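/- A decision tree over the variables $x_1,\dots,x_n$ is a rooted binary tree whose internal nodes are labeled with variables and whose leaves are labeled with $0$ or $1$; it computes a Boolean function $\{0,1\}^n\to\{0,1\}$ by following, at a node labeled $x_i$, the left child if $x_i=0$ and the right child if $x_i=1$. Its size is the number of its leaves and its depth is the maximal number of edges on a path from the root to a leaf. Let $\mathbb{DT}_d^s$ be the class of decision trees over $x_1,\dots,x_n$ of depth at most $d$ and size at most $s$. A black box query for an unknown function $f$ takes $a\in\{0,1\}^n$ and returns $f(a)$. **Theorem.** The class $\mathbb{DT}_d^s$ is deterministically exactly properly learnable from $m=2^{2d+o(d)}\log n$ black box queries in time $s^{O(d)}+O(mn)$, where the $o(d)$ term is $O(\log^2 d)$. That is, there are a single deterministic algorithm, a constant $c$ and a function $g:\mathbb{N}\to\mathbb{R}$ with $g(d)=O(\log^2 d)$ as $d\to\infty$ such that for all $n\ge 2$, all $d,s\ge 0$ and every $f$ computed by a tree in $\mathbb{DT}_d^s$, the algorithm, given $n,d,s$ and black box access to $f$, asks at most $m:=2^{2d+g(d)}\log_2 n$ (adaptive) queries, halts within $s^{cd}+c\,m\,n$ steps, and outputs a decision tree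 in $\mathbb{DT}_d^s$ that computes exactly $f$. Time is measured on a word RAM with unit-cost arithmetic and memory access, on which a query costs $n+1$ steps and all words are smaller than $(n(s+2)^{d+1})^{c}$, i.e. have $O(\log n+(d+1)\log(s+2))$ bits. -/

import Mathlib

namespace DTLearn

/-! ### Decision trees -/

/-- Decision trees over the variables `x_0, …, x_{n-1}`; in `node i l r` the left subtree `l` is
taken when `x_i = 0` and the right subtree `r` when `x_i = 1`. -/
inductive DTree (n : ℕ) : Type
  | leaf (b : Bool) : DTree n
  | node (i : Fin n) (l r : DTree n) : DTree n

namespace DTree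

variable {n : ℕ}

/-- The Boolean function computed by a decision tree. -/
def eval : DTree n → (Fin n → Bool) → Bool
  | leaf b, _ => b
  | node i l r, x => if x i then r.eval x else l.eval x

/-- The size: the number of leaves. -/
def size : DTree n → ℕ
  | leaf _ => 1
  | node _ l r => l.size + r.size

/-- The depth: the maximal number of edges from the root to a leaf. -/
def depth : DTree n → ℕ
  | leaf _ => 0
  | node _ l r => max l.depth r.depth + 1

/-- Preorder code of a tree as a list of words: a leaf is written `0` or `1` (its label), an
internal node labelled `x_i` is written `i + 2`, followed by its left and its right subtree. -/
def code : DTree n → List ℕ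
  | leaf b => [b.toNat]
  | node i l r => (i.val + 2) :: (l.code ++ r.code)

end DTree

/-- The class of decision trees of depth at most `d` and size at most `s` on `n` variables. -/
def DT (n d s : ℕ) : Set (DTree n) := {T | T.depth ≤ d ∧ T.size ≤ s}

/-! ### The machine model: structured word-RAM programs with a black-box query instruction

A program is a fixed finite object. The memory consists of registers and of (finitely many, for
each program) arrays with random access. Every elementary operation costs one step. Every value
that occurs in a run has to be smaller than a word bound `w`: there is no run in which a larger
value occurs. -/

/-- Memory contents: register `x` holds `reg x`, cell `i` of array `a` holds `arr a i`. -/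
structure State : Type where
  reg : ℕ → ℕ
  arr : ℕ → ℕ → ℕ

namespace State

def setReg (σ : State) (x v : ℕ) : State :=
  { σ with reg := Function.update σ.reg x v }

def setArr (σ : State) (a i v : ℕ) : State :=
  { σ with arr := Function.update σ.arr a (Function.update (σ.arr a) i v) }

end State

/-- Arithmetic operations on words (`sub` is truncated subtraction). -/
inductive Op : Type
  | add | sub | mul | div | mod

def Op.apply : Op → ℕ → ℕ → ℕ
  | add, u, v => u + v
  | sub, u, v => u - v
  | mul, u, v => u * v
  | div, u, v => u / v
  | mod, u, v => u % v

/-- Expressions; `load a e` is the content of cell `e` of array `a`. -/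
inductive Expr : Type
  | const (k : ℕ)
  | reg (x : ℕ)
  | load (a : ℕ) (e : Expr)
  | op (o : Op) (e₁ e₂ : Expr)

namespace Expr

def eval (σ : State) : Expr → ℕ
  | const k => k
  | reg x => σ.reg x
  | load a e => σ.arr a (e.eval σ)
  | op o e₁ e₂ => o.apply (e₁.eval σ) (e₂.eval σ)

/-- One step for each constant, register access, array access and arithmetic operation. -/
def cost : Expr → ℕ
  | const _ => 1
  | reg _ => 1
  | load _ e => e.cost + 1
  | op _ e₁ e₂ => e₁.cost + e₂.cost + 1

/-- All values that occur while the expression is evaluated are smaller than `w`. -/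
def Fits (w : ℕ) (σ : State) : Expr → Prop
  | const k => k < w
  | reg x => σ.reg x < w
  | load a e => e.Fits w σ ∧ σ.arr a (e.eval σ) < w
  | op o e₁ e₂ => e₁.Fits w σ ∧ e₂.Fits w σ ∧ o.apply (e₁.eval σ) (e₂.eval σ) < w

end Expr

/-- Programs. `query x a` asks the black box for the value of the unknown function at the
assignment stored in array `a` and puts the answer into register `x`. -/
inductive Prog : Type
  | skip
  | assign (x : ℕ) (e : Expr)
  | store (a : ℕ) (i e : Expr)
  | query (x a : ℕ)
  | seq (p q : Prog)
  | cond (e : Expr) (p q : Prog)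
  | loop (e : Expr) (p : Prog)

/-- The assignment in `{0,1}^n` stored in the first `n` cells of array `a`. -/
def State.point (σ : State) (n a : ℕ) : Fin n → Bool :=
  fun i => decide (σ.arr a i ≠ 0)

/-- `Exec w f p σ σ' t m`: with words smaller than `w` and black box `f`, the program `p` started
in `σ` halts in `σ'` after `t` steps, having asked `m` black-box queries. Branches and loops test
whether an expression is nonzero; a query to a function of `n` variables costs `n + 1` steps. -/
inductive Exec {n : ℕ} (w : ℕ) (f : (Fin n → Bool) → Bool) :
    Prog → State → State → ℕ → ℕ → Prop
  | skip (σ : State) : Exec w f Prog.skip σ σ 1 0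
  | assign (σ : State) (x : ℕ) (e : Expr) (h : e.Fits w σ) :
      Exec w f (Prog.assign x e) σ (σ.setReg x (e.eval σ)) (e.cost + 1) 0
  | store (σ : State) (a : ℕ) (i e : Expr) (hi : i.Fits w σ) (he : e.Fits w σ) :
      Exec w f (Prog.store a i e) σ (σ.setArr a (i.eval σ) (e.eval σ)) (i.cost + e.cost + 1) 0
  | query (σ : State) (x a : ℕ) :
      Exec w f (Prog.query x a) σ (σ.setReg x (f (σ.point n a)).toNat) (n + 1) 1
  | seq {p q : Prog} {σ σ₁ σ₂ : State} {t₁ t₂ m₁ m₂ : ℕ}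
      (h₁ : Exec w f p σ σ₁ t₁ m₁) (h₂ : Exec w f q σ₁ σ₂ t₂ m₂) :
      Exec w f (Prog.seq p q) σ σ₂ (t₁ + t₂) (m₁ + m₂)
  | cond_true {e : Expr} {p q : Prog} {σ σ₁ : State} {t m : ℕ}
      (hf : e.Fits w σ) (he : e.eval σ ≠ 0) (h : Exec w f p σ σ₁ t m) :
      Exec w f (Prog.cond e p q) σ σ₁ (e.cost + 1 + t) m
  | cond_false {e : Expr} {p q : Prog} {σ σ₁ : State} {t m : ℕ}
      (hf : e.Fits w σ) (he : e.eval σ = 0) (h : Exec w f q σ σ₁ t m) :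
      Exec w f (Prog.cond e p q) σ σ₁ (e.cost + 1 + t) m
  | loop_done {e : Expr} {p : Prog} {σ : State} (hf : e.Fits w σ) (he : e.eval σ = 0) :
      Exec w f (Prog.loop e p) σ σ (e.cost + 1) 0
  | loop_step {e : Expr} {p : Prog} {σ σ₁ σ₂ : State} {t₁ t₂ m₁ m₂ : ℕ}
      (hf : e.Fits w σ) (he : e.eval σ ≠ 0) (h₁ : Exec w f p σ σ₁ t₁ m₁)
      (h₂ : Exec w f (Prog.loop e p) σ₁ σ₂ t₂ m₂) :
      Exec w f (Prog.loop e p) σ σ₂ (e.cost + 1 + t₁ + t₂) (m₁ + m₂)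

/-- Initially registers `0, 1, 2` hold `n, d, s`; all other registers and all cells hold `0`. -/
def init (n d s : ℕ) : State where
  reg := fun x => if x = 0 then n else if x = 1 then d else if x = 2 then s else 0
  arr := fun _ _ => 0

/-- The output is the tree whose preorder code is written at the beginning of array `0`. -/
def Outputs {n : ℕ} (σ : State) (T : DTree n) : Prop :=
  ∀ (j : ℕ) (hj : j < T.code.length), σ.arr 0 j = T.code[j]

/-- The program `P`, run on `n, d, s` with words smaller than `w` and black-box access to `f`,
halts within `time` steps after at most `queries` queries and outputs a decision tree of depth at
most `d` and size at most `s` that computes exactly `f`. -/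
def LearnsExactlyProperly (P : Prog) (w n d s : ℕ) (f : (Fin n → Bool) → Bool)
    (queries time : ℝ) : Prop :=
  ∃ (σ : State) (t m : ℕ) (T : DTree n),
    Exec w f P (init n d s) σ t m ∧ Outputs σ T ∧ T ∈ DT n d s ∧ T.eval = f ∧
      (m : ℝ) ≤ queries ∧ (t : ℝ) ≤ time

end DTLearn

namespace DTLearn

/-! ### A program logic with time and query bounds -/

/-! Let `dd = min d (s - 1)` and `k = 2 * dd + 1`. On each input a tree of depth at most `dd` is
certified by the at most `dd` variables of one path. So fixing at most `2 * dd` variables tells two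
different trees apart, and fixing that many around one free variable exposes a relevant variable. It
therefore suffices to have few samples, each giving every variable a class 0, 1 or 2 (2 meaning
free), that realize every bit pattern on fewer than `k` variables together with class 2 at a further
one (`Sampling`).

Such samples are built in two stages. An index is hashed into `ℤ/Q` by evaluating the polynomial of
its base `Q` digits at a point; since few points are spoiled by each pair, some point separates any
`k` indices (`exists_ev_injOn`). On the hashed domain, polynomials with `k` coefficients take
independent values at `k` points (`card_ev_mem`). If class 2 receives about `1 / (4k)` of the
values, every satisfiable constraint is met by a share `1 / (4k * 2^k)` of the polynomials
(`card_prescribed`, `card_covers`). Greedy set cover then needs only `4k * 2^k * k * log Q` rounds,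
up to rounding (`Greedy.covers`). The factor `2^k = 2 * 4^dd` yields the `2^(2d)` of the theorem;
everything else is polynomial in `k` times `log n`.

Learning asks, for each sample, for the two points in which the unmarked free variables are all 0 or
all 1. If the answers differ, a binary search along hybrids isolates an unmarked relevant variable
with `log n` further queries (`relevant_of_hybrid_ne`, `runs_search`). If they never differ any
more, all relevant variables are marked (`Sampling.marked`). A dynamic program over sequences of
literals then finds a smallest tree of bounded depth consistent with the samples
(`DPEq.exists_reads`), and agreement on the samples forces it to compute `f` (`Sampling.eval_eq`).

The construction takes time `Q ^ O(k)` with `Q` of order `k^3 * log n`. The powers of `log n` are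
traded for a function of `k` plus a multiple of `n` (`log_pow_mul_le`), and `dd < s` turns `k ^
O(k)` into `s ^ O(dd)` (`depth_pow_le`). To keep the query count linear in `log n`,
`exists_goodPrime` bounds the prime multiplied by its own binary length. The program itself is
verified in a Hoare logic (`Runs`) that carries time, queries and a syntactic frame condition. -/

instance : Add Expr := ⟨Expr.op .add⟩
instance : Sub Expr := ⟨Expr.op .sub⟩
instance : Mul Expr := ⟨Expr.op .mul⟩
instance : Div Expr := ⟨Expr.op .div⟩
instance : Mod Expr := ⟨Expr.op .mod⟩
instance (k : ℕ) : OfNat Expr k := ⟨Expr.const k⟩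

abbrev rg : ℕ → Expr := Expr.reg
abbrev ld : ℕ → Expr → Expr := Expr.load

infixr:50 " ⨟ " => Prog.seq
infix:60 " ⇐ " => Prog.assign

/-- The expression fits into words smaller than `w`, provided that all memory contents do. -/
def Expr.Ok (w : ℕ) (σ : State) : Expr → Prop
  | const k => k < 64
  | reg _ => True
  | load _ e => e.Ok w σ
  | op o e₁ e₂ => e₁.Ok w σ ∧ e₂.Ok w σ ∧
      match o with
      | .add => e₁.eval σ + e₂.eval σ < w
      | .mul => e₁.eval σ * e₂.eval σ < w
      | _ => True

section simp_lemmas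

variable (w : ℕ) (σ : State) (a b : Expr) (k x v y i j u : ℕ)

@[simp] theorem Expr.eval_num : Expr.eval σ (no_index (OfNat.ofNat k)) = k := rfl
@[simp] theorem Expr.eval_reg : (Expr.reg x).eval σ = σ.reg x := rfl
@[simp] theorem Expr.eval_load : (Expr.load x a).eval σ = σ.arr x (a.eval σ) := rfl
@[simp] theorem Expr.eval_add : (a + b).eval σ = a.eval σ + b.eval σ := rfl
@[simp] theorem Expr.eval_sub : (a - b).eval σ = a.eval σ - b.eval σ := rfl
@[simp] theorem Expr.eval_mul : (a * b).eval σ = a.eval σ * b.eval σ := rfl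
@[simp] theorem Expr.eval_div : (a / b).eval σ = a.eval σ / b.eval σ := rfl
@[simp] theorem Expr.eval_mod : (a % b).eval σ = a.eval σ % b.eval σ := rfl

@[simp] theorem Expr.ok_num : Expr.Ok w σ (no_index (OfNat.ofNat k)) ↔ k < 64 := Iff.rfl
@[simp] theorem Expr.ok_reg : (Expr.reg x).Ok w σ := trivial
@[simp] theorem Expr.ok_load : (Expr.load x a).Ok w σ ↔ a.Ok w σ := Iff.rfl
@[simp] theorem Expr.ok_add :
    (a + b).Ok w σ ↔ a.Ok w σ ∧ b.Ok w σ ∧ a.eval σ + b.eval σ < w := Iff.rfl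
@[simp] theorem Expr.ok_mul :
    (a * b).Ok w σ ↔ a.Ok w σ ∧ b.Ok w σ ∧ a.eval σ * b.eval σ < w := Iff.rfl
@[simp] theorem Expr.ok_sub : (a - b).Ok w σ ↔ a.Ok w σ ∧ b.Ok w σ := by
  change _ ∧ _ ∧ True ↔ _; simp
@[simp] theorem Expr.ok_div : (a / b).Ok w σ ↔ a.Ok w σ ∧ b.Ok w σ := by
  change _ ∧ _ ∧ True ↔ _; simp
@[simp] theorem Expr.ok_mod : (a % b).Ok w σ ↔ a.Ok w σ ∧ b.Ok w σ := by
  change _ ∧ _ ∧ True ↔ _; simp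

@[simp] theorem State.reg_setReg :
    (σ.setReg x v).reg y = if y = x then v else σ.reg y := by
  simp [State.setReg, Function.update_apply]
@[simp] theorem State.arr_setReg : (σ.setReg x v).arr = σ.arr := rfl
@[simp] theorem State.reg_setArr : (σ.setArr x i v).reg = σ.reg := rfl
@[simp] theorem State.arr_setArr :
    (σ.setArr x i v).arr y j = if y = x ∧ j = i then v else σ.arr y j := by
  by_cases h : y = x
  · subst h; simp [State.setArr, Function.update_apply]
  · simp [State.setArr, h]

end simp_lemmas

/-- All memory contents are smaller than `w`. -/
structure Small (w : ℕ) (σ : State) : Prop where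
  large : 64 ≤ w
  reg : ∀ x, σ.reg x < w
  arr : ∀ a i, σ.arr a i < w

/-- Subtraction, division and remainder never exceed their first operand and memory contents are
small by assumption, so only sums and products need a check. Constants stay below 64, which `Small`
puts below `w`. -/
theorem Expr.Ok.fits {w : ℕ} {σ : State} (hσ : Small w σ) :
    ∀ {e : Expr}, e.Ok w σ → e.Fits w σ
  | .const k, h => lt_of_lt_of_le (show k < 64 from h) hσ.large
  | .reg x, _ => hσ.reg x
  | .load a _, h => ⟨Expr.Ok.fits hσ h, hσ.arr a _⟩
  | .op o a b, ⟨h₁, h₂, h₃⟩ => by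
    have f₁ := Expr.Ok.fits hσ h₁
    have f₂ := Expr.Ok.fits hσ h₂
    have lt : ∀ {e : Expr}, e.Fits w σ → e.eval σ < w := by
      intro e he
      cases e with
      | const => exact he
      | reg => exact he
      | load => exact he.2
      | op => exact he.2.2
    refine ⟨f₁, f₂, ?_⟩
    cases o with
    | add => exact h₃
    | mul => exact h₃
    | sub => exact lt_of_le_of_lt (Nat.sub_le _ _) (lt f₁)
    | div => exact lt_of_le_of_lt (Nat.div_le_self _ _) (lt f₁)
    | mod => exact lt_of_le_of_lt (Nat.mod_le _ _) (lt f₁)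

theorem Expr.Fits.eval_lt {w : ℕ} {σ : State} : ∀ {e : Expr}, e.Fits w σ → e.eval σ < w
  | .const _, h => h
  | .reg _, h => h
  | .load _ _, h => h.2
  | .op _ _ _, h => h.2.2

/-! ### Syntactic write sets and the frame rule -/

/-- Whether the program may write register `x`. -/
def Prog.wrReg : Prog → ℕ → Bool
  | skip, _ => false
  | assign x _, y => x == y
  | store _ _ _, _ => false
  | query x _, y => x == y
  | seq p q, y => p.wrReg y || q.wrReg y
  | cond _ p q, y => p.wrReg y || q.wrReg y
  | loop _ p, y => p.wrReg y

/-- Whether the program may write array `a`. -/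
def Prog.wrArr : Prog → ℕ → Bool
  | skip, _ => false
  | assign _ _, _ => false
  | store a _ _, b => a == b
  | query _ _, _ => false
  | seq p q, y => p.wrArr y || q.wrArr y
  | cond _ p q, y => p.wrArr y || q.wrArr y
  | loop _ p, y => p.wrArr y

/-- The states agree on everything that `p` does not write. -/
structure Agree (p : Prog) (σ σ' : State) : Prop where
  reg : ∀ x, p.wrReg x = false → σ'.reg x = σ.reg x
  arr : ∀ a, p.wrArr a = false → σ'.arr a = σ.arr a

theorem Agree.refl (p : Prog) (σ : State) : Agree p σ σ := ⟨fun _ _ => rfl, fun _ _ => rfl⟩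

theorem Agree.trans {p : Prog} {σ₁ σ₂ σ₃ : State} (h : Agree p σ₁ σ₂) (h' : Agree p σ₂ σ₃) :
    Agree p σ₁ σ₃ :=
  ⟨fun x hx => (h'.reg x hx).trans (h.reg x hx), fun x hx => (h'.arr x hx).trans (h.arr x hx)⟩

theorem Agree.weaken {p q : Prog} {σ σ' : State} (h : Agree p σ σ')
    (hr : ∀ x, q.wrReg x = false → p.wrReg x = false)
    (ha : ∀ x, q.wrArr x = false → p.wrArr x = false) : Agree q σ σ' :=
  ⟨fun x hx => h.reg x (hr x hx), fun x hx => h.arr x (ha x hx)⟩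

variable {n w : ℕ} {f : (Fin n → Bool) → Bool}

/-- The frame rule. Write sets are computed from the syntax, so that survival of a register or array
is settled by `rfl` or `decide` in all later proofs. -/
theorem Exec.agree {p : Prog} {σ σ' : State} {t m : ℕ} (h : Exec w f p σ σ' t m) :
    Agree p σ σ' := by
  induction h with
  | skip => exact Agree.refl _ _
  | assign σ x e _ =>
    refine ⟨fun y hy => ?_, fun _ _ => rfl⟩
    have : y ≠ x := by rintro rfl; simp [Prog.wrReg] at hy
    simp [this]
  | store σ a i e _ _ =>
    refine ⟨fun _ _ => rfl, fun b hb => ?_⟩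
    have : b ≠ a := by rintro rfl; simp [Prog.wrArr] at hb
    funext j; simp [this]
  | query σ x a =>
    refine ⟨fun y hy => ?_, fun _ _ => rfl⟩
    have : y ≠ x := by rintro rfl; simp [Prog.wrReg] at hy
    simp [this]
  | seq _ _ ih₁ ih₂ =>
    refine (ih₁.weaken ?_ ?_).trans (ih₂.weaken ?_ ?_) <;>
      simp +contextual [Prog.wrReg, Prog.wrArr]
  | cond_true _ _ _ ih => exact ih.weaken (by simp +contextual [Prog.wrReg]) (by simp +contextual [Prog.wrArr])
  | cond_false _ _ _ ih => exact ih.weaken (by simp +contextual [Prog.wrReg]) (by simp +contextual [Prog.wrArr])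
  | loop_done => exact Agree.refl _ _
  | loop_step _ _ _ _ ih₁ ih₂ =>
    exact (ih₁.weaken (by simp [Prog.wrReg]) (by simp [Prog.wrArr])).trans ih₂

/-- A run only admits values below `w`, and an answer is at most 1; hence the word bound has to be
checked for the initial state only. -/
theorem Exec.small {p : Prog} {σ σ' : State} {t m : ℕ} (h : Exec w f p σ σ' t m)
    (hs : Small w σ) : Small w σ' := by
  induction h with
  | skip => exact hs
  | assign σ x e he =>
    refine ⟨hs.large, fun y => ?_, hs.arr⟩
    rw [State.reg_setReg]; split
    · exact he.eval_lt
    · exact hs.reg y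
  | store σ a i e _ he =>
    refine ⟨hs.large, hs.reg, fun b j => ?_⟩
    rw [State.arr_setArr]; split
    · exact he.eval_lt
    · exact hs.arr b j
  | query σ x a =>
    refine ⟨hs.large, fun y => ?_, hs.arr⟩
    rw [State.reg_setReg]; split
    · have := Bool.toNat_le (f (σ.point n a))
      have := hs.large
      omega
    · exact hs.reg y
  | seq _ _ ih₁ ih₂ => exact ih₂ (ih₁ hs)
  | cond_true _ _ _ ih => exact ih hs
  | cond_false _ _ _ ih => exact ih hs
  | loop_done => exact hs
  | loop_step _ _ _ _ ih₁ ih₂ => exact ih₂ (ih₁ hs)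

/-- Started in `σ` with all memory contents smaller than `w`, the program `p` halts within `T`
steps and `M` queries in a state satisfying `Q`. -/
def Runs (w : ℕ) (f : (Fin n → Bool) → Bool) (p : Prog) (σ : State) (T M : ℕ)
    (Q : State → Prop) : Prop :=
  Small w σ → ∃ (σ' : State) (t m : ℕ), Exec w f p σ σ' t m ∧ t ≤ T ∧ m ≤ M ∧ Q σ'

namespace Runs

variable {p q : Prog} {e : Expr} {σ : State} {T T' T₁ T₂ M M' M₁ M₂ : ℕ} {P Q Q' : State → Prop}

theorem mono (h : Runs w f p σ T M Q) (hT : T ≤ T') (hM : M ≤ M') (hQ : ∀ σ', Q σ' → Q' σ') :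
    Runs w f p σ T' M' Q' := by
  intro hs
  obtain ⟨σ', t, m, h₁, h₂, h₃, h₄⟩ := h hs
  exact ⟨σ', t, m, h₁, h₂.trans hT, h₃.trans hM, hQ _ h₄⟩

theorem post (h : Runs w f p σ T M Q)
    (hQ : ∀ σ', Q σ' → Agree p σ σ' → Small w σ' → Q' σ') : Runs w f p σ T M Q' := by
  intro hs
  obtain ⟨σ', t, m, h₁, h₂, h₃, h₄⟩ := h hs
  exact ⟨σ', t, m, h₁, h₂, h₃, hQ _ h₄ h₁.agree (h₁.small hs)⟩

/-- The second program may use the frame and the word bound besides `P`, so intermediate assertions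
need only mention what the first program changes. -/
theorem seq (h₁ : Runs w f p σ T₁ M₁ P)
    (h₂ : ∀ σ₁, P σ₁ → Agree p σ σ₁ → Small w σ₁ → Runs w f q σ₁ T₂ M₂ Q) :
    Runs w f (p ⨟ q) σ (T₁ + T₂) (M₁ + M₂) Q := by
  intro hs
  obtain ⟨σ₁, t, m, e₁, ht, hm, hP⟩ := h₁ hs
  obtain ⟨σ₂, t', m', e₂, ht', hm', hQ⟩ := h₂ σ₁ hP e₁.agree (e₁.small hs) (e₁.small hs)
  exact ⟨σ₂, _, _, e₁.seq e₂, by omega, by omega, hQ⟩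

theorem cond (he : e.Ok w σ) (h₁ : e.eval σ ≠ 0 → Runs w f p σ T M Q)
    (h₂ : e.eval σ = 0 → Runs w f q σ T M Q) :
    Runs w f (.cond e p q) σ (e.cost + 1 + T) M Q := by
  intro hs
  by_cases h : e.eval σ = 0
  · obtain ⟨σ₁, t, m, e₁, ht, hm, hP⟩ := h₂ h hs
    exact ⟨σ₁, _, _, .cond_false (he.fits hs) h e₁, by omega, hm, hP⟩
  · obtain ⟨σ₁, t, m, e₁, ht, hm, hP⟩ := h₁ h hs
    exact ⟨σ₁, _, _, .cond_true (he.fits hs) h e₁, by omega, hm, hP⟩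

/-- While loops, with a time potential `Φ` and a query potential `Ψ`. -/
theorem loop (Inv : State → Prop) (Φ Ψ : State → ℕ) (h₀ : Inv σ)
    (he : ∀ σ₁, Inv σ₁ → Agree p σ σ₁ → Small w σ₁ → e.Ok w σ₁)
    (hstep : ∀ σ₁, Inv σ₁ → Agree p σ σ₁ → Small w σ₁ → e.eval σ₁ ≠ 0 →
      ∃ T₁ M₁, Runs w f p σ₁ T₁ M₁ fun σ₂ => Inv σ₂ ∧
        T₁ + e.cost + 1 + Φ σ₂ ≤ Φ σ₁ ∧ M₁ + Ψ σ₂ ≤ Ψ σ₁) :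
    Runs w f (.loop e p) σ (Φ σ + e.cost + 1) (Ψ σ) fun σ' => Inv σ' ∧ e.eval σ' = 0 := by
  intro hs
  -- Induction on a bound for the time potential, which drops in every round because testing the
  -- condition already costs a step.
  suffices H : ∀ N σ₁, Φ σ₁ ≤ N → Inv σ₁ → Agree p σ σ₁ → Small w σ₁ →
      ∃ (σ' : State) (t m : ℕ), Exec w f (.loop e p) σ₁ σ' t m ∧ t ≤ Φ σ₁ + e.cost + 1 ∧
        m ≤ Ψ σ₁ ∧ Inv σ' ∧ e.eval σ' = 0 from
    H _ σ le_rfl h₀ (Agree.refl _ _) hs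
  intro N
  induction N with
  | zero =>
    intro σ₁ hN hI hA hS
    by_cases h : e.eval σ₁ = 0
    · exact ⟨σ₁, _, _, .loop_done ((he _ hI hA hS).fits hS) h, by omega, by omega, hI, h⟩
    · obtain ⟨T₁, M₁, hr⟩ := hstep σ₁ hI hA hS h
      obtain ⟨σ₂, t, m, _, _, _, _, h₅, _⟩ := hr hS
      omega
  | succ N ih =>
    intro σ₁ hN hI hA hS
    by_cases h : e.eval σ₁ = 0
    · exact ⟨σ₁, _, _, .loop_done ((he _ hI hA hS).fits hS) h, by omega, by omega, hI, h⟩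
    · obtain ⟨T₁, M₁, hr⟩ := hstep σ₁ hI hA hS h
      obtain ⟨σ₂, t, m, e₁, ht, hm, hI₂, h₅, h₆⟩ := hr hS
      obtain ⟨σ₃, t', m', e₂, ht', hm', hI₃, h₇⟩ :=
        ih σ₂ (by omega) hI₂ (hA.trans e₁.agree) (e₁.small hS)
      exact ⟨σ₃, _, _, .loop_step ((he _ hI hA hS).fits hS) h e₁ e₂, by omega, by omega, hI₃, h₇⟩

end Runs

/-- Weakest precondition of a loop-free program. -/
def Prog.wp (w : ℕ) (f : (Fin n → Bool) → Bool) : Prog → (State → Prop) → State → Prop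
  | skip, Q, σ => Q σ
  | assign x e, Q, σ => e.Ok w σ ∧ Q (σ.setReg x (e.eval σ))
  | store a i e, Q, σ => i.Ok w σ ∧ e.Ok w σ ∧ Q (σ.setArr a (i.eval σ) (e.eval σ))
  | query x a, Q, σ => Q (σ.setReg x (f (σ.point n a)).toNat)
  | seq p q, Q, σ => p.wp w f (q.wp w f Q) σ
  | cond e p q, Q, σ => e.Ok w σ ∧ (e.eval σ ≠ 0 → p.wp w f Q σ) ∧ (e.eval σ = 0 → q.wp w f Q σ)
  | loop _ _, _, _ => False

/-- Upper bound for the running time of a loop-free program without queries. -/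
def Prog.time : Prog → ℕ
  | skip => 1
  | assign _ e => e.cost + 1
  | store _ i e => i.cost + e.cost + 1
  | query _ _ => 0
  | seq p q => p.time + q.time
  | cond e p q => e.cost + 1 + max p.time q.time
  | loop _ _ => 0

/-- Upper bound for the number of queries of a loop-free program. -/
def Prog.queries : Prog → ℕ
  | query _ _ => 1
  | seq p q => p.queries + q.queries
  | cond _ p q => max p.queries q.queries
  | _ => 0

/-- The costs of a loop-free program can be read off its syntax, with `n + 1` steps charged per
query; only the weakest precondition remains to be proved. -/
theorem Runs.block : ∀ {p : Prog} {σ : State} {Q : State → Prop}, p.wp w f Q σ →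
    Runs w f p σ (p.time + p.queries * (n + 1)) p.queries Q
  | .skip, σ, Q, h => fun _ => ⟨σ, _, _, .skip σ, by simp [Prog.time], by simp, h⟩
  | .assign x e, σ, Q, h => fun hs =>
      ⟨_, _, _, .assign σ x e (h.1.fits hs), by simp [Prog.time], by simp, h.2⟩
  | .store a i e, σ, Q, h => fun hs =>
      ⟨_, _, _, .store σ a i e (h.1.fits hs) (h.2.1.fits hs), by simp [Prog.time], by simp, h.2.2⟩
  | .query x a, σ, Q, h => fun _ =>
      ⟨_, _, _, .query σ x a, by simp [Prog.time, Prog.queries], by simp [Prog.queries], h⟩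
  | .seq p q, σ, Q, h => by
      refine (Runs.seq (Runs.block (p := p) h) (fun σ₁ h₁ _ _ => Runs.block (p := q) h₁)).mono
        ?_ le_rfl fun _ h => h
      simp only [Prog.time, Prog.queries]; ring_nf; rfl
  | .cond e p q, σ, Q, h => by
      have hq : ∀ a b : ℕ, a ≤ b → a * (n + 1) ≤ b * (n + 1) := fun a b hab =>
        Nat.mul_le_mul_right _ hab
      have h₁ := hq _ _ (le_max_left p.queries q.queries)
      have h₂ := hq _ _ (le_max_right p.queries q.queries)
      refine (Runs.cond (T := max p.time q.time + max p.queries q.queries * (n + 1))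
        (M := max p.queries q.queries) h.1
        (fun he => (Runs.block (h.2.1 he)).mono ?_ (le_max_left _ _) fun _ h => h)
        (fun he => (Runs.block (h.2.2 he)).mono ?_ (le_max_right _ _) fun _ h => h)).mono
        ?_ le_rfl fun _ h => h
      · have := le_max_left p.time q.time; omega
      · have := le_max_right p.time q.time; omega
      · simp only [Prog.time, Prog.queries]; omega
  | .loop _ _, _, _, h => h.elim

/-- `for i < b do p`, for registers `i` and `b`. -/
def Prog.forLt (i b : ℕ) (p : Prog) : Prog :=
  i ⇐ 0 ⨟ .loop (rg b - rg i) (p ⨟ i ⇐ (rg i + 1))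

/-- The body does not write the counter and the loop does not write the bound, so there are exactly
`N` rounds. Of the 8 extra steps per round, 4 test the condition and 4 increment the counter. -/
theorem Runs.forLt {i b : ℕ} {p : Prog} {σ : State} {T M : ℕ} (Inv : ℕ → State → Prop) (N : ℕ)
    (hi : p.wrReg i = false) (hb : (Prog.forLt i b p).wrReg b = false)
    (hN : σ.reg b = N) (h₀ : Inv 0 (σ.setReg i 0))
    (hstep : ∀ j σ₁, j < N → Inv j σ₁ → σ₁.reg i = j → Agree (Prog.forLt i b p) σ σ₁ →
      Small w σ₁ → Runs w f p σ₁ T M fun σ₂ => Inv (j + 1) (σ₂.setReg i (j + 1))) :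
    Runs w f (Prog.forLt i b p) σ (N * (T + 8) + 6) (N * M) fun σ' => Inv N σ' ∧ σ'.reg i = N := by
  have hib : i ≠ b := by
    rintro rfl; simp [Prog.forLt, Prog.wrReg] at hb
  refine (Runs.seq (T₁ := 2) (M₁ := 0) (P := fun σ' => σ' = σ.setReg i 0)
    ((Runs.block (p := i ⇐ 0) (by simp [Prog.wp])).mono ?_ ?_ fun _ h => h)
    (T₂ := N * (T + 8) + 4) (M₂ := N * M) ?_).mono (by omega) (by omega) fun _ h => h
  · simp [Prog.time, Prog.queries, Expr.cost]
  · simp [Prog.queries]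
  rintro σ₁ rfl - -
  refine ((Runs.loop (fun σ' => ∃ j, j ≤ N ∧ σ'.reg i = j ∧ Inv j σ')
    (fun σ' => (N - σ'.reg i) * (T + 8)) (fun σ' => (N - σ'.reg i) * M) ?_ ?_ ?_).post
    (Q' := fun σ' => Inv N σ' ∧ σ'.reg i = N) ?_).mono ?_ ?_ fun _ h => h
  · exact ⟨0, by omega, by simp, h₀⟩
  · intros; simp
  · rintro σ₁ ⟨j, hj, hij, hI⟩ hA hS he
    have hA' : Agree (Prog.forLt i b p) σ σ₁ := by
      refine Agree.trans ?_ (hA.weaken (fun x => ?_) fun x => ?_)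
      · refine ⟨fun x hx => ?_, fun _ _ => rfl⟩
        have : x ≠ i := by rintro rfl; simp [Prog.forLt, Prog.wrReg] at hx
        simp [this]
      · simp [Prog.forLt, Prog.wrReg]
      · simp [Prog.forLt, Prog.wrArr]
    have hbN : σ₁.reg b = N := (hA'.reg b hb).trans hN
    simp only [Expr.eval_sub, Expr.eval_reg, hbN, hij] at he
    have hjN : j < N := by omega
    refine ⟨T + 4, M, ((hstep j σ₁ hjN hI hij hA' hS).seq (T₂ := 4) (M₂ := 0) ?_)⟩
    intro σ₂ hσ₂ hA₂ hS₂
    have h2 : σ₂.reg i = j := (hA₂.reg i hi).trans hij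
    have hlt : j + 1 < w := by
      have := hS₂.reg b
      rw [hA₂.reg b (by simp [Prog.forLt, Prog.wrReg] at hb; simp [hb]), hbN] at this
      omega
    refine (Runs.block (p := i ⇐ (rg i + 1)) (Q := fun σ' => σ' = σ₂.setReg i (j + 1)) ?_).mono
      ?_ ?_ ?_
    · simp [Prog.wp, h2, hlt]
    · simp [Prog.time, Prog.queries]; exact le_refl 4
    · simp [Prog.queries]
    · rintro _ rfl
      refine ⟨⟨j + 1, hjN, by simp, hσ₂⟩, ?_, ?_⟩
      · simp only [State.reg_setReg, if_true, hij]
        obtain ⟨l, rfl⟩ : ∃ l, N = j + 1 + l := ⟨N - (j + 1), by omega⟩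
        have : j + 1 + l - j = l + 1 := by omega
        rw [this, Nat.add_sub_cancel_left, add_mul]
        have : (rg b - rg i).cost = 3 := rfl
        omega
      · simp only [State.reg_setReg, if_true, hij]
        obtain ⟨l, rfl⟩ : ∃ l, N = j + 1 + l := ⟨N - (j + 1), by omega⟩
        have : j + 1 + l - j = l + 1 := by omega
        rw [this, Nat.add_sub_cancel_left, add_mul]
        omega
  · rintro σ' ⟨⟨j, hj, hij, hI⟩, he⟩ hA -
    have hbN : σ'.reg b = N := by
      rw [hA.reg b, State.reg_setReg, if_neg hib.symm, hN]
      simp only [Prog.forLt, Prog.wrReg, Bool.or_eq_false_iff] at hb ⊢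
      exact hb.2
    simp only [Expr.eval_sub, Expr.eval_reg, hbN, hij] at he
    obtain rfl : j = N := by omega
    exact ⟨hI, hij⟩
  · have : (rg b - rg i).cost = 3 := rfl
    simp [this]
  · simp

end DTLearn

namespace DTLearn

/-! ### Decision trees: certificates, variables, restriction -/

namespace DTree

variable {n : ℕ}

/-- The variables along the computation path of an input certify the value of the tree. -/
theorem exists_certificate (T : DTree n) (z : Fin n → Bool) :
    ∃ P : Finset (Fin n), P.card ≤ T.depth ∧
      ∀ y, (∀ i ∈ P, y i = z i) → T.eval y = T.eval z := by
  induction T with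
  | leaf b => exact ⟨∅, by simp, fun _ _ => rfl⟩
  | node i l r ihl ihr =>
    obtain ⟨P, hP, h⟩ := ihl
    obtain ⟨P', hP', h'⟩ := ihr
    cases hz : z i with
    | false =>
      refine ⟨insert i P, (Finset.card_insert_le _ _).trans ?_, fun y hy => ?_⟩
      · simp only [depth]; omega
      · have := hy i (by simp)
        simp only [eval, this, hz]
        exact h y fun j hj => hy j (by simp [hj])
    | true =>
      refine ⟨insert i P', (Finset.card_insert_le _ _).trans ?_, fun y hy => ?_⟩
      · simp only [depth]; omega
      · have := hy i (by simp)
        simp only [eval, this, hz]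
        exact h' y fun j hj => hy j (by simp [hj])

/-- The set of variables that occur in the tree. -/
def vars : DTree n → Finset (Fin n)
  | leaf _ => ∅
  | node i l r => insert i (l.vars ∪ r.vars)

/-- A binary tree has one internal node fewer than leaves, and each carries one variable. This
bounds the number of relevant variables, hence of binary searches. -/
theorem card_vars_lt_size (T : DTree n) : T.vars.card < T.size := by
  induction T with
  | leaf b => simp [vars, size]
  | node i l r ihl ihr =>
    have h₁ := Finset.card_insert_le i (l.vars ∪ r.vars)
    have h₂ := Finset.card_union_le l.vars r.vars
    simp only [vars, size]; omega

theorem depth_lt_size (T : DTree n) : T.depth < T.size := by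
  induction T with
  | leaf b => simp [depth, size]
  | node i l r ihl ihr => simp only [depth, size]; omega

theorem size_le_two_pow (T : DTree n) : T.size ≤ 2 ^ T.depth := by
  induction T with
  | leaf b => simp [depth, size]
  | node i l r ihl ihr =>
    have h₁ := Nat.pow_le_pow_right (n := 2) (by norm_num) (le_max_left l.depth r.depth)
    have h₂ := Nat.pow_le_pow_right (n := 2) (by norm_num) (le_max_right l.depth r.depth)
    simp only [depth, size, pow_succ]; omega

theorem eval_congr (T : DTree n) {x y : Fin n → Bool} (h : ∀ i ∈ T.vars, x i = y i) :
    T.eval x = T.eval y := by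
  induction T with
  | leaf b => rfl
  | node i l r ihl ihr =>
    simp only [vars, Finset.mem_insert, Finset.mem_union] at h
    simp only [eval, h i (by simp), ihl fun j hj => h j (by simp [hj]),
      ihr fun j hj => h j (by simp [hj])]

/-- Set all variables outside `R` to `0`. -/
def restrict (R : Finset (Fin n)) : DTree n → DTree n
  | leaf b => leaf b
  | node i l r => if i ∈ R then node i (l.restrict R) (r.restrict R) else l.restrict R

theorem eval_restrict (R : Finset (Fin n)) (T : DTree n) (x : Fin n → Bool) :
    (T.restrict R).eval x = T.eval fun i => if i ∈ R then x i else false := by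
  induction T with
  | leaf b => rfl
  | node i l r ihl ihr =>
    by_cases h : i ∈ R <;> simp [restrict, eval, h, ihl, ihr]

theorem depth_restrict_le (R : Finset (Fin n)) (T : DTree n) :
    (T.restrict R).depth ≤ T.depth := by
  induction T with
  | leaf b => rfl
  | node i l r ihl ihr =>
    by_cases h : i ∈ R <;> simp only [restrict, depth, h, if_true, if_false] <;> omega

theorem size_restrict_le (R : Finset (Fin n)) (T : DTree n) :
    (T.restrict R).size ≤ T.size := by
  induction T with
  | leaf b => rfl
  | node i l r ihl ihr =>
    by_cases h : i ∈ R <;> simp only [restrict, size, h, if_true, if_false] <;> omega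

theorem vars_restrict_subset (R : Finset (Fin n)) (T : DTree n) :
    (T.restrict R).vars ⊆ R := by
  induction T with
  | leaf b => simp [restrict, vars]
  | node i l r ihl ihr =>
    by_cases h : i ∈ R
    · simp [restrict, vars, h, Finset.insert_subset_iff, Finset.union_subset_iff, ihl, ihr]
    · simpa [restrict, h] using ihl

end DTree

/-- The variable `i` is relevant for `f`. -/
def Relevant {n : ℕ} (f : (Fin n → Bool) → Bool) (i : Fin n) : Prop :=
  ∃ z, f (Function.update z i false) ≠ f (Function.update z i true)

theorem Relevant.mem_vars {n : ℕ} {T : DTree n} {i : Fin n} (h : Relevant T.eval i) :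
    i ∈ T.vars := by
  obtain ⟨z, hz⟩ := h
  by_contra hi
  refine hz (T.eval_congr fun j hj => ?_)
  have : j ≠ i := by rintro rfl; exact hi hj
  simp [this]

/-- A function does not depend on the variables outside a set with all relevant variables. -/
theorem eval_restrict_relevant {n : ℕ} {f : (Fin n → Bool) → Bool} {R : Finset (Fin n)}
    (hR : ∀ i, Relevant f i → i ∈ R) (x : Fin n → Bool) :
    f (fun i => if i ∈ R then x i else false) = f x := by
  -- The variables outside `R` are set to 0 one at a time; a change of the value would witness that
  -- the variable is relevant.
  have key : ∀ D : Finset (Fin n), (∀ i ∈ D, i ∉ R) →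
      f (fun i => if i ∈ D then false else x i) = f x := by
    intro D
    induction D using Finset.induction_on with
    | empty => simp
    | insert i D hi ih =>
      intro h
      rw [← ih fun j hj => h j (by simp [hj])]
      by_contra hne
      refine h i (by simp) (hR i ⟨fun j => if j ∈ D then false else x j, fun heq => hne ?_⟩)
      set y : Fin n → Bool := fun j => if j ∈ D then false else x j with hy
      have h₁ : (fun j => if j ∈ insert i D then false else x j) = Function.update y i false := by
        funext j
        by_cases hj : j = i
        · subst hj; simp
        · simp [hj, hy]
      rw [h₁]
      cases hyi : y i with
      | false => rw [← hyi, Function.update_eq_self]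
      | true => rw [heq, ← hyi, Function.update_eq_self]
  have := key (Finset.univ.filter (· ∉ R)) (by simp)
  rw [← this]
  congr 1; funext i; by_cases h : i ∈ R <;> simp [h]

end DTLearn

namespace DTLearn

/-! ### Reed–Solomon hashing -/

/-- The value at `x` of the polynomial over `ℤ/Q` whose coefficients are the base `Q` digits
of `i`. -/
def ev (Q x i : ℕ) : ℕ := Nat.ofDigits x (Nat.digits Q i) % Q

theorem ev_zero (Q x : ℕ) : ev Q x 0 = 0 := by simp [ev]

/-- Horner's rule; the machine fills its table of values by this recursion. -/
theorem ev_step {Q : ℕ} (hQ : 1 < Q) (x i : ℕ) :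
    ev Q x i = (i % Q + x * ev Q x (i / Q)) % Q := by
  rcases Nat.eq_zero_or_pos i with rfl | hi
  · simp [ev]
  · rw [ev, Nat.digits_def' hQ hi, Nat.ofDigits_cons, ev]
    simp [Nat.add_mod, Nat.mul_mod]

theorem ev_lt {Q : ℕ} (hQ : 0 < Q) (x i : ℕ) : ev Q x i < Q := Nat.mod_lt _ hQ

open Polynomial in
/-- The polynomial with the given coefficients. -/
noncomputable def digitPoly (Q : ℕ) (L : List ℕ) : (ZMod Q)[X] := Nat.ofDigits X L

theorem coeff_digitPoly (Q : ℕ) : ∀ (L : List ℕ) (j : ℕ),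
    (digitPoly Q L).coeff j = (L.getD j 0 : ZMod Q)
  | [], j => by simp [digitPoly, Nat.ofDigits]
  | a :: L, 0 => by simp [digitPoly, Nat.ofDigits]
  | a :: L, j + 1 => by
    have := coeff_digitPoly Q L j
    simp only [digitPoly] at this
    simp [digitPoly, Nat.ofDigits, Polynomial.coeff_X_mul, this, Polynomial.coeff_natCast_ite]

theorem eval_digitPoly (Q : ℕ) (x : ZMod Q) : ∀ L : List ℕ,
    (digitPoly Q L).eval x = Nat.ofDigits x L
  | [] => by simp [digitPoly, Nat.ofDigits]
  | a :: L => by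
    have := eval_digitPoly Q x L
    simp only [digitPoly] at this
    simp [digitPoly, Nat.ofDigits, this]

theorem eq_of_digits_eq {Q : ℕ} : ∀ {κ i j : ℕ}, i < Q ^ κ → j < Q ^ κ →
    (∀ m, i / Q ^ m % Q = j / Q ^ m % Q) → i = j
  | 0, i, j, hi, hj, _ => by simp at hi hj; omega
  | κ + 1, i, j, hi, hj, h => by
    have hd : i / Q = j / Q := by
      refine eq_of_digits_eq (κ := κ) (Nat.div_lt_of_lt_mul (by rwa [← pow_succ']))
        (Nat.div_lt_of_lt_mul (by rwa [← pow_succ'])) fun m => ?_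
      have := h (m + 1)
      rwa [pow_succ', ← Nat.div_div_eq_div_mul, ← Nat.div_div_eq_div_mul] at this
    have h0 := h 0
    simp only [pow_zero, Nat.div_one] at h0
    rw [← Nat.div_add_mod i Q, ← Nat.div_add_mod j Q, hd, h0]

/-- Two different polynomials with fewer than `κ` coefficients agree on fewer than `κ` points. -/
theorem card_ev_eq_lt {Q : ℕ} (hQ : Q.Prime) {i j κ : ℕ} (hi : i < Q ^ κ) (hj : j < Q ^ κ)
    (hij : i ≠ j) : ((Finset.range Q).filter fun x => ev Q x i = ev Q x j).card < κ := by
  have : Fact Q.Prime := ⟨hQ⟩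
  set P := digitPoly Q (Nat.digits Q i) - digitPoly Q (Nat.digits Q j) with hP
  have hlen : ∀ l < Q ^ κ, (Nat.digits Q l).length ≤ κ := fun l hl =>
    (Nat.digits_length_le_iff hQ.one_lt l).2 hl
  have hcoef : ∀ l < Q ^ κ, ∀ m, κ ≤ m → (digitPoly Q (Nat.digits Q l)).coeff m = 0 := by
    intro l hl m hm
    rw [coeff_digitPoly, List.getD_eq_default _ _ ((hlen l hl).trans hm)]; simp
  have hP0 : P ≠ 0 := by
    intro h0
    rw [sub_eq_zero] at h0
    apply hij
    refine eq_of_digits_eq hi hj fun m => ?_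
    have := congrArg (fun p => p.coeff m) h0
    simp only [coeff_digitPoly, Nat.getD_digits _ _ hQ.two_le] at this
    have := (ZMod.natCast_eq_natCast_iff' _ _ _).1 this
    rwa [Nat.mod_mod, Nat.mod_mod] at this
  have hdeg : P.natDegree < κ := by
    rcases Nat.eq_zero_or_pos κ with rfl | hκ
    · simp at hi hj; omega
    · rw [Polynomial.natDegree_lt_iff_degree_lt hP0, Polynomial.degree_lt_iff_coeff_zero]
      intro m hm
      simp [hP, hcoef i hi m hm, hcoef j hj m hm]
  refine lt_of_le_of_lt ?_ hdeg
  -- Points of agreement are roots of the difference, whose degree is less than `κ`.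
  have himg : ((Finset.range Q).filter fun x => ev Q x i = ev Q x j).image
      (fun x : ℕ => (x : ZMod Q)) ⊆ P.roots.toFinset := by
    intro y hy
    simp only [Finset.mem_image, Finset.mem_filter, Finset.mem_range] at hy
    obtain ⟨x, ⟨_, hx⟩, rfl⟩ := hy
    rw [Multiset.mem_toFinset, Polynomial.mem_roots hP0, Polynomial.IsRoot, hP,
      Polynomial.eval_sub, eval_digitPoly, eval_digitPoly, ← Nat.coe_ofDigits,
      ← Nat.coe_ofDigits, sub_eq_zero, ZMod.natCast_eq_natCast_iff']
    exact hx
  have hinj : Set.InjOn (fun x : ℕ => (x : ZMod Q))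
      ((Finset.range Q).filter fun x => ev Q x i = ev Q x j : Finset ℕ) := by
    intro x hx y hy hxy
    simp only [Finset.coe_filter, Set.mem_ofPred_eq, Finset.mem_range] at hx hy
    have := (ZMod.natCast_eq_natCast_iff' _ _ _).1 hxy
    rwa [Nat.mod_eq_of_lt hx.1, Nat.mod_eq_of_lt hy.1] at this
  rw [← Finset.card_image_of_injOn hinj]
  exact (Finset.card_le_card himg).trans
    ((Multiset.toFinset_card_le _).trans (Polynomial.card_roots' _))

/-- Some evaluation point separates all elements of a small set. -/
theorem exists_ev_injOn {Q : ℕ} (hQ : Q.Prime) {k κ : ℕ} (h : k * k * κ < Q) {S : Finset ℕ}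
    (hS : ∀ i ∈ S, i < Q ^ κ) (hk : S.card ≤ k) : ∃ x < Q, Set.InjOn (ev Q x) S := by
  by_contra! hcon
  -- Union bound: a point that fails to separate collides on one of at most `k * k` ordered pairs,
  -- and each pair spoils at most `κ` points.
  have hsub : Finset.range Q ⊆ S.offDiag.biUnion fun p =>
      (Finset.range Q).filter fun x => ev Q x p.1 = ev Q x p.2 := by
    intro x hx
    have := hcon x (Finset.mem_range.1 hx)
    simp only [Set.InjOn, not_forall] at this
    obtain ⟨i, hi, j, hj, he, hne⟩ := this
    simp only [Finset.mem_biUnion, Finset.mem_filter]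
    exact ⟨(i, j), Finset.mem_offDiag.2 ⟨hi, hj, hne⟩, hx, he⟩
  have h₁ := Finset.card_le_card hsub
  have h₂ : (S.offDiag.biUnion fun p =>
      (Finset.range Q).filter fun x => ev Q x p.1 = ev Q x p.2).card ≤ S.offDiag.card * κ := by
    refine Finset.card_biUnion_le_card_mul _ _ _ fun p hp => ?_
    obtain ⟨h₁, h₂, h₃⟩ := Finset.mem_offDiag.1 hp
    exact (card_ev_eq_lt hQ (hS _ h₁) (hS _ h₂) h₃).le
  have h₃ : S.offDiag.card ≤ k * k := by
    rw [Finset.offDiag_card]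
    exact (Nat.sub_le _ _).trans (Nat.mul_le_mul hk hk)
  have := Nat.mul_le_mul_right κ h₃
  simp at h₁
  omega

/-- Evaluation at `k` points takes all tuples of values exactly once on the polynomials with `k`
coefficients. -/
theorem card_ev_mem {Q : ℕ} (hQ : Q.Prime) {E : Finset ℕ} (hE : E ⊆ Finset.range Q)
    (A : ℕ → Finset ℕ) (hA : ∀ y ∈ E, A y ⊆ Finset.range Q) :
    ((Finset.range (Q ^ E.card)).filter fun ω => ∀ y ∈ E, ev Q y ω ∈ A y).card =
      ∏ y ∈ E, (A y).card := by
  classical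
  -- Injectivity holds because polynomials with `E.card` coefficients that agree on `E` coincide.
  -- Domain and range both have `Q ^ E.card` elements, so evaluation is a bijection.
  have hinj : Set.InjOn (fun ω => fun y (_ : y ∈ E) => ev Q y ω)
      (Finset.range (Q ^ E.card) : Finset ℕ) := by
    intro i hi j hj hij
    by_contra hne
    have := card_ev_eq_lt hQ (Finset.mem_range.1 hi) (Finset.mem_range.1 hj) hne
    refine absurd (Finset.card_le_card (s := E) fun y hy => ?_) (not_le.2 this)
    exact Finset.mem_filter.2 ⟨hE hy, congrFun (congrFun hij y) hy⟩
  have hsurj : (Finset.range (Q ^ E.card)).image (fun ω => fun y (_ : y ∈ E) => ev Q y ω) =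
      E.pi fun _ => Finset.range Q := by
    refine Finset.eq_of_subset_of_card_le ?_ ?_
    · intro g hg
      obtain ⟨ω, _, rfl⟩ := Finset.mem_image.1 hg
      exact Finset.mem_pi.2 fun y _ => Finset.mem_range.2 (ev_lt hQ.pos _ _)
    · rw [Finset.card_image_of_injOn hinj, Finset.card_pi]; simp
  rw [← Finset.card_pi, ← Finset.card_image_of_injOn
    (hinj.mono (Finset.coe_subset.2 (Finset.filter_subset (fun ω => ∀ y ∈ E, ev Q y ω ∈ A y) _)))]
  congr 1
  ext g
  simp only [Finset.mem_image, Finset.mem_filter, Finset.mem_pi]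
  constructor
  · rintro ⟨ω, ⟨_, h⟩, rfl⟩
    exact fun y hy => h y hy
  · intro h
    have : g ∈ E.pi fun _ => Finset.range Q := Finset.mem_pi.2 fun y hy => hA y hy (h y hy)
    rw [← hsurj, Finset.mem_image] at this
    obtain ⟨ω, hω, rfl⟩ := this
    exact ⟨ω, ⟨hω, h⟩, rfl⟩

end DTLearn

namespace DTLearn

/-! ### A greedy covering family -/

/-- The class of a value: `2` for a fraction of about `1 / 4k` of the values, the parity for the
others. -/
def cl (k Q v : ℕ) : ℕ := if v * (4 * k) < Q then 2 else v % 2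

theorem cl_le (k Q v : ℕ) : cl k Q v ≤ 2 := by
  unfold cl; split <;> omega

/-- The values below `Q` of class `c`. -/
def clSet (k Q c : ℕ) : Finset ℕ := (Finset.range Q).filter fun v => cl k Q v = c

/-- The `⌈Q / 4k⌉` smallest values have class 2. -/
theorem mul_card_clSet_two {k Q : ℕ} (hk : 0 < k) : Q ≤ 4 * k * (clSet k Q 2).card := by
  have hsub : Finset.range ((Q + (4 * k - 1)) / (4 * k)) ⊆ clSet k Q 2 := by
    intro v hv
    have hv' : v < (Q + (4 * k - 1)) / (4 * k) := Finset.mem_range.1 hv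
    have h₁ : (v + 1) * (4 * k) ≤ Q + (4 * k - 1) :=
      (Nat.le_div_iff_mul_le (by omega)).1 hv'
    have h₂ : v * (4 * k) < Q := by rw [add_mul] at h₁; omega
    have h₃ : v ≤ v * (4 * k) := Nat.le_mul_of_pos_right _ (by omega)
    refine Finset.mem_filter.2 ⟨Finset.mem_range.2 (by omega), ?_⟩
    rw [cl, if_pos h₂]
  have := Finset.card_le_card hsub
  rw [Finset.card_range] at this
  have h₂ := Nat.mul_le_mul_left (4 * k) this
  have h₃ := Nat.div_add_mod (Q + (4 * k - 1)) (4 * k)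
  have h₄ := Nat.mod_lt (Q + (4 * k - 1)) (show 0 < 4 * k by omega)
  omega

/-- From `u = ⌈Q / 4k⌉` on, the class is the parity, so each bit receives a share of at least `1/2 -
1/(4k)`; the roundings are absorbed by `8 * k ≤ Q`. -/
theorem mul_card_clSet_bit {k Q c : ℕ} (hk : 0 < k) (hQ : 8 * k ≤ Q) (hc : c < 2) :
    (2 * k - 1) * Q ≤ 4 * k * (clSet k Q c).card := by
  set u := (Q + (4 * k - 1)) / (4 * k) with hu
  have h₃ := Nat.div_add_mod (Q + (4 * k - 1)) (4 * k)
  have h₄ := Nat.mod_lt (Q + (4 * k - 1)) (show 0 < 4 * k by omega)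
  rw [← hu] at h₃
  -- `u + (u + c) % 2` is the first value from `u` on with parity `c`.
  have hsub : (Finset.range ((Q - u) / 2)).image (fun v => u + (u + c) % 2 + 2 * v) ⊆
      clSet k Q c := by
    intro v hv
    obtain ⟨a, ha, rfl⟩ := Finset.mem_image.1 hv
    have ha' := Finset.mem_range.1 ha
    have h₁ : Q ≤ u * (4 * k) := by rw [mul_comm]; omega
    have h₂ : ¬ (u + (u + c) % 2 + 2 * a) * (4 * k) < Q := by
      rw [add_assoc, add_mul]; omega
    refine Finset.mem_filter.2 ⟨Finset.mem_range.2 (by omega), ?_⟩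
    rw [cl, if_neg h₂]
    omega
  have h := Finset.card_le_card hsub
  rw [Finset.card_image_of_injective _ (fun a b hab => by simpa using hab), Finset.card_range] at h
  have h₅ : Q ≤ 2 * (clSet k Q c).card + u + 1 := by omega
  have h₆ := Nat.mul_le_mul_left (2 * k) h₅
  have h₇ : 2 * k * (2 * (clSet k Q c).card + u + 1) =
    4 * k * (clSet k Q c).card + 2 * k * u + 2 * k := by ring
  rw [h₇] at h₆
  have h₈ : (2 * k - 1) * Q + Q = 2 * k * Q := by
    rw [← Nat.succ_mul]; congr 1; omega
  have h₉ : 2 * (2 * k * u) = 4 * k * u := by ring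
  omega

/-- `ω` covers the constraint encoded by the base `2Q` digits of `z`. -/
def Covers (k Q ω z : ℕ) : Prop :=
  ∀ j < k, cl k Q (ev Q (z / (2 * Q) ^ j % (2 * Q) / 2) ω) =
    if j = 0 then 2 else z / (2 * Q) ^ j % (2 * Q) % 2

instance (k Q ω z : ℕ) : Decidable (Covers k Q ω z) := by unfold Covers; infer_instance

/-- Bernoulli: `(1 - 1/(2k)) ^ (k - 1) ≥ 1/2`. Reserving values for class 2 thus costs only a factor
2 over all `k - 1` prescribed bits. -/
theorem two_mul_pow_le (k : ℕ) (hk : 0 < k) : (2 * k) ^ (k - 1) ≤ 2 * (2 * k - 1) ^ (k - 1) := by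
  have hk' : (0 : ℝ) < 2 * k := by positivity
  have h := one_add_mul_le_pow (a := -(1 / (2 * k : ℝ))) (by
    have : 1 / (2 * k : ℝ) ≤ 1 := by
      rw [div_le_one hk']
      have : (1 : ℝ) ≤ k := by exact_mod_cast hk
      linarith
    linarith) (k - 1)
  have h2 : (1 : ℝ) / 2 ≤ 1 + ((k - 1 : ℕ) : ℝ) * -(1 / (2 * k)) := by
    rw [Nat.cast_sub hk]
    field_simp
    push_cast
    linarith
  have h3 : (1 / 2 : ℝ) * (2 * k) ^ (k - 1) ≤ (2 * k - 1) ^ (k - 1) := by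
    calc (1 / 2 : ℝ) * (2 * k) ^ (k - 1) ≤ (1 + -(1 / (2 * k))) ^ (k - 1) * (2 * k) ^ (k - 1) := by
          gcongr; linarith
      _ = (2 * k - 1) ^ (k - 1) := by
          rw [← mul_pow]; congr 1; field_simp; ring
  have h4 : ((2 * k - 1 : ℕ) : ℝ) = 2 * k - 1 := by
    rw [Nat.cast_sub (by omega)]; push_cast; ring
  have : (((2 * k) ^ (k - 1) : ℕ) : ℝ) ≤ ((2 * (2 * k - 1) ^ (k - 1) : ℕ) : ℝ) := by
    push_cast [h4]; linarith
  exact_mod_cast this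

/-- The class of every point of a `k`-set can be prescribed, with class `2` for one point only, for
a fraction of at least `1 / (4k 2^k)` of the polynomials. -/
theorem card_prescribed {k Q : ℕ} (hQ : Q.Prime) (hk : 0 < k) (hkQ : 8 * k ≤ Q) {E : Finset ℕ}
    (hE : E ⊆ Finset.range Q) (hEk : E.card = k) {y₀ : ℕ} (hy₀ : y₀ ∈ E) {c : ℕ → ℕ}
    (hc₀ : c y₀ = 2) (hc : ∀ y ∈ E, y ≠ y₀ → c y < 2) :
    Q ^ k ≤ 4 * k * 2 ^ k *
      ((Finset.range (Q ^ k)).filter fun ω => ∀ y ∈ E, cl k Q (ev Q y ω) = c y).card := by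
  have h₁ := card_ev_mem hQ hE (fun y => clSet k Q (c y)) fun y _ => Finset.filter_subset _ _
  rw [hEk] at h₁
  have h₂ : ((Finset.range (Q ^ k)).filter fun ω => ∀ y ∈ E, cl k Q (ev Q y ω) = c y) =
      (Finset.range (Q ^ k)).filter fun ω => ∀ y ∈ E, ev Q y ω ∈ clSet k Q (c y) := by
    refine Finset.filter_congr fun ω _ => forall₂_congr fun y _ => ?_
    simp [clSet, ev_lt hQ.pos]
  rw [h₂, h₁]
  rw [← Finset.mul_prod_erase _ _ hy₀, hc₀]
  have h₃ : ((2 * k - 1) * Q) ^ (k - 1) ≤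
      (4 * k) ^ (k - 1) * ∏ y ∈ E.erase y₀, (clSet k Q (c y)).card := by
    have hcard : (E.erase y₀).card = k - 1 := by rw [Finset.card_erase_of_mem hy₀, hEk]
    rw [← hcard, ← Finset.prod_const, ← Finset.prod_const, ← Finset.prod_mul_distrib]
    refine Finset.prod_le_prod' fun y hy => ?_
    exact mul_card_clSet_bit hk hkQ (hc y (Finset.mem_of_mem_erase hy) (Finset.ne_of_mem_erase hy))
  have h₄ := mul_card_clSet_two (Q := Q) hk
  set X := ∏ y ∈ E.erase y₀, (clSet k Q (c y)).card
  set Y := (clSet k Q 2).card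
  have h₅ := two_mul_pow_le k hk
  -- Each bit has a share of at least `(1/2) * (1 - 1/(2k))`; by `two_mul_pow_le` the `k - 1` bits
  -- jointly have at least `2 ^ (-k)`.
  have h₆ : Q ^ (k - 1) ≤ 2 ^ k * X := by
    have : (2 * k) ^ (k - 1) * Q ^ (k - 1) ≤ (2 * k) ^ (k - 1) * (2 ^ k * X) := by
      calc (2 * k) ^ (k - 1) * Q ^ (k - 1) ≤ 2 * (2 * k - 1) ^ (k - 1) * Q ^ (k - 1) := by gcongr
        _ = 2 * ((2 * k - 1) * Q) ^ (k - 1) := by rw [mul_pow]; ring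
        _ ≤ 2 * ((4 * k) ^ (k - 1) * X) := by gcongr
        _ = (2 * k) ^ (k - 1) * (2 ^ k * X) := by
          have : 4 * k = 2 * (2 * k) := by ring
          rw [this, mul_pow]
          obtain ⟨l, rfl⟩ : ∃ l, k = l + 1 := ⟨k - 1, by omega⟩
          simp only [Nat.add_sub_cancel, pow_succ]; ring
    exact Nat.le_of_mul_le_mul_left this (by positivity)
  calc Q ^ k = Q * Q ^ (k - 1) := by rw [← pow_succ']; congr 1; omega
    _ ≤ (4 * k * Y) * (2 ^ k * X) := Nat.mul_le_mul h₄ h₆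
    _ = _ := by ring

/-- A constraint that can be covered is covered by many polynomials. -/
theorem card_covers {k Q : ℕ} (hQ : Q.Prime) (hk : 0 < k) (hkQ : 8 * k ≤ Q) {ω₀ z : ℕ}
    (h : Covers k Q ω₀ z) :
    Q ^ k ≤ 4 * k * 2 ^ k * ((Finset.range (Q ^ k)).filter fun ω => Covers k Q ω z).card := by
  classical
  set y : ℕ → ℕ := fun j => z / (2 * Q) ^ j % (2 * Q) / 2 with hy
  have hyQ : ∀ j, y j < Q := fun j => by
    have := Nat.mod_lt (z / (2 * Q) ^ j) (show 0 < 2 * Q by have := hQ.pos; omega)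
    simp only [hy]; omega
  set Y := (Finset.range k).image y with hY
  have hYc : Y.card ≤ k := Finset.card_image_le.trans (by simp)
  have hYQ : Y ⊆ Finset.range Q := by
    intro a ha
    obtain ⟨j, _, rfl⟩ := Finset.mem_image.1 ha
    exact Finset.mem_range.2 (hyQ j)
  -- The points are padded to exactly `k`, since the exact count needs as many points as
  -- coefficients; padding points are given class 0.
  obtain ⟨E, hYE, hEQ, hEk⟩ := Finset.exists_subsuperset_card_eq hYQ hYc (by simp; omega)
  have hyY : ∀ j < k, y j ∈ Y := fun j hj =>
    Finset.mem_image.2 ⟨j, Finset.mem_range.2 hj, rfl⟩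
  have hY₀ : y 0 ∈ Y := hyY 0 hk
  refine (card_prescribed hQ hk hkQ hEQ hEk (hYE hY₀)
    (c := fun u => if u ∈ Y then cl k Q (ev Q u ω₀) else 0) ?_ ?_).trans
    (Nat.mul_le_mul_left _ (Finset.card_le_card ?_))
  · simp only [hY₀, if_true]
    exact h 0 hk
  · intro u _ hu
    split
    · rename_i hmem
      obtain ⟨j, hj, rfl⟩ := Finset.mem_image.1 hmem
      have hj0 : j ≠ 0 := by rintro rfl; exact hu rfl
      have := h j (Finset.mem_range.1 hj)
      simp only [hj0, if_false] at this
      rw [this]; omega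
    · omega
  · intro ω hω
    simp only [Finset.mem_filter] at hω ⊢
    refine ⟨hω.1, fun j hj => ?_⟩
    have := hω.2 (y j) (hYE (hyY j hj))
    rw [if_pos (hyY j hj)] at this
    rw [← h j hj]
    exact this

/-- `G` lists greedy choices: each polynomial covers as many as possible of the constraints not yet
covered. -/
def Greedy (k Q rn : ℕ) (G : ℕ → ℕ) : Prop :=
  ∀ r < rn, G r < Q ^ k ∧ ∀ ω < Q ^ k,
    ((Finset.range ((2 * Q) ^ k)).filter fun z =>
      (∀ r' < r, ¬ Covers k Q (G r') z) ∧ Covers k Q ω z).card ≤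
    ((Finset.range ((2 * Q) ^ k)).filter fun z =>
      (∀ r' < r, ¬ Covers k Q (G r') z) ∧ Covers k Q (G r) z).card

/-- Bernoulli: `(1 + 1/(K - 1)) ^ K ≥ 2`, so a block of `K` greedy rounds at least halves what is
left. -/
theorem two_mul_pred_pow_le {K : ℕ} (hK : 1 < K) : 2 * (K - 1) ^ K ≤ K ^ K := by
  obtain ⟨l, rfl⟩ : ∃ l, K = l + 2 := ⟨K - 2, by omega⟩
  have h := one_add_mul_le_pow (a := (1 : ℝ) / (l + 1)) (by
    have : (0 : ℝ) ≤ 1 / (l + 1) := by positivity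
    linarith) (l + 2)
  have h2 : (2 : ℝ) ≤ 1 + ((l + 2 : ℕ) : ℝ) * (1 / (l + 1)) := by
    push_cast
    rw [mul_one_div, show ((l : ℝ) + 2) / (l + 1) = 1 + 1 / (l + 1) by field_simp; ring]
    have : (0 : ℝ) ≤ 1 / (l + 1) := by positivity
    linarith
  have h3 : (2 : ℝ) * (l + 1) ^ (l + 2) ≤ (l + 2) ^ (l + 2) := by
    calc (2 : ℝ) * (l + 1) ^ (l + 2) ≤ (1 + 1 / (l + 1)) ^ (l + 2) * (l + 1) ^ (l + 2) := by
          gcongr; linarith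
      _ = (l + 2) ^ (l + 2) := by rw [← mul_pow]; congr 1; field_simp; ring
  have : l + 2 - 1 = l + 1 := by omega
  rw [this]
  exact_mod_cast h3

/-- After enough greedy rounds, all constraints that can be covered are covered. -/
theorem Greedy.covers {k Q : ℕ} (hQ : Q.Prime) (hk : 0 < k) (hkQ : 8 * k ≤ Q) {lam : ℕ}
    (hlam : 2 * Q < 2 ^ lam) {G : ℕ → ℕ} (hG : Greedy k Q (4 * k * 2 ^ k * (k * lam)) G)
    {ω₀ z : ℕ} (hz : z < (2 * Q) ^ k) (h : Covers k Q ω₀ z) :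
    ∃ r < 4 * k * 2 ^ k * (k * lam), Covers k Q (G r) z := by
  classical
  set K := 4 * k * 2 ^ k with hKdef
  have hK : 1 < K := by
    have : 0 < 2 ^ k := by positivity
    nlinarith
  by_contra! hcon
  -- A code `z` may prescribe contradictory classes at a repeated point, so only constraints covered
  -- by some polynomial are counted.
  set V : ℕ → Finset ℕ := fun r => (Finset.range ((2 * Q) ^ k)).filter fun z =>
    (∃ ω, Covers k Q ω z) ∧ ∀ r' < r, ¬ Covers k Q (G r') z with hV
  have hstep : ∀ r < K * (k * lam), K * (V (r + 1)).card ≤ (K - 1) * (V r).card := by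
    intro r hr
    obtain ⟨hGr, hmax⟩ := hG r hr
    set C := ((Finset.range ((2 * Q) ^ k)).filter fun z =>
      (∀ r' < r, ¬ Covers k Q (G r') z) ∧ Covers k Q (G r) z).card with hC
    have hsplit : (V (r + 1)).card + C = (V r).card := by
      rw [hC, ← Finset.card_union_of_disjoint]
      · congr 1
        ext z
        simp only [hV, Finset.mem_union, Finset.mem_filter, Nat.forall_lt_succ_right]
        constructor
        · rintro (⟨h1, h2, h3, -⟩ | ⟨h1, h2, h3⟩)
          · exact ⟨h1, h2, h3⟩
          · exact ⟨h1, ⟨_, h3⟩, h2⟩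
        · rintro ⟨h1, h2, h3⟩
          by_cases h4 : Covers k Q (G r) z
          · exact Or.inr ⟨h1, h3, h4⟩
          · exact Or.inl ⟨h1, h2, h3, h4⟩
      · rw [Finset.disjoint_left]
        intro z h1 h2
        simp only [hV, Finset.mem_filter, Nat.forall_lt_succ_right] at h1 h2
        exact h1.2.2.2 h2.2.2
    -- Double counting of pairs of a constraint and a covering polynomial: some polynomial, hence
    -- also the greedy one, covers a share of at least `1 / K` of `V r`.
    have hcount : (V r).card * Q ^ k ≤ K * (Q ^ k * C) := by
      calc (V r).card * Q ^ k = ∑ _z ∈ V r, Q ^ k := by simp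
        _ ≤ ∑ z ∈ V r, K * ((Finset.range (Q ^ k)).filter fun ω => Covers k Q ω z).card := by
          refine Finset.sum_le_sum fun z hz => ?_
          obtain ⟨ω, hω⟩ := (Finset.mem_filter.1 hz).2.1
          exact card_covers hQ hk hkQ hω
        _ = K * ∑ ω ∈ Finset.range (Q ^ k), ((V r).filter fun z => Covers k Q ω z).card := by
          rw [← Finset.mul_sum]
          congr 1
          simp only [Finset.card_filter]
          exact Finset.sum_comm
        _ ≤ K * ∑ _ω ∈ Finset.range (Q ^ k), C := by
          gcongr with ω hω
          refine (Finset.card_le_card fun z hz => ?_).trans (hmax ω (Finset.mem_range.1 hω))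
          simp only [hV, Finset.mem_filter] at hz ⊢
          exact ⟨hz.1.1, hz.1.2.2, hz.2⟩
        _ = K * (Q ^ k * C) := by simp
    have hC' : (V r).card ≤ K * C := by
      have : Q ^ k * (V r).card ≤ Q ^ k * (K * C) := by
        calc _ = (V r).card * Q ^ k := by ring
          _ ≤ _ := hcount
          _ = _ := by ring
      exact Nat.le_of_mul_le_mul_left this (pow_pos hQ.pos k)
    have : (K - 1) * (V r).card + (V r).card = K * (V r).card := by
      rw [← Nat.succ_mul]; congr 1; omega
    have h2 : K * (V r).card = K * (V (r + 1)).card + K * C := by rw [← hsplit]; ring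
    omega
  have hind : ∀ r ≤ K * (k * lam), K ^ r * (V r).card ≤ (K - 1) ^ r * (2 * Q) ^ k := by
    intro r
    induction r with
    | zero =>
      intro _
      simpa using Finset.card_filter_le (Finset.range ((2 * Q) ^ k)) _
    | succ r ih =>
      intro hr
      calc K ^ (r + 1) * (V (r + 1)).card = K ^ r * (K * (V (r + 1)).card) := by ring
        _ ≤ K ^ r * ((K - 1) * (V r).card) := Nat.mul_le_mul_left _ (hstep r (by omega))
        _ = (K - 1) * (K ^ r * (V r).card) := by ring
        _ ≤ (K - 1) * ((K - 1) ^ r * (2 * Q) ^ k) := Nat.mul_le_mul_left _ (ih (by omega))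
        _ = _ := by ring
  have hlast := hind _ le_rfl
  have hpos : 1 ≤ (V (K * (k * lam))).card := by
    refine Finset.card_pos.2 ⟨z, ?_⟩
    simp only [hV, Finset.mem_filter, Finset.mem_range]
    exact ⟨hz, ⟨ω₀, h⟩, hcon⟩
  have h1 : K ^ (K * (k * lam)) ≤ (K - 1) ^ (K * (k * lam)) * (2 * Q) ^ k :=
    (Nat.le_mul_of_pos_right _ hpos).trans hlast
  have h2 : 2 ^ (k * lam) * (K - 1) ^ (K * (k * lam)) ≤ K ^ (K * (k * lam)) := by
    rw [pow_mul (K - 1), pow_mul K, ← mul_pow]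
    exact Nat.pow_le_pow_left (two_mul_pred_pow_le hK) _
  -- There are fewer than `2 ^ (k * lam)` constraints, while `k * lam` blocks of `K` rounds divide
  -- the number left by at least `2 ^ (k * lam)`.
  have h3 : (2 * Q) ^ k < 2 ^ (k * lam) := by
    rw [mul_comm k, pow_mul]; exact Nat.pow_lt_pow_left hlam (by omega)
  have h4 : 0 < (K - 1) ^ (K * (k * lam)) := pow_pos (by omega) _
  have h5 := (Nat.mul_lt_mul_left h4).2 h3
  rw [mul_comm (2 ^ _)] at h2
  omega

/-! ### From the covering family to classes of variables -/

/-- The class of variable `i` in the sample `(x, ω)`. -/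
def vcl (k Q x ω i : ℕ) : ℕ := cl k Q (ev Q (ev Q x i) ω)

/-- A prime that is large enough for the covering family. -/
structure GoodPrime (n k Q : ℕ) : Prop where
  prime : Q.Prime
  large : 8 * k * k ≤ Q
  digits : k * k * (Nat.digits Q n).length < Q

/-- The samples realize every assignment of fewer than `k` variables together with class `2` at a
further variable. -/
theorem exists_sample {n k Q lam : ℕ} (hQ : GoodPrime n k Q) (hk : 0 < k)
    (hlam : 2 * Q < 2 ^ lam) {G : ℕ → ℕ} (hG : Greedy k Q (4 * k * 2 ^ k * (k * lam)) G)
    {S : Finset ℕ} (hS : ∀ i ∈ S, i ≤ n) (hSk : S.card < k) {i : ℕ} (hin : i ≤ n) (hi : i ∉ S)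
    (v : ℕ → ℕ) (hv : ∀ j, v j < 2) :
    ∃ x < Q, ∃ r < 4 * k * 2 ^ k * (k * lam), vcl k Q x (G r) i = 2 ∧
      ∀ j ∈ S, vcl k Q x (G r) j = v j := by
  classical
  have hkQ : 8 * k ≤ Q := le_trans (by nlinarith) hQ.large
  have hprime := hQ.prime
  -- `S` and `i` are together at most `k` indices, none with more base `Q` digits than `n`.
  obtain ⟨x, hx, hinj⟩ := exists_ev_injOn hprime hQ.digits (S := insert i S) (by
    intro j hj
    refine lt_of_le_of_lt ?_ (Nat.lt_base_pow_length_digits hprime.one_lt)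
    rcases Finset.mem_insert.1 hj with rfl | hj
    · exact hin
    · exact hS j hj) ((Finset.card_insert_le _ _).trans hSk)
  set y₀ := ev Q x i with hy₀
  have hy₀Q : y₀ < Q := ev_lt hprime.pos _ _
  have hsub : S.image (ev Q x) ⊆ (Finset.range Q).erase y₀ := by
    intro y hy
    obtain ⟨j, hj, rfl⟩ := Finset.mem_image.1 hy
    refine Finset.mem_erase.2 ⟨fun he => ?_, Finset.mem_range.2 (ev_lt hprime.pos _ _)⟩
    have := hinj (by simp [hj]) (by simp) he
    exact hi (this ▸ hj)
  -- Exactly `k - 1` points besides `y₀` are wanted, because a constraint consists of exactly `k`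
  -- digits.
  obtain ⟨Y, hY₁, hY₂, hYc⟩ := Finset.exists_subsuperset_card_eq (n := k - 1) hsub
    (Finset.card_image_le.trans (by omega))
    (by rw [Finset.card_erase_of_mem (Finset.mem_range.2 hy₀Q)]; simp; omega)
  have hy₀Y : y₀ ∉ Y := fun h => (Finset.mem_erase.1 (hY₂ h)).1 rfl
  -- the prescribed bit at a point of the hashed domain
  set c : ℕ → ℕ := fun y => if h : ∃ j ∈ S, ev Q x j = y then v h.choose else 0 with hc
  have hc2 : ∀ y, c y < 2 := by
    intro y; simp only [hc]; split
    · exact hv _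
    · omega
  have hcS : ∀ j ∈ S, c (ev Q x j) = v j := by
    intro j hj
    have hex : ∃ j' ∈ S, ev Q x j' = ev Q x j := ⟨j, hj, rfl⟩
    simp only [hc, dif_pos hex]
    congr 1
    exact hinj (by simp [hex.choose_spec.1]) (by simp [hj]) hex.choose_spec.2
  have hEcard : (insert y₀ Y).card = k := by
    rw [Finset.card_insert_of_notMem hy₀Y, hYc]; omega
  have hEQ : insert y₀ Y ⊆ Finset.range Q := by
    refine Finset.insert_subset (Finset.mem_range.2 hy₀Q) (hY₂.trans (Finset.erase_subset _ _))
  have hcnt := card_prescribed hprime hk hkQ hEQ hEcard (Finset.mem_insert_self _ _)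
    (c := fun y => if y = y₀ then 2 else c y) (by simp) (by
      intro y _ hne; simpa [hne] using hc2 y)
  have hne : ((Finset.range (Q ^ k)).filter fun ω => ∀ y ∈ insert y₀ Y,
      cl k Q (ev Q y ω) = if y = y₀ then 2 else c y).Nonempty := by
    rw [← Finset.card_pos]
    refine Nat.pos_of_ne_zero fun h0 => ?_
    rw [h0, mul_zero] at hcnt
    have := pow_pos hprime.pos k
    omega
  obtain ⟨ω₀, hω₀⟩ := hne
  have hω₀' := (Finset.mem_filter.1 hω₀).2
  -- enumerate the points and encode them as digits
  let e : Fin (k - 1) ≃ Y := (Finset.equivFinOfCardEq hYc).symm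
  have hYQ : ∀ y ∈ Y, y < Q := fun y hy => Finset.mem_range.1 (Finset.mem_of_mem_erase (hY₂ hy))
  -- Position 0 demands class 2 whatever its low bit is, so that bit is 0; every other digit packs a
  -- point and its bit as `2 * y + bit`.
  let dig : Fin k → Fin (2 * Q) := fun j =>
    if h : j.val = 0 then ⟨2 * y₀, by omega⟩ else
      ⟨2 * (e ⟨j.val - 1, by omega⟩ : ℕ) + c (e ⟨j.val - 1, by omega⟩), by
        have h1 := hYQ _ (e ⟨j.val - 1, by omega⟩).2
        have h2 := hc2 (e ⟨j.val - 1, by omega⟩)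
        omega⟩
  set z : ℕ := (finFunctionFinEquiv dig).val with hz
  have hzd : ∀ j (hj : j < k), z / (2 * Q) ^ j % (2 * Q) = dig ⟨j, hj⟩ := by
    intro j hj
    have := congrFun (finFunctionFinEquiv.symm_apply_apply dig) ⟨j, hj⟩
    rw [← this]
    rfl
  have hcov : ∀ ω, Covers k Q ω z ↔ ∀ y ∈ insert y₀ Y,
      cl k Q (ev Q y ω) = if y = y₀ then 2 else c y := by
    intro ω
    constructor
    · intro h y hy
      rcases Finset.mem_insert.1 hy with rfl | hy
      · have := h 0 hk
        rw [hzd 0 hk] at this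
        simpa [dig] using this
      · have hne : y ≠ y₀ := fun h => hy₀Y (h ▸ hy)
        have hlt := (e.symm ⟨y, hy⟩).2
        have := h ((e.symm ⟨y, hy⟩).val + 1) (by omega)
        rw [hzd _ (by omega)] at this
        have hcy := hc2 y
        simp only [dig, Nat.add_eq_zero_iff, one_ne_zero, and_false, dif_neg, not_false_eq_true,
          Nat.add_sub_cancel, Fin.eta, Equiv.apply_symm_apply, if_false] at this
        rw [show (2 * y + c y) / 2 = y by omega, show (2 * y + c y) % 2 = c y by omega] at this
        simpa [hne] using this
    · intro h j hj
      rw [hzd j hj]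
      by_cases hj0 : j = 0
      · subst hj0
        simpa [dig] using h y₀ (by simp)
      · have hmem := (e ⟨j - 1, by omega⟩).2
        set y : ℕ := (e ⟨j - 1, by omega⟩).val with hy
        have hne : y ≠ y₀ := fun h => hy₀Y (h ▸ hmem)
        have hcy := hc2 y
        have := h y (by simp [hmem])
        simp only [dig, hj0, dif_neg, not_false_eq_true, if_false, ← hy]
        rw [show (2 * y + c y) / 2 = y by omega, show (2 * y + c y) % 2 = c y by omega]
        simpa [hne] using this
  obtain ⟨r, hr, hcr⟩ := hG.covers hprime hk hkQ hlam (Fin.is_lt _) ((hcov ω₀).2 hω₀')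
  have hcr' := (hcov (G r)).1 hcr
  refine ⟨x, hx, r, hr, ?_, fun j hj => ?_⟩
  · have := hcr' y₀ (by simp)
    rwa [if_pos rfl] at this
  · have hmem : ev Q x j ∈ Y := hY₁ (Finset.mem_image_of_mem _ hj)
    have hne : ev Q x j ≠ y₀ := fun h => hy₀Y (h ▸ hmem)
    have := hcr' _ (Finset.mem_insert_of_mem hmem)
    rw [if_neg hne, hcS j hj] at this
    exact this

end DTLearn

namespace DTLearn

/-! ### Samples, relevant variables and dynamic programming -/

/-- The samples `q < M` realize every assignment of fewer than `k` variables together with class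
`2` at a further variable. -/
def Sampling (n k M : ℕ) (cls : ℕ → ℕ → ℕ) : Prop :=
  ∀ (S : Finset ℕ) (i : ℕ) (v : ℕ → ℕ), (∀ j ∈ S, j ≤ n) → S.card < k → i ≤ n → i ∉ S →
    (∀ j, v j < 2) → ∃ q < M, cls q i = 2 ∧ ∀ j ∈ S, cls q j = v j

/-- The point of sample `q` in which the variables below `mid` that are not marked by `ρ` are set
to `1` if their class is `2`; all other variables of class `2` are set to `0`. -/
def hybrid (n : ℕ) (cls : ℕ → ℕ → ℕ) (q : ℕ) (ρ : ℕ → ℕ) (mid : ℕ) : Fin n → Bool :=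
  fun i => decide (cls q i % (2 + (1 - ρ i) * (1 - (1 - (mid - i)))) ≠ 0)

/-- The point of sample `q` in which all variables of class `2` are `0`. -/
def sample (n : ℕ) (cls : ℕ → ℕ → ℕ) (q : ℕ) : Fin n → Bool :=
  fun i => decide (cls q i % 2 ≠ 0)

theorem hybrid_zero (n : ℕ) (cls : ℕ → ℕ → ℕ) (q : ℕ) (ρ : ℕ → ℕ) :
    hybrid n cls q ρ 0 = sample n cls q := by
  funext i; simp [hybrid, sample]

variable {n k M dd : ℕ} {cls : ℕ → ℕ → ℕ} {f : (Fin n → Bool) → Bool}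

/-- Two trees of depth at most `dd` that agree on all samples compute the same function. -/
theorem Sampling.eval_eq (h : Sampling n (2 * dd + 1) M cls) {T₁ T₂ : DTree n}
    (h₁ : T₁.depth ≤ dd) (h₂ : T₂.depth ≤ dd)
    (heq : ∀ q < M, T₁.eval (sample n cls q) = T₂.eval (sample n cls q)) : T₁.eval = T₂.eval := by
  classical
  funext z
  obtain ⟨P₁, hP₁, hz₁⟩ := T₁.exists_certificate z
  obtain ⟨P₂, hP₂, hz₂⟩ := T₂.exists_certificate z
  -- No free variable is needed here: the index `n`, which belongs to no variable, serves as a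
  -- dummy. For this reason `Sampling` admits indices up to `n`.
  obtain ⟨q, hq, -, hS⟩ := h ((P₁ ∪ P₂).image Fin.val) n
    (fun j => if hj : j < n then (z ⟨j, hj⟩).toNat else 0)
    (by intro j hj; obtain ⟨i, _, rfl⟩ := Finset.mem_image.1 hj; exact i.2.le)
    (by
      have := Finset.card_image_le (s := P₁ ∪ P₂) (f := Fin.val)
      have := Finset.card_union_le P₁ P₂
      omega)
    le_rfl
    (by intro hj; obtain ⟨i, _, hi⟩ := Finset.mem_image.1 hj; exact i.2.ne hi)
    (by intro j; split
        · exact Bool.toNat_lt _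
        · omega)
  have hsamp : ∀ i ∈ P₁ ∪ P₂, sample n cls q i = z i := by
    intro i hi
    have := hS i (Finset.mem_image_of_mem _ hi)
    simp only [i.2, dif_pos] at this
    simp only [sample, this]
    cases z i <;> simp
  rw [← hz₁ _ fun i hi => hsamp i (Finset.mem_union_left _ hi),
    ← hz₂ _ fun i hi => hsamp i (Finset.mem_union_right _ hi), heq q hq]

/-- If the two extreme hybrids of every sample have the same value, then every relevant variable is
marked. -/
theorem Sampling.marked (h : Sampling n (2 * dd + 1) M cls) {T : DTree n} (hT : T.depth ≤ dd)
    {i : Fin n} (hi : Relevant T.eval i) :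
    ∃ q < M, ∀ ρ : ℕ → ℕ, ρ i = 0 →
      T.eval (hybrid n cls q ρ 0) ≠ T.eval (hybrid n cls q ρ n) := by
  classical
  obtain ⟨z, hz⟩ := hi
  obtain ⟨P₁, hP₁, hz₁⟩ := T.exists_certificate (Function.update z i false)
  obtain ⟨P₂, hP₂, hz₂⟩ := T.exists_certificate (Function.update z i true)
  -- Both certificates without `i` have at most `2 * dd` variables; they are fixed as in `z`, while
  -- `i` is free.
  obtain ⟨q, hq, hqi, hS⟩ := h (((P₁ ∪ P₂).erase i).image Fin.val) i
    (fun j => if hj : j < n then (z ⟨j, hj⟩).toNat else 0)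
    (by intro j hj; obtain ⟨i, _, rfl⟩ := Finset.mem_image.1 hj; exact i.2.le)
    (by
      have := Finset.card_image_le (s := (P₁ ∪ P₂).erase i) (f := Fin.val)
      have := Finset.card_erase_le (s := P₁ ∪ P₂) (a := i)
      have := Finset.card_union_le P₁ P₂
      omega)
    i.2.le
    (by
      intro hj; obtain ⟨j, hj, he⟩ := Finset.mem_image.1 hj
      exact (Finset.mem_erase.1 hj).1 (Fin.ext he))
    (by intro j; split
        · exact Bool.toNat_lt _
        · omega)
  have hcl : ∀ j ∈ P₁ ∪ P₂, j ≠ i → cls q j = (z j).toNat := by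
    intro j hj hji
    have := hS j (Finset.mem_image_of_mem _ (Finset.mem_erase.2 ⟨hji, hj⟩))
    simpa [j.2] using this
  refine ⟨q, hq, fun ρ hρ => ?_⟩
  -- Reduction modulo 2 or 3 keeps the classes 0 and 1, so certificate variables other than `i` are
  -- the same in all hybrids. Class 2 becomes 0 modulo 2 and stays nonzero modulo 3.
  have hot : ∀ (mid : ℕ) (j : Fin n), j ∈ P₁ ∪ P₂ → j ≠ i → hybrid n cls q ρ mid j = z j := by
    intro mid j hj hji
    simp only [hybrid, hcl j hj hji]
    have := Bool.toNat_lt (z j)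
    rw [Nat.mod_eq_of_lt (by omega)]
    cases z j <;> simp
  have h0 : hybrid n cls q ρ 0 i = false := by simp [hybrid, hqi]
  have hn : hybrid n cls q ρ n i = true := by
    have h1 : 1 - (n - (i : ℕ)) = 0 := by have := i.2; omega
    simp [hybrid, hqi, hρ, h1]
  rw [hz₁ (hybrid n cls q ρ 0), hz₂ (hybrid n cls q ρ n)]
  · exact hz
  · intro j hj
    by_cases hji : j = i
    · subst hji; simp [hn]
    · simp [hji, hot n j (Finset.mem_union_right _ hj) hji]
  · intro j hj
    by_cases hji : j = i
    · subst hji; simp [h0]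
    · simp [hji, hot 0 j (Finset.mem_union_left _ hj) hji]

/-- A change of value between consecutive hybrids reveals a relevant variable that is not
marked. -/
theorem relevant_of_hybrid_ne {q : ℕ} {ρ : ℕ → ℕ} {l : ℕ} (hl : l < n)
    (h : f (hybrid n cls q ρ l) ≠ f (hybrid n cls q ρ (l + 1))) :
    Relevant f ⟨l, hl⟩ ∧ ρ l = 0 := by
  -- Passing from `l` to `l + 1` can change the modulus at coordinate `l` only, and not even there
  -- if that variable is marked.
  have hot : ∀ j : Fin n, (j : ℕ) ≠ l →
      hybrid n cls q ρ l j = hybrid n cls q ρ (l + 1) j := by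
    intro j hj
    have : 1 - (l - (j : ℕ)) = 1 - (l + 1 - j) := by omega
    simp only [hybrid, this]
  have hupd : hybrid n cls q ρ (l + 1) = Function.update (hybrid n cls q ρ l) ⟨l, hl⟩
      (hybrid n cls q ρ (l + 1) ⟨l, hl⟩) := by
    funext j
    by_cases hj : j = ⟨l, hl⟩
    · subst hj; simp
    · have : (j : ℕ) ≠ l := fun h => hj (Fin.ext h)
      simp [hj, hot j this]
  have hself : hybrid n cls q ρ l = Function.update (hybrid n cls q ρ l) ⟨l, hl⟩
      (hybrid n cls q ρ l ⟨l, hl⟩) := (Function.update_eq_self _ _).symm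
  constructor
  · refine ⟨hybrid n cls q ρ l, fun heq => h ?_⟩
    rw [hself, hupd]
    cases hybrid n cls q ρ l ⟨l, hl⟩ <;> cases hybrid n cls q ρ (l + 1) ⟨l, hl⟩ <;>
      simp [heq]
  · by_contra hρ
    have h1 : 1 - ρ l = 0 := by omega
    apply h
    congr 1
    funext j
    by_cases hj : (j : ℕ) = l
    · simp [hybrid, hj, h1]
    · exact hot j hj

/-! ### The dynamic program on a heap of literal sequences -/

/-- The literals on the way from the root to node `t` of the `B`-ary heap all satisfy `p`. -/
def HeapAll (p : ℕ → Prop) (B : ℕ) : ℕ → Prop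
  | 0 => True
  | t + 1 => p (t % B) ∧ HeapAll p B (t / B)
termination_by t => t
decreasing_by exact Nat.lt_succ_of_le (Nat.div_le_self _ _)

theorem heapAll_zero (p : ℕ → Prop) (B : ℕ) : HeapAll p B 0 := by
  rw [HeapAll]; trivial

theorem heapAll_succ (p : ℕ → Prop) (B t : ℕ) :
    HeapAll p B (t + 1) ↔ p (t % B) ∧ HeapAll p B (t / B) := by
  rw [HeapAll]

theorem heapAll_child (p : ℕ → Prop) {B t l : ℕ} (hl : l < B) :
    HeapAll p B (B * t + 1 + l) ↔ p l ∧ HeapAll p B t := by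
  rw [show B * t + 1 + l = B * t + l + 1 by ring, heapAll_succ, Nat.mul_add_mod,
    Nat.mod_eq_of_lt hl, Nat.mul_add_div (by omega), Nat.div_eq_of_lt hl, add_zero]

/-- The number of nodes of depth less than `l` of the `B`-ary heap. -/
def heapOff (B : ℕ) : ℕ → ℕ
  | 0 => 0
  | l + 1 => B * heapOff B l + 1

theorem heapOff_mono (B : ℕ) : Monotone (heapOff B) := by
  refine monotone_nat_of_le_succ fun l => ?_
  induction l with
  | zero => simp [heapOff]
  | succ l ih => simp only [heapOff] at ih ⊢; nlinarith

/-- Sample `q` satisfies literal `l`: the variable `RL (l / 2)` has value `l % 2`. -/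
def SatLit (cls : ℕ → ℕ → ℕ) (RL : ℕ → ℕ) (q l : ℕ) : Prop := cls q (RL (l / 2)) % 2 = l % 2

/-- The equations of the dynamic program at node `t`; `best t` is the least size of a tree that is
consistent with the samples at `t`, capped at `s + 1`. -/
def DPEq (cls : ℕ → ℕ → ℕ) (RL ans best choice : ℕ → ℕ) (M N s tot t : ℕ) : Prop :=
  (∃ b : Bool, choice t = b.toNat ∧ best t = 1 ∧
    ∀ q < M, HeapAll (SatLit cls RL q) (2 * N) t → ans q = b.toNat) ∨
  (¬ (∃ b : Bool, ∀ q < M, HeapAll (SatLit cls RL q) (2 * N) t → ans q = b.toNat) ∧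
    (best t = s + 1 ∨ ∃ r < N, 2 * N * t + 2 * N < tot ∧ choice t = r + 2 ∧ best t ≤ s ∧
      best t = best (2 * N * t + 1 + 2 * r) + best (2 * N * t + 1 + (2 * r + 1))) ∧
    (2 * N * t + 2 * N < tot → ∀ r < N,
      best t ≤ best (2 * N * t + 1 + 2 * r) + best (2 * N * t + 1 + (2 * r + 1))))

/-- The tree described by the choices of the dynamic program. -/
def Reads (RL choice : ℕ → ℕ) (N tot : ℕ) : ℕ → DTree n → Prop
  | t, .leaf b => choice t = b.toNat
  | t, .node i l r => ∃ ρ < N, 2 * N * t + 2 * N < tot ∧ choice t = ρ + 2 ∧ RL ρ = i ∧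
      Reads RL choice N tot (2 * N * t + 1 + 2 * ρ) l ∧
      Reads RL choice N tot (2 * N * t + 1 + (2 * ρ + 1)) r

section DP

variable {RL ans best choice : ℕ → ℕ} {N s : ℕ}

/-- Level `l` is the index interval from `heapOff B l` to `heapOff B (l + 1)`, so the depth of a
node never has to be stored. -/
theorem heap_child_range {B t l L : ℕ} (h₁ : heapOff B l ≤ t) (h₂ : t < heapOff B (l + 1))
    (hL : L < B) :
    heapOff B (l + 1) ≤ B * t + 1 + L ∧ B * t + 1 + L < heapOff B (l + 2) := by
  constructor
  · have := Nat.mul_le_mul_left B h₁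
    simp only [heapOff]; omega
  · have := Nat.mul_le_mul_left B (Nat.succ_le_of_lt h₂)
    rw [heapOff]
    rw [Nat.mul_succ] at this
    omega

/-- Soundness: an entry that does not exceed the cap is attained by a tree. Induction on the number
`h` of levels below the node. -/
theorem DPEq.exists_tree (hRL : ∀ r < N, RL r < n)
    (hdp : ∀ t < heapOff (2 * N) (dd + 1),
      DPEq cls RL ans best choice M N s (heapOff (2 * N) (dd + 1)) t) :
    ∀ (h l t : ℕ), l + h = dd → heapOff (2 * N) l ≤ t → t < heapOff (2 * N) (l + 1) →
      best t ≤ s → ∃ T : DTree n, T.depth ≤ h ∧ T.size = best t ∧ Reads RL choice N (heapOff (2 * N) (dd + 1)) t T ∧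
        ∀ q < M, HeapAll (SatLit cls RL q) (2 * N) t →
          (T.eval (sample n cls q)).toNat = ans q := by
  intro h
  induction h with
  | zero =>
    intro l t hl h₁ h₂ hs
    rw [show l = dd by omega] at h₁ h₂
    rcases hdp t h₂ with ⟨b, hb, hbest, hc⟩ | ⟨-, hbest | ⟨r, hr, hlt, -⟩, -⟩
    · exact ⟨.leaf b, le_rfl, hbest.symm, hb, fun q hq hm => (hc q hq hm).symm⟩
    · omega
    -- On the last level the children would lie outside the heap, which leaves only the leaf case.
    · have := Nat.mul_le_mul_left (2 * N) h₁
      simp only [heapOff] at hlt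
      omega
  | succ h ih =>
    intro l t hl h₁ h₂ hs
    have ht : t < heapOff (2 * N) (dd + 1) :=
      lt_of_lt_of_le h₂ (heapOff_mono _ (by omega))
    rcases hdp t ht with ⟨b, hb, hbest, hc⟩ | ⟨-, hbest | ⟨r, hr, hlt, hch, hle, hbest⟩, -⟩
    · exact ⟨.leaf b, by simp [DTree.depth], hbest.symm, hb, fun q hq hm => (hc q hq hm).symm⟩
    · omega
    · obtain ⟨a₁, a₂⟩ := heap_child_range h₁ h₂ (show 2 * r < 2 * N by omega)
      obtain ⟨b₁, b₂⟩ := heap_child_range h₁ h₂ (show 2 * r + 1 < 2 * N by omega)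
      obtain ⟨L, hL₁, hL₂, hL₃, hL₄⟩ := ih (l + 1) _ (by omega) a₁ a₂ (by omega)
      obtain ⟨R, hR₁, hR₂, hR₃, hR₄⟩ := ih (l + 1) _ (by omega) b₁ b₂ (by omega)
      refine ⟨.node ⟨RL r, hRL r hr⟩ L R, ?_, ?_, ⟨r, hr, hlt, hch, rfl, hL₃, hR₃⟩, ?_⟩
      · simp only [DTree.depth]; omega
      · simp only [DTree.size]; omega
      · intro q hq hm
        simp only [DTree.eval, sample]
        rcases Nat.mod_two_eq_zero_or_one (cls q (RL r)) with h0 | h0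
        · simp only [h0, ne_eq, not_true_eq_false, decide_false, Bool.false_eq_true, if_false]
          refine hL₄ q hq ((heapAll_child _ (by omega)).2 ⟨?_, hm⟩)
          rw [SatLit, show 2 * r / 2 = r by omega, h0]; omega
        · simp only [h0, ne_eq, one_ne_zero, not_false_eq_true, decide_true, if_true]
          refine hR₄ q hq ((heapAll_child _ (by omega)).2 ⟨?_, hm⟩)
          rw [SatLit, show (2 * r + 1) / 2 = r by omega, h0]; omega

/-- Optimality: the two subtrees of a consistent tree are consistent at the corresponding children,
so every consistent tree over the listed variables bounds the entry from above. -/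
theorem DPEq.best_le
    (hdp : ∀ t < heapOff (2 * N) (dd + 1),
      DPEq cls RL ans best choice M N s (heapOff (2 * N) (dd + 1)) t) (T : DTree n) :
    ∀ (l t : ℕ), l + T.depth ≤ dd → heapOff (2 * N) l ≤ t → t < heapOff (2 * N) (l + 1) →
      (∀ i ∈ T.vars, ∃ r < N, RL r = i) →
      (∀ q < M, HeapAll (SatLit cls RL q) (2 * N) t →
        (T.eval (sample n cls q)).toNat = ans q) → best t ≤ T.size := by
  induction T with
  | leaf b =>
    intro l t hl h₁ h₂ _ hc
    have ht : t < heapOff (2 * N) (dd + 1) :=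
      lt_of_lt_of_le h₂ (heapOff_mono _ (by omega))
    rcases hdp t ht with ⟨b, hb, hbest, _⟩ | ⟨hno, -⟩
    · exact hbest.le
    · exact (hno ⟨b, fun q hq hm => (hc q hq hm).symm⟩).elim
  | node i L R ihL ihR =>
    intro l t hl h₁ h₂ hv hc
    simp only [DTree.depth] at hl
    have ht : t < heapOff (2 * N) (dd + 1) :=
      lt_of_lt_of_le h₂ (heapOff_mono _ (by omega))
    rcases hdp t ht with ⟨b, hb, hbest, _⟩ | ⟨-, -, hmin⟩
    · have := (DTree.node i L R).card_vars_lt_size; omega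
    · obtain ⟨r, hr, hri⟩ := hv i (by simp [DTree.vars])
      obtain ⟨a₁, a₂⟩ := heap_child_range h₁ h₂ (show 2 * r < 2 * N by omega)
      obtain ⟨b₁, b₂⟩ := heap_child_range h₁ h₂ (show 2 * r + 1 < 2 * N by omega)
      obtain ⟨c₁, c₂⟩ := heap_child_range h₁ h₂ (show 2 * N - 1 < 2 * N by omega)
      have hlt : 2 * N * t + 2 * N < heapOff (2 * N) (dd + 1) := by
        refine lt_of_lt_of_le ?_ (heapOff_mono (2 * N) (show l + 2 ≤ dd + 1 by omega))
        omega
      refine (hmin hlt r hr).trans (Nat.add_le_add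
        (ihL (l + 1) _ (by omega) a₁ a₂ (fun j hj => hv j (by simp [DTree.vars, hj]))
          fun q hq hm => ?_)
        (ihR (l + 1) _ (by omega) b₁ b₂ (fun j hj => hv j (by simp [DTree.vars, hj]))
          fun q hq hm => ?_))
      · obtain ⟨hs, hm⟩ := (heapAll_child _ (by omega)).1 hm
        have := hc q hq hm
        rw [SatLit, show 2 * r / 2 = r by omega, hri] at hs
        simpa [DTree.eval, sample, show cls q i % 2 = 0 by omega] using this
      · obtain ⟨hs, hm⟩ := (heapAll_child _ (by omega)).1 hm
        have := hc q hq hm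
        rw [SatLit, show (2 * r + 1) / 2 = r by omega, hri] at hs
        simpa [DTree.eval, sample, show cls q i % 2 = 1 by omega] using this

/-- The dynamic program finds a tree of depth at most `dd` and size at most `s` for `f`. -/
theorem DPEq.exists_reads (hS : Sampling n (2 * dd + 1) M cls) {T₀ : DTree n}
    (hdepth : T₀.depth ≤ dd) (hsize : T₀.size ≤ s) (hRL : ∀ r < N, RL r < n)
    (hrel : ∀ i, Relevant T₀.eval i → ∃ r < N, RL r = i)
    (hans : ∀ q < M, ans q = (T₀.eval (sample n cls q)).toNat)
    (hdp : ∀ t < heapOff (2 * N) (dd + 1),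
      DPEq cls RL ans best choice M N s (heapOff (2 * N) (dd + 1)) t) :
    ∃ T : DTree n, T.depth ≤ dd ∧ T.size ≤ s ∧ T.eval = T₀.eval ∧
      Reads RL choice N (heapOff (2 * N) (dd + 1)) 0 T := by
  classical
  set R : Finset (Fin n) := Finset.univ.filter fun i => ∃ r < N, RL r = i with hR
  have hroot : (0 : ℕ) < heapOff (2 * N) (0 + 1) := by simp [heapOff]
  -- Restricting `T₀` to the listed variables keeps the function, as all relevant variables are
  -- listed, and increases neither depth nor size. The restricted tree competes in the dynamic
  -- program.
  have hev : (T₀.restrict R).eval = T₀.eval := by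
    funext x
    rw [DTree.eval_restrict]
    exact eval_restrict_relevant (f := T₀.eval) (R := R)
      (fun i hi => by simpa [hR] using hrel i hi) x
  have hle : best 0 ≤ s := by
    refine (DPEq.best_le hdp (T₀.restrict R) 0 0 ?_ le_rfl hroot ?_ ?_).trans
      ((DTree.size_restrict_le R T₀).trans hsize)
    · have := DTree.depth_restrict_le R T₀; omega
    · intro i hi
      simpa [hR] using DTree.vars_restrict_subset R T₀ hi
    · intro q hq _
      rw [hev, hans q hq]
  obtain ⟨T, h₁, h₂, h₃, h₄⟩ := DPEq.exists_tree hRL hdp dd 0 0 (by omega) le_rfl hroot hle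
  refine ⟨T, h₁, h₂ ▸ hle, hS.eval_eq h₁ hdepth fun q hq => ?_, h₃⟩
  have := h₄ q hq (heapAll_zero _ _)
  rw [hans q hq] at this
  revert this
  cases T.eval (sample n cls q) <;> cases T₀.eval (sample n cls q) <;> simp

end DP

end DTLearn

namespace DTLearn

variable {n w : ℕ} {f : (Fin n → Bool) → Bool}

theorem Runs.block' {p : Prog} {σ : State} {T M : ℕ} {Q : State → Prop} (h : p.wp w f Q σ)
    (hq : p.queries = 0) (ht : p.time ≤ T) : Runs w f p σ T M Q :=
  (Runs.block h).mono (by simpa [hq] using ht) (by simp [hq]) fun _ h => h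

/-! ### Setting up the parameters -/

/-- Register `20` becomes the number of base `b` digits of register `19`. -/
def countDigits (b : ℕ) : Prog :=
  20 ⇐ 0 ⨟ .loop (rg 19) (19 ⇐ rg 19 / rg b ⨟ 20 ⇐ rg 20 + 1)

/-- The value itself, strictly decreased by every division, serves as time potential; a logarithmic
bound is not needed. -/
theorem runs_countDigits {b : ℕ} (h19 : b ≠ 19) (h20 : b ≠ 20) {σ : State} {β v : ℕ}
    (hβ : σ.reg b = β) (hβ2 : 1 < β) (hv : σ.reg 19 = v) (hw : (Nat.digits β v).length < w) :
    Runs w f (countDigits b) σ (v * 10 + 4) 0 fun σ' => σ'.reg 20 = (Nat.digits β v).length := by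
  refine (Runs.seq (P := fun σ₁ => σ₁.reg 20 = 0) (T₁ := 2) (M₁ := 0)
    (Runs.block' (by simp [Prog.wp]) rfl (by decide)) (T₂ := v * 10 + 2) (M₂ := 0)
    fun σ₁ h₁ hA hS => ?_).mono (by omega) (by omega) fun _ h => h
  have h1b : σ₁.reg b = β := by
    rw [hA.reg b (by simp [Prog.wrReg, h20.symm]), hβ]
  have h1v : σ₁.reg 19 = v := by rw [hA.reg 19 rfl, hv]
  refine (Runs.loop (fun σ₂ => σ₂.reg 20 + (Nat.digits β (σ₂.reg 19)).length =
      (Nat.digits β v).length) (fun σ₂ => σ₂.reg 19 * 10) (fun _ => 0) ?_ ?_ ?_).mono ?_ le_rfl ?_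
  · simp [h₁, h1v]
  · intros; simp
  · intro σ₂ hI hA₂ hS₂ he
    have h2b : σ₂.reg b = β := by
      rw [hA₂.reg b (by simp [Prog.wrReg, h19.symm, h20.symm]), h1b]
    have hpos : 0 < σ₂.reg 19 := Nat.pos_of_ne_zero (by simpa using he)
    have hd := Nat.div_lt_self hpos hβ2
    rw [Nat.digits_def' hβ2 hpos, List.length_cons] at hI
    refine ⟨8, 0, Runs.block' ?_ rfl (le_refl 8)⟩
    simp only [Prog.wp, Expr.ok_div, Expr.ok_reg, Expr.ok_add, Expr.ok_num, Expr.eval_div,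
      Expr.eval_reg, Expr.eval_add, Expr.eval_num, State.reg_setReg, h2b]
    have : (rg 19).cost = 1 := rfl
    simp
    omega
  · have : (rg 19).cost = 1 := rfl
    rw [h1v, this]
  · rintro σ₂ ⟨hI, he⟩
    simp only [Expr.eval_reg] at he
    simpa [he] using hI

/-- Register `dst` becomes the `k`-th power of register `b`, where `k` is in register `4`. -/
def power (dst b : ℕ) : Prog := dst ⇐ 1 ⨟ .forLt 18 4 (dst ⇐ rg dst * rg b)

theorem runs_power {dst b : ℕ} (h1 : dst ≠ 18) (h2 : dst ≠ 4) (h3 : b ≠ dst) (h4 : b ≠ 18)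
    {σ : State} {β k : ℕ} (hβ : σ.reg b = β) (hβ0 : 0 < β) (hk : σ.reg 4 = k) (hw : β ^ k < w) :
    Runs w f (power dst b) σ (k * 12 + 8) 0 fun σ' => σ'.reg dst = β ^ k := by
  refine (Runs.seq (P := fun σ₁ => σ₁.reg dst = 1) (T₁ := 2) (M₁ := 0)
    (Runs.block' (by simp [Prog.wp]) rfl (le_refl 2)) (T₂ := k * 12 + 6) (M₂ := 0)
    fun σ₁ h₁ hA hS => ?_).mono (by omega) (by omega) fun _ h => h
  have h1b : σ₁.reg b = β := by
    rw [hA.reg b (by simp [Prog.wrReg, h3.symm]), hβ]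
  have h1k : σ₁.reg 4 = k := by rw [hA.reg 4 (by simp [Prog.wrReg, h2]), hk]
  refine ((Runs.forLt (T := 4) (M := 0) (fun j σ₂ => σ₂.reg dst = β ^ j) k
    (by simp [Prog.wrReg, h1]) (by simp [Prog.forLt, Prog.wrReg, h2]) h1k ?_ ?_)).mono
    le_rfl (by omega) fun _ h => h.1
  · simp [h1, h₁]
  · intro j σ₂ hj hI _ hA₂ hS₂
    have h2b : σ₂.reg b = β := by
      rw [hA₂.reg b (by simp [Prog.wrReg, Prog.forLt, h3.symm, h4.symm]), h1b]
    refine Runs.block' ?_ rfl (le_refl 4)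
    have : β ^ j * β ≤ β ^ k := by
      rw [← pow_succ]; exact Nat.pow_le_pow_right hβ0 hj
    simp [Prog.wp, h1, h2b, hI, pow_succ]
    omega

/-- Register `16` becomes nonzero if register `5` holds a good prime. -/
def testPrime : Prog :=
  17 ⇐ 0 ⨟ .forLt 18 5 (.cond (rg 5 % rg 18) .skip (17 ⇐ rg 17 + 1)) ⨟
  19 ⇐ rg 0 ⨟ countDigits 5 ⨟
  .cond (rg 17 - 1) .skip (.cond (rg 5 - rg 4 * rg 4 * rg 20) (16 ⇐ 1) .skip)

/-- Register `5` becomes the least good prime. -/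
def findPrime : Prog :=
  5 ⇐ 8 * rg 4 * rg 4 - 1 ⨟ 16 ⇐ 0 ⨟ .loop (1 - rg 16) (5 ⇐ rg 5 + 1 ⨟ testPrime)

/-- The trial divisor 0 is never counted, as `q % 0 = q`, and 1 always is; primality means that
nothing else is counted. -/
theorem prime_iff_card_divisors {q : ℕ} (hq : 1 < q) :
    ((Finset.range q).filter fun t => q % t = 0).card ≤ 1 ↔ q.Prime := by
  rw [Finset.card_le_one]
  simp only [Finset.mem_filter, Finset.mem_range]
  constructor
  · intro h
    rw [Nat.prime_def_lt]
    refine ⟨hq, fun m hm hd => ?_⟩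
    exact h m ⟨hm, Nat.mod_eq_zero_of_dvd hd⟩ 1 ⟨hq, Nat.mod_one _⟩
  · intro hp
    have : ∀ a, a < q ∧ q % a = 0 → a = 1 := by
      rintro a ⟨h1, h2⟩
      rcases (Nat.dvd_prime hp).1 (Nat.dvd_of_mod_eq_zero h2) with h | h <;> omega
    intro a ha b hb
    rw [this a ha, this b hb]

theorem length_digits_le {β : ℕ} (hβ : 1 < β) (u : ℕ) : (Nat.digits β u).length ≤ u := by
  rw [Nat.digits_length_le_iff hβ]
  exact Nat.lt_pow_self hβ

theorem runs_testPrime {σ : State} {k q : ℕ} (h0 : σ.reg 0 = n) (h4 : σ.reg 4 = k)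
    (h5 : σ.reg 5 = q) (h16 : σ.reg 16 = 0) (hk : 0 < k) (hq : 8 * k * k ≤ q)
    (hw : k * k * n < w) :
    Runs w f testPrime σ (q * 20 + n * 10 + 50) 0 fun σ' =>
      (σ'.reg 16 = 0 ∧ ¬ GoodPrime n k q) ∨ (σ'.reg 16 = 1 ∧ GoodPrime n k q) := by
  have hq1 : 1 < q := by nlinarith
  refine (Runs.seq (P := fun σ₁ => σ₁.reg 17 = 0) (T₁ := 2) (M₁ := 0)
    (Runs.block' (by simp [Prog.wp]) rfl (le_refl 2)) (T₂ := q * 20 + n * 10 + 48) (M₂ := 0)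
    fun σ₁ h₁ hA₁ hS₁ => ?_).mono (by omega) (by omega) fun _ h => h
  have h5₁ : σ₁.reg 5 = q := by rw [hA₁.reg 5 rfl, h5]
  refine (Runs.seq (Runs.forLt (T := 10) (M := 0) (fun j σ₂ => σ₂.reg 17 =
    ((Finset.range j).filter fun t => q % t = 0).card) q rfl rfl h5₁ (by simp [h₁]) ?_)
    (T₂ := n * 10 + 40) (M₂ := 0) fun σ₂ h₂ hA₂ hS₂ => ?_).mono
    (by omega) (by omega) fun _ h => h
  · intro j σ₂ hj hI hj' hA₂ hS₂
    have h5₂ : σ₂.reg 5 = q := by rw [hA₂.reg 5 rfl, h5₁]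
    have hqw : q < w := by rw [← h5₂]; exact hS₂.reg 5
    have hcard : ((Finset.range j).filter fun t => q % t = 0).card ≤ j :=
      (Finset.card_filter_le _ _).trans (by simp)
    refine Runs.block' ?_ rfl (by decide)
    rw [Finset.range_add_one, Finset.filter_insert]
    by_cases hm : q % j = 0
    · simp [Prog.wp, h5₂, hj', hm, hI]
      omega
    · simp [Prog.wp, h5₂, hj', hm, hI]
  · have hcnt := h₂.1
    have g0 : σ₂.reg 0 = n := by rw [hA₂.reg 0 rfl, hA₁.reg 0 rfl, h0]
    have g4 : σ₂.reg 4 = k := by rw [hA₂.reg 4 rfl, hA₁.reg 4 rfl, h4]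
    have g5 : σ₂.reg 5 = q := by rw [hA₂.reg 5 rfl, h5₁]
    have g16 : σ₂.reg 16 = 0 := by rw [hA₂.reg 16 rfl, hA₁.reg 16 rfl, h16]
    refine (Runs.seq (P := fun σ₃ => σ₃.reg 19 = n) (T₁ := 2) (M₁ := 0)
      (Runs.block' (by simp [Prog.wp, g0]) rfl (le_refl 2)) (T₂ := n * 10 + 30) (M₂ := 0)
      fun σ₃ h₃ hA₃ hS₃ => ?_).mono (by omega) (by omega) fun _ h => h
    have hlen := length_digits_le hq1 n
    refine (Runs.seq (runs_countDigits (by decide) (by decide) (by rw [hA₃.reg 5 rfl, g5]) hq1 h₃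
      (lt_of_le_of_lt hlen (by rw [← h₃]; exact hS₃.reg 19))) (T₂ := 20) (M₂ := 0)
      fun σ₄ h₄ hA₄ hS₄ => ?_).mono (by omega) (by omega) fun _ h => h
    have e4 : σ₄.reg 4 = k := by rw [hA₄.reg 4 rfl, hA₃.reg 4 rfl, g4]
    have e5 : σ₄.reg 5 = q := by rw [hA₄.reg 5 rfl, hA₃.reg 5 rfl, g5]
    have e16 : σ₄.reg 16 = 0 := by rw [hA₄.reg 16 rfl, hA₃.reg 16 rfl, g16]
    have e17 : σ₄.reg 17 = ((Finset.range q).filter fun t => q % t = 0).card := by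
      rw [hA₄.reg 17 rfl, hA₃.reg 17 rfl, hcnt]
    have hkk : k * k < w := lt_of_le_of_lt (by
      have : 8 * k * k = 8 * (k * k) := by ring
      omega) (e5 ▸ hS₄.reg 5)
    have hkkl : k * k * (Nat.digits q n).length < w :=
      lt_of_le_of_lt (Nat.mul_le_mul_left _ hlen) hw
    refine Runs.block' ?_ rfl (by decide)
    simp only [Prog.wp, Expr.ok_sub, Expr.ok_reg, Expr.ok_num, Expr.eval_sub, Expr.eval_reg,
      Expr.eval_num, Expr.ok_mul, Expr.eval_mul, e4, e5, e17, h₄, e16, hkk, hkkl]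
    have hpi := prime_iff_card_divisors hq1
    refine ⟨by norm_num, fun h => Or.inl ⟨trivial, fun hg => ?_⟩, fun h => ⟨by norm_num, fun h' => ⟨by norm_num,
      Or.inr ⟨by simp, hpi.1 (by omega), hq, by omega⟩⟩, fun h' => Or.inl ⟨trivial, fun hg => ?_⟩⟩⟩
    · have := hpi.2 hg.prime; omega
    · have := hg.digits; omega

/-- The program knows no bound for its search. `P` is any good prime and enters only the analysis:
the search stops at `P` at the latest. -/
theorem runs_findPrime {σ : State} {k P : ℕ} (h0 : σ.reg 0 = n) (h4 : σ.reg 4 = k) (hk : 0 < k)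
    (hP : GoodPrime n k P) (hPw : P < w) (hw : k * k * n < w) :
    Runs w f findPrime σ (P * (P * 20 + n * 10 + 60) + 20) 0 fun σ' =>
      GoodPrime n k (σ'.reg 5) ∧ σ'.reg 5 ≤ P := by
  have hkP := hP.large
  have hk8 : 8 ≤ 8 * k * k := by nlinarith
  -- The start is one below the first candidate because the loop increments before it tests.
  refine (Runs.seq (P := fun σ₁ => σ₁.reg 5 = 8 * k * k - 1) (T₁ := 8) (M₁ := 0)
    (Runs.block' ?_ rfl (le_refl 8)) (T₂ := P * (P * 20 + n * 10 + 60) + 6) (M₂ := 0)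
    fun σ₁ h₁ hA₁ hS₁ => ?_).mono (by omega) (by omega) fun _ h => h
  · have : 8 * k ≤ 8 * k * k := Nat.le_mul_of_pos_right _ hk
    simp [Prog.wp, h4]
    omega
  refine (Runs.seq (P := fun σ₂ => σ₂.reg 16 = 0) (T₁ := 2) (M₁ := 0)
    (Runs.block' (by simp [Prog.wp]) rfl (le_refl 2))
    (T₂ := P * (P * 20 + n * 10 + 60) + 4) (M₂ := 0)
    fun σ₂ h₂ hA₂ hS₂ => ?_).mono (by omega) (by omega) fun _ h => h
  have g0 : σ₂.reg 0 = n := by rw [hA₂.reg 0 rfl, hA₁.reg 0 rfl, h0]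
  have g4 : σ₂.reg 4 = k := by rw [hA₂.reg 4 rfl, hA₁.reg 4 rfl, h4]
  have g5 : σ₂.reg 5 = 8 * k * k - 1 := by rw [hA₂.reg 5 rfl, h₁]
  refine (Runs.loop (fun σ₃ => 8 * k * k - 1 ≤ σ₃.reg 5 ∧ σ₃.reg 5 ≤ P ∧
      ((σ₃.reg 16 = 0 ∧ ∀ q, 8 * k * k ≤ q → q ≤ σ₃.reg 5 → ¬ GoodPrime n k q) ∨
        (σ₃.reg 16 = 1 ∧ GoodPrime n k (σ₃.reg 5))))
      (fun σ₃ => if σ₃.reg 16 = 0 then (P - σ₃.reg 5) * (P * 20 + n * 10 + 60) else 0)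
      (fun _ => 0) ?_ ?_ ?_).mono ?_ le_rfl ?_
  · refine ⟨g5.ge, by omega, Or.inl ⟨h₂, fun q h h' => by omega⟩⟩
  · intros; simp
  · rintro σ₃ ⟨hlo, hhi, hI⟩ hA₃ hS₃ he
    simp only [Expr.eval_sub, Expr.eval_num, Expr.eval_reg] at he
    obtain ⟨h16, hno⟩ : σ₃.reg 16 = 0 ∧ ∀ q, 8 * k * k ≤ q → q ≤ σ₃.reg 5 → ¬ GoodPrime n k q := by
      rcases hI with h | h
      · exact h
      · omega
    have hlt : σ₃.reg 5 < P := by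
      by_contra hge
      exact hno P hkP (by omega) hP
    refine ⟨4 + (P * 20 + n * 10 + 50), 0, ?_⟩
    refine (Runs.seq (P := fun σ₄ => σ₄.reg 5 = σ₃.reg 5 + 1) (T₁ := 4) (M₁ := 0)
      (Runs.block' ?_ rfl (le_refl 4)) (T₂ := P * 20 + n * 10 + 50) (M₂ := 0)
      fun σ₄ h₄ hA₄ hS₄ => ?_).mono le_rfl le_rfl fun _ h => h
    · simp [Prog.wp]; omega
    refine ((runs_testPrime (k := k) (q := σ₃.reg 5 + 1) ?_ ?_ h₄ ?_ hk (by omega) hw).post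
      (Q' := fun σ₅ => _) ?_).mono ?_ le_rfl fun _ h => h
    · rw [hA₄.reg 0 rfl, hA₃.reg 0 rfl, g0]
    · rw [hA₄.reg 4 rfl, hA₃.reg 4 rfl, g4]
    · rw [hA₄.reg 16 rfl, h16]
    · intro σ₅ h₅ hA₅ _
      have e5 : σ₅.reg 5 = σ₃.reg 5 + 1 := by rw [hA₅.reg 5 rfl, h₄]
      have hc : (1 - rg 16).cost = 3 := rfl
      obtain ⟨l, hl⟩ : ∃ l, P = σ₃.reg 5 + 1 + l := ⟨P - (σ₃.reg 5 + 1), by omega⟩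
      have hl1 : P - σ₃.reg 5 = l + 1 := by omega
      have hl2 : P - (σ₃.reg 5 + 1) = l := by omega
      rw [if_pos h16, hc, e5, hl1, hl2, add_mul]
      refine ⟨⟨by omega, by omega, ?_⟩, ?_, le_rfl⟩
      · rcases h₅ with ⟨h, h'⟩ | ⟨h, h'⟩
        · refine Or.inl ⟨h, fun q hq1 hq2 => ?_⟩
          rcases Nat.lt_or_ge (σ₃.reg 5) q with h3 | h3
          · rwa [show q = σ₃.reg 5 + 1 by omega]
          · exact hno q hq1 h3
        · exact Or.inr ⟨h, h'⟩
      · split <;> omega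
    · omega
  · have hc : (1 - rg 16).cost = 3 := rfl
    rw [if_pos h₂, hc]
    have := Nat.mul_le_mul_right (P * 20 + n * 10 + 60) (Nat.sub_le P (σ₂.reg 5))
    omega
  · rintro σ₃ ⟨⟨hlo, hhi, hI⟩, he⟩
    simp only [Expr.eval_sub, Expr.eval_num, Expr.eval_reg] at he
    rcases hI with h | h
    · omega
    · exact ⟨h.2, hhi⟩

end DTLearn

/-! ### Derived parameters and precomputed tables -/

namespace DTLearn

variable {n w : ℕ} {f : (Fin n → Bool) → Bool}

/-- The depth bound `min d (s - 1)` and the parameter `k`. -/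
def setDepth : Prog := 3 ⇐ rg 1 - (rg 1 - (rg 2 - 1)) ⨟ 4 ⇐ 2 * rg 3 + 1

/-- All parameters derived from `n`, `k` and the prime. -/
def setParams : Prog :=
  8 ⇐ 2 * rg 5 ⨟ 23 ⇐ 2 ⨟ power 6 5 ⨟ power 9 8 ⨟ power 22 23 ⨟
  19 ⇐ rg 8 ⨟ countDigits 23 ⨟
  (10 ⇐ 4 * rg 4 * rg 22 * (rg 4 * rg 20) ⨟ 11 ⇐ rg 5 * rg 10 ⨟ 7 ⇐ rg 0 + rg 6)

/-- The number of greedy rounds. -/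
def rounds (k Q : ℕ) : ℕ := 4 * k * 2 ^ k * (k * (Nat.digits 2 (2 * Q)).length)

/-- The registers that hold the parameters. -/
structure Params (n s dd k Q : ℕ) (σ : State) : Prop where
  r0 : σ.reg 0 = n
  r2 : σ.reg 2 = s
  r3 : σ.reg 3 = dd
  r4 : σ.reg 4 = k
  r5 : σ.reg 5 = Q
  r6 : σ.reg 6 = Q ^ k
  r7 : σ.reg 7 = n + Q ^ k
  r8 : σ.reg 8 = 2 * Q
  r9 : σ.reg 9 = (2 * Q) ^ k
  r10 : σ.reg 10 = rounds k Q
  r11 : σ.reg 11 = Q * rounds k Q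

theorem Params.agree {s dd k Q : ℕ} {p : Prog} {σ σ' : State} (h : Params n s dd k Q σ)
    (hA : Agree p σ σ') (hp : ∀ x < 12, p.wrReg x = false) : Params n s dd k Q σ' where
  r0 := by rw [hA.reg _ (hp _ (by norm_num)), h.r0]
  r2 := by rw [hA.reg _ (hp _ (by norm_num)), h.r2]
  r3 := by rw [hA.reg _ (hp _ (by norm_num)), h.r3]
  r4 := by rw [hA.reg _ (hp _ (by norm_num)), h.r4]
  r5 := by rw [hA.reg _ (hp _ (by norm_num)), h.r5]
  r6 := by rw [hA.reg _ (hp _ (by norm_num)), h.r6]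
  r7 := by rw [hA.reg _ (hp _ (by norm_num)), h.r7]
  r8 := by rw [hA.reg _ (hp _ (by norm_num)), h.r8]
  r9 := by rw [hA.reg _ (hp _ (by norm_num)), h.r9]
  r10 := by rw [hA.reg _ (hp _ (by norm_num)), h.r10]
  r11 := by rw [hA.reg _ (hp _ (by norm_num)), h.r11]

/-- Capping the depth at `s - 1` loses no tree, as the depth is less than the size, and for `s > 0`
makes quantities in terms of the depth comparable to powers of `s`. Truncated subtraction computes
the minimum. -/
theorem runs_setDepth {σ : State} {d s : ℕ} (h1 : σ.reg 1 = d) (h2 : σ.reg 2 = s)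
    (hw : 2 * d + 1 < w) :
    Runs w f setDepth σ 20 0 fun σ' => σ'.reg 3 = min d (s - 1) ∧
      σ'.reg 4 = 2 * min d (s - 1) + 1 := by
  refine Runs.block' ?_ rfl (by decide)
  have : d - (d - (s - 1)) = min d (s - 1) := by omega
  simp [setDepth, Prog.wp, h1, h2, this]
  omega

theorem runs_setParams {σ : State} {s dd k Q : ℕ} (h0 : σ.reg 0 = n) (h2 : σ.reg 2 = s)
    (h3 : σ.reg 3 = dd) (h4 : σ.reg 4 = k) (h5 : σ.reg 5 = Q) (hQ : 0 < Q) (hk : 0 < k)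
    (hw₁ : (2 * Q) ^ k < w) (hw₂ : Q * rounds k Q < w) (hw₃ : n + Q ^ k < w) :
    Runs w f setParams σ (36 * k + 20 * Q + 80) 0 fun σ' => Params n s dd k Q σ' := by
  have hQk : Q ^ k ≤ (2 * Q) ^ k := Nat.pow_le_pow_left (by omega) k
  have h2k : 2 ^ k ≤ (2 * Q) ^ k := Nat.pow_le_pow_left (by omega) k
  have h2Q : 2 * Q ≤ (2 * Q) ^ k := Nat.le_self_pow hk.ne' _
  refine (Runs.seq (P := fun σ₁ => σ₁.reg 8 = 2 * Q) (T₁ := 4) (M₁ := 0)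
    (Runs.block' (by simp [Prog.wp, h5]; omega) rfl (by decide))
    (T₂ := 36 * k + 20 * Q + 76) (M₂ := 0)
    fun σ₁ h₁ hA₁ hS₁ => ?_).mono (by omega) (by omega) fun _ h => h
  refine (Runs.seq (P := fun σ₁ => σ₁.reg 23 = 2) (T₁ := 2) (M₁ := 0)
    (Runs.block' (by simp [Prog.wp]) rfl (by decide)) (T₂ := 36 * k + 20 * Q + 74) (M₂ := 0)
    fun σ₂ h₂ hA₂ hS₂ => ?_).mono (by omega) (by omega) fun _ h => h
  refine (Runs.seq (runs_power (dst := 6) (b := 5) (β := Q) (k := k) (by decide) (by decide)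
    (by decide) (by decide)
    (by rw [hA₂.reg 5 rfl, hA₁.reg 5 rfl, h5]) hQ (by rw [hA₂.reg 4 rfl, hA₁.reg 4 rfl, h4])
    (by omega)) (T₂ := 24 * k + 20 * Q + 66) (M₂ := 0)
    fun σ₃ h₃ hA₃ hS₃ => ?_).mono (by omega) (by omega) fun _ h => h
  have b4 : σ₃.reg 4 = k := by rw [hA₃.reg 4 rfl, hA₂.reg 4 rfl, hA₁.reg 4 rfl, h4]
  have b8 : σ₃.reg 8 = 2 * Q := by rw [hA₃.reg 8 rfl, hA₂.reg 8 rfl, h₁]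
  have b23 : σ₃.reg 23 = 2 := by rw [hA₃.reg 23 rfl, h₂]
  refine (Runs.seq (runs_power (dst := 9) (b := 8) (β := 2 * Q) (k := k) (by decide) (by decide)
    (by decide) (by decide) b8 (by omega) b4 hw₁) (T₂ := 12 * k + 20 * Q + 58) (M₂ := 0)
    fun σ₄ h₄ hA₄ hS₄ => ?_).mono (by omega) (by omega) fun _ h => h
  refine (Runs.seq (runs_power (dst := 22) (b := 23) (β := 2) (k := k) (by decide) (by decide)
    (by decide) (by decide) (by rw [hA₄.reg 23 rfl, b23]) (by omega) (by rw [hA₄.reg 4 rfl, b4])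
    (by omega)) (T₂ := 20 * Q + 50) (M₂ := 0)
    fun σ₅ h₅ hA₅ hS₅ => ?_).mono (by omega) (by omega) fun _ h => h
  refine (Runs.seq (P := fun σ₁ => σ₁.reg 19 = 2 * Q) (T₁ := 2) (M₁ := 0)
    (Runs.block' (by simp [Prog.wp, hA₅.reg 8 rfl, hA₄.reg 8 rfl, b8]) rfl (by decide))
    (T₂ := 20 * Q + 48) (M₂ := 0)
    fun σ₆ h₆ hA₆ hS₆ => ?_).mono (by omega) (by omega) fun _ h => h
  have hlen := length_digits_le one_lt_two (2 * Q)
  refine (Runs.seq (runs_countDigits (by decide) (by decide)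
    (by rw [hA₆.reg 23 rfl, hA₅.reg 23 rfl, hA₄.reg 23 rfl, b23])
    one_lt_two h₆ (by omega)) (T₂ := 44) (M₂ := 0)
    fun σ₇ h₇ hA₇ hS₇ => ?_).mono (by omega) (by omega) fun _ h => h
  have e0 : σ₇.reg 0 = n := by
    rw [hA₇.reg 0 rfl, hA₆.reg 0 rfl, hA₅.reg 0 rfl, hA₄.reg 0 rfl, hA₃.reg 0 rfl, hA₂.reg 0 rfl,
      hA₁.reg 0 rfl, h0]
  have e2 : σ₇.reg 2 = s := by
    rw [hA₇.reg 2 rfl, hA₆.reg 2 rfl, hA₅.reg 2 rfl, hA₄.reg 2 rfl, hA₃.reg 2 rfl, hA₂.reg 2 rfl,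
      hA₁.reg 2 rfl, h2]
  have e3 : σ₇.reg 3 = dd := by
    rw [hA₇.reg 3 rfl, hA₆.reg 3 rfl, hA₅.reg 3 rfl, hA₄.reg 3 rfl, hA₃.reg 3 rfl, hA₂.reg 3 rfl,
      hA₁.reg 3 rfl, h3]
  have e4 : σ₇.reg 4 = k := by
    rw [hA₇.reg 4 rfl, hA₆.reg 4 rfl, hA₅.reg 4 rfl, hA₄.reg 4 rfl, b4]
  have e5 : σ₇.reg 5 = Q := by
    rw [hA₇.reg 5 rfl, hA₆.reg 5 rfl, hA₅.reg 5 rfl, hA₄.reg 5 rfl, hA₃.reg 5 rfl, hA₂.reg 5 rfl,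
      hA₁.reg 5 rfl, h5]
  have e6 : σ₇.reg 6 = Q ^ k := by
    rw [hA₇.reg 6 rfl, hA₆.reg 6 rfl, hA₅.reg 6 rfl, hA₄.reg 6 rfl, h₃]
  have e8 : σ₇.reg 8 = 2 * Q := by
    rw [hA₇.reg 8 rfl, hA₆.reg 8 rfl, hA₅.reg 8 rfl, hA₄.reg 8 rfl, b8]
  have e9 : σ₇.reg 9 = (2 * Q) ^ k := by
    rw [hA₇.reg 9 rfl, hA₆.reg 9 rfl, hA₅.reg 9 rfl, h₄]
  have e22 : σ₇.reg 22 = 2 ^ k := by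
    rw [hA₇.reg 22 rfl, hA₆.reg 22 rfl, h₅]
  set lam := (Nat.digits 2 (2 * Q)).length with hlam
  have hlam0 : 0 < lam := by
    rw [hlam, Nat.digits_def' one_lt_two (by omega)]; simp
  have hr : 4 * k * 2 ^ k * (k * lam) ≤ Q * (4 * k * 2 ^ k * (k * lam)) :=
    Nat.le_mul_of_pos_left _ hQ
  have hr' : Q * (4 * k * 2 ^ k * (k * lam)) < w := hw₂
  have hkl : 0 < k * lam := Nat.mul_pos hk hlam0
  have hp1 : 4 * k ≤ 4 * k * 2 ^ k := Nat.le_mul_of_pos_right _ (by positivity)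
  have hp2 : 4 * k * 2 ^ k ≤ 4 * k * 2 ^ k * (k * lam) := Nat.le_mul_of_pos_right _ hkl
  have hp3 : k * lam ≤ 4 * k * 2 ^ k * (k * lam) := Nat.le_mul_of_pos_left _ (by positivity)
  refine Runs.block' ?_ rfl (by decide)
  simp only [Prog.wp, Expr.ok_mul, Expr.ok_reg, Expr.ok_num, Expr.eval_mul, Expr.eval_reg,
    Expr.eval_num, Expr.ok_add, Expr.eval_add, State.reg_setReg, e0, e4, e5, e6, e22, h₇]
  refine ⟨⟨⟨⟨by norm_num, trivial, by omega⟩, trivial, by omega⟩, ⟨trivial, trivial, by omega⟩,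
    by omega⟩, ⟨trivial, trivial, by simpa using hr'⟩, ⟨trivial, trivial, by simpa using hw₃⟩, ?_⟩
  constructor <;> simp [e0, e2, e3, e4, e5, e6, e8, e9, rounds, ← hlam]

/-- The table of all values of the polynomials, and the table of classes. -/
def buildTables : Prog :=
  .forLt 16 5 (.forLt 17 7 (.store 1 (rg 16 * rg 7 + rg 17)
    ((rg 17 % rg 5 + rg 16 * ld 1 (rg 16 * rg 7 + rg 17 / rg 5)) % rg 5))) ⨟
  .forLt 16 5 (.cond (rg 5 - rg 16 * (4 * rg 4)) (.store 2 (rg 16) 2) (.store 2 (rg 16) (rg 16 % 2)))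

/-- The contents of the tables. -/
structure Tables (n k Q : ℕ) (σ : State) : Prop where
  ev : ∀ x < Q, ∀ i < n + Q ^ k, σ.arr 1 (x * (n + Q ^ k) + i) = ev Q x i
  cl : ∀ v < Q, σ.arr 2 v = cl k Q v

theorem Tables.agree {k Q : ℕ} {p : Prog} {σ σ' : State} (h : Tables n k Q σ)
    (hA : Agree p σ σ') (h₁ : p.wrArr 1 = false) (h₂ : p.wrArr 2 = false) : Tables n k Q σ' where
  ev := by rw [hA.arr 1 h₁]; exact h.ev
  cl := by rw [hA.arr 2 h₂]; exact h.cl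

theorem mul_add_lt_mul {x Q i N : ℕ} (hx : x < Q) (hi : i < N) : x * N + i < Q * N := by
  calc x * N + i < x * N + N := by omega
    _ = (x + 1) * N := by ring
    _ ≤ Q * N := Nat.mul_le_mul_right _ hx

theorem mul_add_inj {x y i j N : ℕ} (hi : i < N) (hj : j < N) :
    x * N + i = y * N + j ↔ x = y ∧ i = j := by
  constructor
  · intro h
    have h1 : x = y := by
      have := congrArg (· / N) h
      simp only [mul_comm _ N, Nat.mul_add_div (show 0 < N by omega), Nat.div_eq_of_lt hi,
        Nat.div_eq_of_lt hj] at this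
      simpa using this
    subst h1
    exact ⟨rfl, by omega⟩
  · rintro ⟨rfl, rfl⟩; rfl

theorem Runs.seq_le {p q : Prog} {σ : State} {T M T₁ M₁ T₂ M₂ : ℕ} {P Q : State → Prop}
    (h₁ : Runs w f p σ T₁ M₁ P) (hT : T₁ + T₂ ≤ T) (hM : M₁ + M₂ ≤ M)
    (h₂ : ∀ σ₁, P σ₁ → Agree p σ σ₁ → Small w σ₁ → Runs w f q σ₁ T₂ M₂ Q) :
    Runs w f (p ⨟ q) σ T M Q :=
  (Runs.seq h₁ h₂).mono hT hM fun _ h => h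

/-- One table serves both stages: columns up to `n + Q ^ k` include the indices of the variables to
be hashed and the codes of the polynomials evaluated at the hashes. -/
theorem runs_buildTables {σ : State} {s dd k Q : ℕ} (hp : Params n s dd k Q σ) (hQ : 1 < Q)
    (hz : ∀ i, σ.arr 1 i = 0)
    (hw : Q * (n + Q ^ k) < w) (hw₂ : Q * Q + Q < w) (hw₃ : Q * (4 * k) < w) :
    Runs w f buildTables σ (Q * ((n + Q ^ k) * 30 + 14) + Q * 30 + 12) 0
      fun σ' => Tables n k Q σ' := by
  set N := n + Q ^ k with hN
  have hN0 : 0 < N := by have := pow_pos (show 0 < Q by omega) k; omega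
  refine Runs.seq_le (P := fun σ₁ => ∀ x < Q, ∀ i < N, σ₁.arr 1 (x * N + i) = ev Q x i)
    (T₁ := Q * (N * 30 + 14) + 6) (M₁ := 0) (T₂ := Q * 30 + 6) (M₂ := 0) ?_
    (by omega) le_rfl fun σ₁ h₁ hA₁ hS₁ => ?_
  · refine (Runs.forLt (T := N * 30 + 6) (M := 0) (fun x σ₁ =>
      (∀ y < x, ∀ i < N, σ₁.arr 1 (y * N + i) = ev Q y i) ∧
      ∀ y, x ≤ y → ∀ i < N, σ₁.arr 1 (y * N + i) = 0) Q rfl rfl hp.r5 ?_ ?_).mono le_rfl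
      (by simp) fun _ h => h.1.1
    · exact ⟨fun y hy => by omega, fun y _ i _ => hz _⟩
    rintro x σ₁ hx ⟨hI₁, hI₂⟩ hx' hA₁ hS₁
    have hp₁ := hp.agree hA₁ (by decide)
    refine (Runs.forLt (T := 22) (M := 0) (fun i σ₂ =>
      (∀ y < x, ∀ i < N, σ₂.arr 1 (y * N + i) = ev Q y i) ∧
      (∀ j < i, σ₂.arr 1 (x * N + j) = ev Q x j) ∧
      (∀ j, i ≤ j → j < N → σ₂.arr 1 (x * N + j) = 0) ∧
      ∀ y, x < y → ∀ i < N, σ₂.arr 1 (y * N + i) = 0) N rfl rfl hp₁.r7 ?_ ?_).mono (by omega)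
      (by simp) ?_
    · exact ⟨hI₁, fun j hj => by omega, fun j _ hj => hI₂ x le_rfl j hj,
        fun y hy => hI₂ y hy.le⟩
    · rintro i σ₂ hi ⟨hJ₁, hJ₂, hJ₃, hJ₄⟩ hi' hA₂ hS₂
      have hp₂ := hp₁.agree hA₂ (by decide)
      have hx₂ : σ₂.reg 16 = x := by rw [hA₂.reg 16 rfl, hx']
      -- Entry `i / Q` is already written unless `i = 0`; then the cell reads its own initial
      -- content 0, which is the correct value. Hence the invariant on unwritten cells.
      have hval : σ₂.arr 1 (x * N + i / Q) = ev Q x (i / Q) := by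
        rcases Nat.eq_zero_or_pos i with rfl | hpos
        · simpa [ev_zero] using hJ₃ 0 le_rfl hN0
        · exact hJ₂ _ (Nat.div_lt_self hpos hQ)
      have hidx := mul_add_lt_mul hx hi
      have hdiv : i / Q ≤ i := Nat.div_le_self _ _
      have hmod := Nat.mod_lt i (show 0 < Q by omega)
      have hev := ev_lt (show 0 < Q by omega) x (i / Q)
      have hmul : x * ev Q x (i / Q) ≤ Q * Q := Nat.mul_le_mul hx.le hev.le
      refine Runs.block' ?_ rfl (by decide)
      simp only [Prog.wp, Expr.ok_mul, Expr.ok_reg, Expr.eval_mul, Expr.eval_reg, Expr.ok_load,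
        Expr.eval_load, Expr.ok_mod, Expr.eval_mod, Expr.ok_div, Expr.eval_div, Expr.ok_add,
        Expr.eval_add, hp₂.r5, hp₂.r7, ← hN, hx₂, hi', hval, ← ev_step hQ, State.arr_setArr,
        State.arr_setReg, true_and, and_true]
      refine ⟨⟨by omega, by omega⟩, ⟨⟨⟨by omega, by omega⟩, by omega⟩, by omega⟩, ?_, ?_, ?_, ?_⟩
      · intro y hy j hj
        rw [if_neg (by rw [mul_add_inj hj hi]; omega)]; exact hJ₁ y hy j hj
      · intro j hj
        by_cases hji : j = i
        · subst hji; simp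
        · rw [if_neg (by rw [mul_add_inj (by omega) hi]; omega)]; exact hJ₂ j (by omega)
      · intro j hj hjN
        rw [if_neg (by rw [mul_add_inj hjN hi]; omega)]; exact hJ₃ j (by omega) hjN
      · intro y hy j hj
        rw [if_neg (by rw [mul_add_inj hj hi]; omega)]; exact hJ₄ y hy j hj
    · rintro σ₂ ⟨⟨hJ₁, hJ₂, -, hJ₄⟩, -⟩
      simp only [State.arr_setReg]
      refine ⟨fun y hy => ?_, fun y hy => hJ₄ y hy⟩
      rcases Nat.lt_succ_iff_lt_or_eq.1 hy with h | rfl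
      · exact hJ₁ y h
      · exact hJ₂
  · have hp₁ := hp.agree hA₁ (by decide)
    refine ((Runs.forLt (T := 22) (M := 0) (fun x σ₂ => ∀ v < x, σ₂.arr 2 v = cl k Q v)
      Q rfl rfl hp₁.r5 (fun v hv => by omega) ?_).post (Q' := fun σ' => Tables n k Q σ') ?_).mono
      (by omega) (by simp) fun _ h => h
    · intro v σ₂ hv hI hv' hA₂ hS₂
      have hp₂ := hp₁.agree hA₂ (by decide)
      have h4k : v * (4 * k) ≤ Q * (4 * k) := Nat.mul_le_mul_right _ hv.le
      have h4k' : 4 * k ≤ Q * (4 * k) := Nat.le_mul_of_pos_left _ (by omega)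
      refine Runs.block' ?_ rfl (by decide)
      have hstep : ∀ c, c = cl k Q v → ∀ u < v + 1,
          (if u = v then c else σ₂.arr 2 u) = cl k Q u := by
        rintro c rfl u hu
        by_cases huv : u = v
        · simp [huv]
        · rw [if_neg huv]; exact hI u (by omega)
      simp only [Prog.wp, Expr.ok_mul, Expr.ok_reg, Expr.eval_mul, Expr.eval_reg, Expr.ok_num,
        Expr.eval_num, Expr.ok_mod, Expr.eval_mod, Expr.ok_sub, Expr.eval_sub,
        hp₂.r5, hp₂.r4, hv', State.arr_setArr,
        State.arr_setReg, true_and]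
      refine ⟨⟨⟨by norm_num, by omega⟩, by omega⟩, fun h => ⟨by norm_num, hstep _ ?_⟩,
        fun h => ⟨by norm_num, hstep _ ?_⟩⟩
      · rw [cl, if_pos (by omega)]
      · rw [cl, if_neg (by omega)]
    · rintro σ₂ ⟨hI, -⟩ hA₂ -
      exact ⟨by rw [hA₂.arr 1 rfl]; exact h₁, hI⟩

end DTLearn

namespace DTLearn

variable {n w : ℕ} {f : (Fin n → Bool) → Bool}

/-! ### The greedy phase -/

/-- Register `22` becomes `1` if the polynomial in register `19` covers the constraint in register
`21`, and `0` otherwise. -/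
def testCover : Prog :=
  (22 ⇐ 1 ⨟ 23 ⇐ rg 21) ⨟ .forLt 24 4 (
    25 ⇐ ld 2 (ld 1 (rg 23 % rg 8 / 2 * rg 7 + rg 19)) ⨟
    .cond (rg 24) (26 ⇐ rg 23 % rg 8 % 2) (26 ⇐ 2) ⨟
    .cond (rg 25 - rg 26 + (rg 26 - rg 25)) (22 ⇐ 0) .skip ⨟
    23 ⇐ rg 23 / rg 8)

/-- Registers `17` and `18` become the largest number of uncovered constraints that a polynomial
covers and such a polynomial. -/
def findBest : Prog :=
  (17 ⇐ 0 ⨟ 18 ⇐ 0) ⨟ .forLt 19 6 (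
    20 ⇐ 0 ⨟
    .forLt 21 9 (.cond (ld 3 (rg 21)) .skip (testCover ⨟ 20 ⇐ rg 20 + rg 22)) ⨟
    .cond (rg 20 - rg 17) (17 ⇐ rg 20 ⨟ 18 ⇐ rg 19) .skip)

/-- Mark the constraints covered by the polynomial in register `19`. -/
def markCovered : Prog :=
  .forLt 21 9 (testCover ⨟ .cond (rg 22) (.store 3 (rg 21) 1) .skip)

/-- Write the greedy choices into array `4`. -/
def greedy : Prog :=
  .forLt 16 10 (findBest ⨟ (.store 4 (rg 16) (rg 18) ⨟ 19 ⇐ rg 18) ⨟ markCovered)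

section

variable {σ : State} {s dd k Q : ℕ}

theorem runs_testCover (hp : Params n s dd k Q σ) (ht : Tables n k Q σ) (hQ : 0 < Q) {ω z : ℕ}
    (hω : σ.reg 19 = ω) (hωQ : ω < Q ^ k) (hz : σ.reg 21 = z) (hw : Q * (n + Q ^ k) < w) :
    Runs w f testCover σ (k * 60 + 12) 0 fun σ' =>
      σ'.reg 22 = if Covers k Q ω z then 1 else 0 := by
  set N := n + Q ^ k with hN
  refine Runs.seq_le (P := fun σ₁ => σ₁.reg 22 = 1 ∧ σ₁.reg 23 = z) (T₁ := 4) (M₁ := 0)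
    (T₂ := k * 60 + 8) (M₂ := 0) (Runs.block' (by simp [Prog.wp, hz]) rfl (by decide)) (by omega)
    le_rfl fun σ₁ h₁ hA₁ hS₁ => ?_
  have hp₁ := hp.agree hA₁ (by decide)
  have ht₁ := ht.agree hA₁ rfl rfl
  have hω₁ : σ₁.reg 19 = ω := by rw [hA₁.reg 19 rfl, hω]
  refine (Runs.forLt (T := 46) (M := 0) (fun j σ₂ => σ₂.reg 23 = z / (2 * Q) ^ j ∧
    σ₂.reg 22 = if (∀ i < j, cl k Q (ev Q (z / (2 * Q) ^ i % (2 * Q) / 2) ω) =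
      if i = 0 then 2 else z / (2 * Q) ^ i % (2 * Q) % 2) then 1 else 0) k rfl rfl hp₁.r4
      (by simp [h₁]) ?_).mono (by omega) (by simp) fun _ h => h.1.2
  rintro j σ₂ hj ⟨hI₁, hI₂⟩ hj' hA₂ hS₂
  have hp₂ := hp₁.agree hA₂ (by decide)
  have ht₂ := ht₁.agree hA₂ rfl rfl
  have hω₂ : σ₂.reg 19 = ω := by rw [hA₂.reg 19 rfl, hω₁]
  set a := z / (2 * Q) ^ j with ha
  have ha2 : a % (2 * Q) / 2 < Q := by
    have := Nat.mod_lt a (show 0 < 2 * Q by omega); omega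
  have hidx := mul_add_lt_mul ha2 (show ω < N by omega)
  have hnext : a / (2 * Q) = z / (2 * Q) ^ (j + 1) := by
    rw [ha, Nat.div_div_eq_div_mul, pow_succ]
  have hev : σ₂.arr 1 (a % (2 * Q) / 2 * N + ω) = ev Q (a % (2 * Q) / 2) ω :=
    ht₂.ev _ ha2 _ (by omega)
  have hcl := ht₂.cl _ (ev_lt hQ (a % (2 * Q) / 2) ω)
  have hcl2 := cl_le k Q (ev Q (a % (2 * Q) / 2) ω)
  set c := cl k Q (ev Q (a % (2 * Q) / 2) ω) with hc
  have hS64 := hS₂.large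
  -- With truncated subtraction `c - b + (b - c)` vanishes exactly if `c = b`. One mismatch clears
  -- the flag for good.
  have key : ∀ b, b < 3 → (b = if j = 0 then 2 else a % (2 * Q) % 2) →
      c - b + (b - c) < w ∧ (c - b + (b - c) ≠ 0 → (0 : ℕ) =
        if (∀ i < j + 1, cl k Q (ev Q (z / (2 * Q) ^ i % (2 * Q) / 2) ω) =
          if i = 0 then 2 else z / (2 * Q) ^ i % (2 * Q) % 2) then 1 else 0) ∧
      (c - b + (b - c) = 0 → σ₂.reg 22 =
        if (∀ i < j + 1, cl k Q (ev Q (z / (2 * Q) ^ i % (2 * Q) / 2) ω) =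
          if i = 0 then 2 else z / (2 * Q) ^ i % (2 * Q) % 2) then 1 else 0) := by
    intro b hb hb'
    refine ⟨by omega, fun h => ?_, fun h => ?_⟩
    · rw [if_neg]
      intro hall
      have := hall j (by omega)
      rw [← hb', ← ha, ← hc] at this
      omega
    · rw [hI₂]
      congr 1
      rw [Nat.forall_lt_succ_right, ← hb', ← ha, ← hc, eq_iff_iff]
      exact ⟨fun h' => ⟨h', by omega⟩, fun h' => h'.1⟩
  refine Runs.block' ?_ rfl (by decide)
  simp only [Prog.wp, Expr.ok_mul, Expr.ok_reg, Expr.eval_mul, Expr.eval_reg, Expr.ok_load,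
        Expr.eval_load, Expr.ok_mod, Expr.eval_mod, Expr.ok_div, Expr.eval_div, Expr.ok_add,
        Expr.eval_add, Expr.ok_sub, Expr.eval_sub, Expr.ok_num, Expr.eval_num, hp₂.r8, hp₂.r7,
        ← hN, hω₂, hj', hI₁, State.reg_setReg,
        true_and, and_true]
  simp +decide only [hev, hcl, if_true, if_false, true_and]
  refine ⟨⟨by omega, by omega⟩, fun h => ?_, fun h => ?_⟩
  · obtain ⟨k₁, k₂, k₃⟩ := key (a % (2 * Q) % 2) (by omega) (by rw [if_neg h])
    exact ⟨k₁, fun h => ⟨hnext, k₂ h⟩, fun h => ⟨hnext, k₃ h⟩⟩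
  · obtain ⟨k₁, k₂, k₃⟩ := key 2 (by omega) (by rw [if_pos h])
    exact ⟨k₁, fun h => ⟨hnext, k₂ h⟩, fun h => ⟨hnext, k₃ h⟩⟩

theorem runs_findBest (hp : Params n s dd k Q σ) (ht : Tables n k Q σ) (hQ : 0 < Q)
    (hw : Q * (n + Q ^ k) < w) (U : ℕ → Prop) [DecidablePred U]
    (hU : ∀ z < (2 * Q) ^ k, σ.arr 3 z = 0 ↔ U z) :
    Runs w f findBest σ (Q ^ k * ((2 * Q) ^ k * (k * 60 + 40) + 40) + 10) 0 fun σ' =>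
      σ'.reg 18 < Q ^ k ∧ ∀ ω < Q ^ k,
        ((Finset.range ((2 * Q) ^ k)).filter fun z => U z ∧ Covers k Q ω z).card ≤
        ((Finset.range ((2 * Q) ^ k)).filter fun z => U z ∧ Covers k Q (σ'.reg 18) z).card := by
  set Z := (2 * Q) ^ k with hZ
  have hQk : 0 < Q ^ k := pow_pos hQ k
  set cnt : ℕ → ℕ := fun ω => ((Finset.range Z).filter fun z => U z ∧ Covers k Q ω z).card
    with hcnt
  refine Runs.seq_le (P := fun σ₁ => σ₁.reg 17 = 0 ∧ σ₁.reg 18 = 0) (T₁ := 4) (M₁ := 0)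
    (T₂ := Q ^ k * (Z * (k * 60 + 40) + 40) + 6) (M₂ := 0)
    (Runs.block' (by simp [Prog.wp]) rfl (by decide)) (by omega)
    le_rfl fun σ₁ h₁ hA₁ hS₁ => ?_
  have hp₁ := hp.agree hA₁ (by decide)
  have ht₁ := ht.agree hA₁ rfl rfl
  have hU₁ : ∀ z < Z, σ₁.arr 3 z = 0 ↔ U z := by rw [hA₁.arr 3 rfl]; exact hU
  -- For register `17` only an inequality is invariant: initially it is 0 with candidate polynomial
  -- 0, which has not been counted yet.
  refine (Runs.forLt (T := Z * (k * 60 + 40) + 32) (M := 0) (fun j σ₂ => σ₂.reg 18 < Q ^ k ∧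
    σ₂.reg 17 ≤ cnt (σ₂.reg 18) ∧ ∀ ω < j, cnt ω ≤ σ₂.reg 17) (Q ^ k) rfl rfl hp₁.r6
      (by simp [h₁, hQk]) ?_).mono (by simp [add_assoc]) (by simp)
      fun _ h => ⟨h.1.1, fun ω hω => (h.1.2.2 ω hω).trans h.1.2.1⟩
  rintro ω σ₂ hω ⟨hI₁, hI₂, hI₃⟩ hω' hA₂ hS₂
  have hp₂ := hp₁.agree hA₂ (by decide)
  have ht₂ := ht₁.agree hA₂ rfl rfl
  have hU₂ : ∀ z < Z, σ₂.arr 3 z = 0 ↔ U z := by rw [hA₂.arr 3 rfl]; exact hU₁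
  refine Runs.seq_le (P := fun σ₃ => σ₃.reg 20 = 0) (T₁ := 2) (M₁ := 0)
    (T₂ := Z * (k * 60 + 40) + 30) (M₂ := 0)
    (Runs.block' (by simp [Prog.wp]) rfl (by decide)) (by omega)
    le_rfl fun σ₃ h₃ hA₃ hS₃ => ?_
  have hp₃ := hp₂.agree hA₃ (by decide)
  have ht₃ := ht₂.agree hA₃ rfl rfl
  have hU₃ : ∀ z < Z, σ₃.arr 3 z = 0 ↔ U z := by rw [hA₃.arr 3 rfl]; exact hU₂
  have hω₃ : σ₃.reg 19 = ω := by rw [hA₃.reg 19 rfl, hω']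
  refine Runs.seq_le (P := fun σ₄ => σ₄.reg 20 = cnt ω) (T₁ := Z * (k * 60 + 40) + 6) (M₁ := 0)
    (T₂ := 24) (M₂ := 0) ?_ (by omega) le_rfl fun σ₄ h₄ hA₄ hS₄ => ?_
  · refine (Runs.forLt (T := k * 60 + 30) (M := 0) (fun j σ₄ => σ₄.reg 20 =
      ((Finset.range j).filter fun z => U z ∧ Covers k Q ω z).card) Z rfl rfl hp₃.r9
      (by simp [h₃]) ?_).mono
      (by have := Nat.mul_le_mul_left Z (show k * 60 + 30 + 8 ≤ k * 60 + 40 by omega); omega)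
      (by simp) fun _ h => h.1
    intro z σ₄ hz hI hz' hA₄ hS₄
    have hp₄ := hp₃.agree hA₄ (by decide)
    have ht₄ := ht₃.agree hA₄ rfl rfl
    have hω₄ : σ₄.reg 19 = ω := by rw [hA₄.reg 19 rfl, hω₃]
    have hU₄ : σ₄.arr 3 z = 0 ↔ U z := by rw [hA₄.arr 3 rfl]; exact hU₃ z hz
    have hle : ((Finset.range z).filter fun z => U z ∧ Covers k Q ω z).card ≤ z :=
      (Finset.card_filter_le _ _).trans (by simp)
    have hZw : Z < w := by rw [hZ, ← hp₄.r9]; exact hS₄.reg 9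
    rw [Finset.range_add_one, Finset.filter_insert]
    refine (Runs.cond (T := k * 60 + 16) (by simp) (fun he => ?_) fun he => ?_).mono
      (by have : (ld 3 (rg 21)).cost = 2 := rfl
          omega) le_rfl fun _ h => h
    · have : ¬ U z := by simpa [hz', hU₄] using he
      exact Runs.block' (by simp [Prog.wp, this, hI]) rfl (by simp [Prog.time])
    · have hUz : U z := by simpa [hz', hU₄] using he
      refine Runs.seq_le (runs_testCover hp₄ ht₄ hQ hω₄ hω hz' hw) (T₂ := 4) (M₂ := 0) (by omega)
        le_rfl fun σ₅ h₅ hA₅ hS₅ => ?_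
      have h20 : σ₅.reg 20 = _ := (hA₅.reg 20 rfl).trans hI
      refine Runs.block' ?_ rfl (by decide)
      by_cases hc : Covers k Q ω z
      · simp [Prog.wp, h₅, h20, hc, hUz]; omega
      · simp [Prog.wp, h₅, h20, hc]; omega
  · have h17 : σ₄.reg 17 = σ₂.reg 17 := by rw [hA₄.reg 17 rfl, hA₃.reg 17 rfl]
    have h18 : σ₄.reg 18 = σ₂.reg 18 := by rw [hA₄.reg 18 rfl, hA₃.reg 18 rfl]
    have h19 : σ₄.reg 19 = ω := by rw [hA₄.reg 19 rfl, hω₃]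
    refine Runs.block' ?_ rfl (by decide)
    simp only [Prog.wp, Expr.ok_sub, Expr.ok_reg, Expr.eval_sub, Expr.eval_reg, true_and,
      State.reg_setReg, h17, h18, h19, h₄]
    simp +decide only [if_true, if_false]
    refine ⟨fun h => ⟨hω, le_rfl, fun ω' hω' => ?_⟩,
      fun h => ⟨hI₁, hI₂, fun ω' hω' => ?_⟩⟩
    · rcases Nat.lt_succ_iff_lt_or_eq.1 hω' with h' | rfl
      · have := hI₃ ω' h'; omega
      · exact le_rfl
    · rcases Nat.lt_succ_iff_lt_or_eq.1 hω' with h' | rfl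
      · exact hI₃ ω' h'
      · omega

theorem runs_markCovered (hp : Params n s dd k Q σ) (ht : Tables n k Q σ) (hQ : 0 < Q) {ω : ℕ}
    (hω : σ.reg 19 = ω) (hωQ : ω < Q ^ k)
    (hw : Q * (n + Q ^ k) < w) :
    Runs w f markCovered σ ((2 * Q) ^ k * (k * 60 + 40) + 6) 0 fun σ' =>
      ∀ z < (2 * Q) ^ k, σ'.arr 3 z = 0 ↔ σ.arr 3 z = 0 ∧ ¬ Covers k Q ω z := by
  set Z := (2 * Q) ^ k with hZ
  refine (Runs.forLt (T := k * 60 + 30) (M := 0) (fun j σ₁ =>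
    (∀ z < j, σ₁.arr 3 z = 0 ↔ σ.arr 3 z = 0 ∧ ¬ Covers k Q ω z) ∧
    ∀ z, j ≤ z → σ₁.arr 3 z = σ.arr 3 z) Z rfl rfl hp.r9
    ⟨fun z hz => by omega, fun _ _ => rfl⟩ ?_).mono
    (by have := Nat.mul_le_mul_left Z (show k * 60 + 30 + 8 ≤ k * 60 + 40 by omega); omega)
    (by simp) fun _ h => h.1.1
  rintro z σ₁ hz ⟨hI₁, hI₂⟩ hz' hA₁ hS₁
  have hp₁ := hp.agree hA₁ (by decide)
  have ht₁ := ht.agree hA₁ rfl rfl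
  have hω₁ : σ₁.reg 19 = ω := by rw [hA₁.reg 19 rfl, hω]
  refine Runs.seq_le (runs_testCover hp₁ ht₁ hQ hω₁ hωQ hz' hw) (T₂ := 10) (M₂ := 0) (by omega)
    le_rfl fun σ₂ h₂ hA₂ hS₂ => ?_
  have h21 : σ₂.reg 21 = z := (hA₂.reg 21 rfl).trans hz'
  have h3 : σ₂.arr 3 = σ₁.arr 3 := hA₂.arr 3 rfl
  refine Runs.block' ?_ rfl (by decide)
  by_cases hc : Covers k Q ω z
  · simp only [Prog.wp, h₂, hc, if_true, Expr.ok_reg, Expr.eval_reg, Expr.ok_num, Expr.eval_num,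
      State.arr_setArr, State.arr_setReg, h21, h3, true_and]
    refine ⟨fun _ => ⟨by norm_num, fun y hy => ?_, fun y hy => ?_⟩, fun h => by simp at h⟩
    · by_cases hyz : y = z
      · simp [hyz, hc]
      · simpa [hyz] using hI₁ y (by omega)
    · rw [if_neg (by omega)]; exact hI₂ y (by omega)
  · simp only [Prog.wp, h₂, hc, if_false, Expr.ok_reg, Expr.eval_reg,
      State.arr_setReg, h3, true_and]
    refine ⟨fun h => (h rfl).elim, fun _ => ⟨fun y hy => ?_, fun y hy => hI₂ y (by omega)⟩⟩
    by_cases hyz : y = z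
    · subst hyz; simp [hc, hI₂ y le_rfl]
    · exact hI₁ y (by omega)

theorem runs_greedy (hp : Params n s dd k Q σ) (ht : Tables n k Q σ) (hQ : 0 < Q)
    (hz : ∀ z, σ.arr 3 z = 0) (hw : Q * (n + Q ^ k) < w) :
    Runs w f greedy σ (rounds k Q * (Q ^ k * ((2 * Q) ^ k * (k * 60 + 40) + 40) +
      (2 * Q) ^ k * (k * 60 + 40) + 40) + 6) 0 fun σ' => Greedy k Q (rounds k Q) (σ'.arr 4) := by
  set Z := (2 * Q) ^ k with hZ
  refine (Runs.forLt (T := Q ^ k * (Z * (k * 60 + 40) + 40) + Z * (k * 60 + 40) + 32) (M := 0)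
    (fun r σ₁ => Greedy k Q r (σ₁.arr 4) ∧
      ∀ z < Z, σ₁.arr 3 z = 0 ↔ ∀ r' < r, ¬ Covers k Q (σ₁.arr 4 r') z) (rounds k Q) rfl rfl hp.r10
    ⟨fun r hr => by omega, fun z _ => by simp [hz]⟩ ?_).mono (by simp [add_assoc])
    (by simp) fun _ h => h.1.1
  rintro r σ₁ hr ⟨hI₁, hI₂⟩ hr' hA₁ hS₁
  have hp₁ := hp.agree hA₁ (by decide)
  have ht₁ := ht.agree hA₁ rfl rfl
  refine Runs.seq_le (runs_findBest hp₁ ht₁ hQ hw _ hI₂)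
    (T₂ := Z * (k * 60 + 40) + 22) (M₂ := 0) (by rw [← hZ]; omega) le_rfl fun σ₂ h₂ hA₂ hS₂ => ?_
  have hp₂ := hp₁.agree hA₂ (by decide)
  have ht₂ := ht₁.agree hA₂ rfl rfl
  have hr₂ : σ₂.reg 16 = r := by rw [hA₂.reg 16 rfl, hr']
  refine Runs.seq_le (P := fun σ₃ => σ₃.reg 19 = σ₂.reg 18 ∧
      ∀ i, σ₃.arr 4 i = if i = r then σ₂.reg 18 else σ₁.arr 4 i) (T₁ := 8) (M₁ := 0)
    (T₂ := Z * (k * 60 + 40) + 6) (M₂ := 0)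
    (Runs.block' (by simp [Prog.wp, hr₂, hA₂.arr 4 rfl]) rfl (by decide)) (by omega)
    le_rfl fun σ₃ h₃ hA₃ hS₃ => ?_
  have hp₃ := hp₂.agree hA₃ (by decide)
  have ht₃ := ht₂.agree hA₃ rfl rfl
  refine ((runs_markCovered hp₃ ht₃ hQ h₃.1 h₂.1 hw).post (Q' := fun σ₄ => _) ?_)
  intro σ₄ h₄ hA₄ hS₄
  have hG : ∀ i, (σ₄.setReg 16 (r + 1)).arr 4 i = if i = r then σ₂.reg 18 else σ₁.arr 4 i := by
    intro i; rw [State.arr_setReg, hA₄.arr 4 rfl]; exact h₃.2 i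
  have hGlt : ∀ i < r, (σ₄.setReg 16 (r + 1)).arr 4 i = σ₁.arr 4 i := by
    intro i hi; rw [hG, if_neg (by omega)]
  have hGr : (σ₄.setReg 16 (r + 1)).arr 4 r = σ₂.reg 18 := by rw [hG, if_pos rfl]
  -- The new choice goes to cell `r`, so the greedy condition of earlier rounds, which looks only at
  -- earlier cells, persists.
  have hcov : ∀ r₁ ≤ r, ∀ z, (∀ r' < r₁, ¬ Covers k Q ((σ₄.setReg 16 (r + 1)).arr 4 r') z) ↔
      ∀ r' < r₁, ¬ Covers k Q (σ₁.arr 4 r') z := by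
    intro r₁ hr₁ z
    refine forall₂_congr fun r' h => ?_
    rw [hGlt r' (by omega)]
  refine ⟨fun r₁ hr₁ => ?_, fun z hz => ?_⟩
  · simp only [hcov r₁ (by omega)]
    rcases Nat.lt_succ_iff_lt_or_eq.1 hr₁ with h | rfl
    · rw [hGlt r₁ h]; exact hI₁ r₁ h
    · rw [hGr]; exact h₂
  · rw [Nat.forall_lt_succ_right, hcov r le_rfl, hGr, State.arr_setReg, h₄ z hz, hA₃.arr 3 rfl,
      hA₂.arr 3 rfl, hI₂ z hz]

end

end DTLearn

namespace DTLearn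

variable {n w : ℕ} {f : (Fin n → Bool) → Bool}

/-! ### The query phase -/

/-- The class of variable `i` in sample `q`. -/
def scl (k Q : ℕ) (G : ℕ → ℕ) (q i : ℕ) : ℕ :=
  vcl k Q (q / rounds k Q) (G (q % rounds k Q)) i

/-- A sample number `q` encodes the hash point `q / rounds k Q` and the greedy polynomial numbered
`q % rounds k Q`. -/
theorem Greedy.sampling {k Q : ℕ} {G : ℕ → ℕ} (hG : Greedy k Q (rounds k Q) G)
    (hQ : GoodPrime n k Q) (hk : 0 < k) : Sampling n k (Q * rounds k Q) (scl k Q G) := by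
  intro S i v hS hSk hin hi hv
  obtain ⟨x, hx, r, hr, h₁, h₂⟩ := exists_sample hQ hk
    (Nat.lt_base_pow_length_digits one_lt_two) hG hS hSk hin hi v hv
  change r < rounds k Q at hr
  have hd : (x * rounds k Q + r) / rounds k Q = x := by
    rw [mul_comm, Nat.mul_add_div (by omega), Nat.div_eq_of_lt hr, add_zero]
  have hm : (x * rounds k Q + r) % rounds k Q = r := by
    rw [mul_comm, Nat.mul_add_mod, Nat.mod_eq_of_lt hr]
  refine ⟨x * rounds k Q + r, mul_add_lt_mul hx hr, ?_, ?_⟩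
  · simpa only [scl, hd, hm] using h₁
  · simpa only [scl, hd, hm] using h₂

/-- Ask the black box for the hybrid given by registers `17`, `18` and `19`; the answer is put into
register `22`. -/
def ask : Prog :=
  .forLt 21 0 (.store 8 (rg 21) (ld 2 (ld 1 (ld 1 (rg 17 * rg 7 + rg 21) * rg 7 + rg 18)) %
    (2 + (1 - ld 6 (rg 21)) * (1 - (1 - (rg 19 - rg 21)))))) ⨟ .query 22 8

/-- Binary search for a relevant variable, which is put into register `23`. -/
def search : Prog :=
  (23 ⇐ 0 ⨟ 24 ⇐ rg 0) ⨟ .loop (rg 24 - rg 23 - 1)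
    (19 ⇐ (rg 23 + rg 24) / 2 ⨟ ask ⨟
      .cond (rg 20 - rg 22 + (rg 22 - rg 20)) (24 ⇐ rg 19) (23 ⇐ rg 19))

/-- Treat the sample in register `16`: find a new relevant variable, or store the answer and go to
the next sample. -/
def treatSample : Prog :=
  (17 ⇐ rg 16 / rg 10 ⨟ 18 ⇐ ld 4 (rg 16 % rg 10) ⨟ 19 ⇐ 0) ⨟ ask ⨟
  (20 ⇐ rg 22 ⨟ 19 ⇐ rg 0) ⨟ ask ⨟
  .cond (rg 20 - rg 22 + (rg 22 - rg 20))
    (search ⨟ .store 6 (rg 23) 1 ⨟ .store 7 (rg 12) (rg 23) ⨟ 12 ⇐ rg 12 + 1)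
    (.store 5 (rg 16) (rg 20) ⨟ 16 ⇐ rg 16 + 1)

/-- Query all samples and find all relevant variables. -/
def queryPhase : Prog :=
  (16 ⇐ 0 ⨟ 12 ⇐ 0) ⨟ .loop (rg 11 - rg 16) treatSample

section

variable {σ : State} {s dd k Q : ℕ}

/-- Nested look-ups: hash the variable, evaluate the polynomial at the hash, classify the value. The
index bounds keep the addresses within a word. -/
theorem Tables.vcl (ht : Tables n k Q σ) (hQ : 0 < Q) {x ω i : ℕ} (hx : x < Q)
    (hω : ω < Q ^ k) (hi : i < n) :
    x * (n + Q ^ k) + i < Q * (n + Q ^ k) ∧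
    σ.arr 1 (x * (n + Q ^ k) + i) * (n + Q ^ k) + ω < Q * (n + Q ^ k) ∧
    σ.arr 2 (σ.arr 1 (σ.arr 1 (x * (n + Q ^ k) + i) * (n + Q ^ k) + ω)) = vcl k Q x ω i := by
  rw [ht.ev x hx i (by omega)]
  have h1 := ev_lt hQ x i
  refine ⟨mul_add_lt_mul hx (by omega), mul_add_lt_mul h1 (by omega), ?_⟩
  rw [ht.ev _ h1 _ (by omega), ht.cl _ (ev_lt hQ _ _)]
  rfl

theorem runs_ask (hp : Params n s dd k Q σ) (ht : Tables n k Q σ) (hQ : 0 < Q) {q mid : ℕ}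
    {G : ℕ → ℕ} (h17 : σ.reg 17 = q / rounds k Q) (h18 : σ.reg 18 = G (q % rounds k Q))
    (h19 : σ.reg 19 = mid) (hx : q / rounds k Q < Q) (hω : G (q % rounds k Q) < Q ^ k)
    (hw : Q * (n + Q ^ k) < w) :
    Runs w f ask σ (n * 60 + 10) 1 fun σ' =>
      σ'.reg 22 = (f (hybrid n (scl k Q G) q (σ.arr 6) mid)).toNat := by
  refine Runs.seq_le (P := fun σ₁ => ∀ j < n, σ₁.arr 8 j =
      scl k Q G q j % (2 + (1 - σ.arr 6 j) * (1 - (1 - (mid - j)))))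
    (T₁ := n * 59 + 6) (M₁ := 0) (T₂ := n + 1) (M₂ := 1) ?_ (by omega) le_rfl
    fun σ₁ h₁ hA₁ hS₁ => ?_
  · refine (Runs.forLt (T := 51) (M := 0) (fun i σ₁ => ∀ j < i, σ₁.arr 8 j =
      scl k Q G q j % (2 + (1 - σ.arr 6 j) * (1 - (1 - (mid - j))))) n rfl rfl hp.r0
      (fun j hj => by omega) ?_).mono le_rfl (by simp) fun _ h => h.1
    intro i σ₁ hi hI hi' hA₁ hS₁
    have hp₁ := hp.agree hA₁ (by decide)
    have ht₁ := ht.agree hA₁ rfl rfl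
    obtain ⟨v₁, v₂, v₃⟩ := ht₁.vcl hQ hx hω hi
    have g17 := (hA₁.reg 17 rfl).trans h17
    have g18 := (hA₁.reg 18 rfl).trans h18
    have g19 := (hA₁.reg 19 rfl).trans h19
    have g6 := hA₁.arr 6 rfl
    have hlarge := hS₁.large
    have hm : (1 - σ.arr 6 i) * (1 - (1 - (mid - i))) ≤ 1 := by
      have h1 : 1 - σ.arr 6 i ≤ 1 := by omega
      have h2 : 1 - (1 - (mid - i)) ≤ 1 := by omega
      exact Nat.mul_le_mul h1 h2
    have hxN : q / rounds k Q * (n + Q ^ k) < w := by omega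
    have hyN : σ₁.arr 1 (q / rounds k Q * (n + Q ^ k) + i) * (n + Q ^ k) < w := by omega
    refine Runs.block' ?_ rfl (by decide)
    simp only [Prog.wp, Expr.ok_mul, Expr.ok_reg, Expr.eval_mul, Expr.eval_reg, Expr.ok_load,
        Expr.eval_load, Expr.ok_mod, Expr.eval_mod, Expr.ok_add, Expr.eval_add, Expr.ok_sub,
        Expr.eval_sub, Expr.ok_num, Expr.eval_num, hp₁.r7, g17, g18, g19, g6, hi', v₃,
        State.arr_setArr, State.arr_setReg, true_and, and_true, hxN, hyN]
    refine ⟨⟨⟨by omega, by omega⟩, by norm_num, ⟨by norm_num, by omega⟩, by omega⟩, fun j hj => ?_⟩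
    by_cases hji : j = i
    · subst hji; simp [scl]
    · rw [if_neg hji]; exact hI j (by omega)
  · have hpt : σ₁.point n 8 = hybrid n (scl k Q G) q (σ.arr 6) mid := by
      funext i
      simp only [State.point, hybrid, h₁ i i.2]
    refine (Runs.block (p := .query 22 8) ?_).mono (by simp [Prog.time, Prog.queries])
      (by simp [Prog.queries]) fun _ h => h
    simp [Prog.wp, hpt]

theorem toNat_diff (a b : Bool) : a.toNat - b.toNat + (b.toNat - a.toNat) = 0 ↔ a = b := by
  cases a <;> cases b <;> simp

theorem toNat_diff_lt {w : ℕ} (hw : 64 ≤ w) (a b : Bool) :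
    a.toNat - b.toNat + (b.toNat - a.toNat) < w := by
  have := Bool.toNat_lt a
  have := Bool.toNat_lt b
  omega

/-- The larger half of an interval of length `g` has length at most `(g + 1) / 2`; the rounded-up
logarithm still drops by one. -/
theorem clog_half {g g' : ℕ} (hg : 2 ≤ g) (hg' : g' ≤ (g + 1) / 2) :
    Nat.clog 2 g' + 1 ≤ Nat.clog 2 g := by
  rw [Nat.clog_of_two_le one_lt_two hg]
  have : g' ≤ (g + 2 - 1) / 2 := by omega
  exact Nat.succ_le_succ (Nat.clog_mono_right 2 this)

/-- The lower end keeps the value of hybrid 0 and the upper end the other value, so consecutive ends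
give a jump. Hybrid 0 has been queried before; each halving costs one query. -/
theorem runs_search (hp : Params n s dd k Q σ) (ht : Tables n k Q σ) (hQ : 0 < Q) {q : ℕ}
    {G : ℕ → ℕ} (h17 : σ.reg 17 = q / rounds k Q) (h18 : σ.reg 18 = G (q % rounds k Q))
    (hx : q / rounds k Q < Q) (hω : G (q % rounds k Q) < Q ^ k)
    (hw : Q * (n + Q ^ k) < w) (hw₂ : 2 * n < w)
    (h20 : σ.reg 20 = (f (hybrid n (scl k Q G) q (σ.arr 6) 0)).toNat)
    (hne : f (hybrid n (scl k Q G) q (σ.arr 6) 0) ≠ f (hybrid n (scl k Q G) q (σ.arr 6) n)) :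
    Runs w f search σ (Nat.clog 2 n * (n * 60 + 40) + 10) (Nat.clog 2 n) fun σ' =>
      σ'.reg 23 < n ∧ f (hybrid n (scl k Q G) q (σ.arr 6) (σ'.reg 23)) ≠
        f (hybrid n (scl k Q G) q (σ.arr 6) (σ'.reg 23 + 1)) := by
  set F : ℕ → Bool := fun mid => f (hybrid n (scl k Q G) q (σ.arr 6) mid) with hF
  have hn : 0 < n := by
    rcases Nat.eq_zero_or_pos n with h | h
    · have hne' : F 0 ≠ F n := hne
      rw [h] at hne'; exact (hne' rfl).elim
    · exact h
  refine Runs.seq_le (P := fun σ₁ => σ₁.reg 23 = 0 ∧ σ₁.reg 24 = n) (T₁ := 4) (M₁ := 0)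
    (T₂ := Nat.clog 2 n * (n * 60 + 40) + 6) (M₂ := Nat.clog 2 n)
    (Runs.block' (by simp [Prog.wp, hp.r0]) rfl (by decide)) (by omega) (by omega)
    fun σ₁ h₁ hA₁ hS₁ => ?_
  have hp₁ := hp.agree hA₁ (by decide)
  have ht₁ := ht.agree hA₁ rfl rfl
  have hcost : (rg 24 - rg 23 - 1).cost = 5 := rfl
  refine (Runs.loop (fun σ₂ => σ₂.reg 23 < σ₂.reg 24 ∧ σ₂.reg 24 ≤ n ∧ F (σ₂.reg 23) = F 0 ∧
      F (σ₂.reg 24) ≠ F 0) (fun σ₂ => Nat.clog 2 (σ₂.reg 24 - σ₂.reg 23) * (n * 60 + 40))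
      (fun σ₂ => Nat.clog 2 (σ₂.reg 24 - σ₂.reg 23)) ?_ ?_ ?_).mono ?_ ?_ ?_
  · rw [h₁.1, h₁.2]; exact ⟨hn, le_rfl, rfl, hne.symm⟩
  · intros; simp
  · rintro σ₂ ⟨hlt, hle, hlo, hhi⟩ hA₂ hS₂ he
    have hp₂ := hp₁.agree hA₂ (by decide)
    have ht₂ := ht₁.agree hA₂ rfl rfl
    set lo := σ₂.reg 23 with hlo_def
    set hi := σ₂.reg 24 with hhi_def
    simp only [Expr.eval_sub, Expr.eval_num, Expr.eval_reg, ← hlo_def, ← hhi_def] at he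
    refine ⟨n * 60 + 30, 1, ?_⟩
    refine Runs.seq_le (P := fun σ₃ => σ₃.reg 19 = (lo + hi) / 2) (T₁ := 6) (M₁ := 0)
      (T₂ := n * 60 + 24) (M₂ := 1) (Runs.block' ?_ rfl (by decide)) (by omega) le_rfl
      fun σ₃ h₃ hA₃ hS₃ => ?_
    · simp [Prog.wp, ← hlo_def, ← hhi_def]; omega
    have hp₃ := hp₂.agree hA₃ (by decide)
    have ht₃ := ht₂.agree hA₃ rfl rfl
    have g6 : σ₃.arr 6 = σ.arr 6 := by rw [hA₃.arr 6 rfl, hA₂.arr 6 rfl, hA₁.arr 6 rfl]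
    have hask := runs_ask (f := f) hp₃ ht₃ hQ (q := q) (G := G)
      (by rw [hA₃.reg 17 rfl, hA₂.reg 17 rfl, hA₁.reg 17 rfl, h17])
      (by rw [hA₃.reg 18 rfl, hA₂.reg 18 rfl, hA₁.reg 18 rfl, h18]) h₃ hx hω hw
    rw [g6] at hask
    refine Runs.seq_le hask (T₂ := 14) (M₂ := 0) (by omega) le_rfl fun σ₄ h₄ hA₄ hS₄ => ?_
    have g19 : σ₄.reg 19 = (lo + hi) / 2 := (hA₄.reg 19 rfl).trans h₃
    have g20 : σ₄.reg 20 = (F 0).toNat := by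
      rw [hA₄.reg 20 rfl, hA₃.reg 20 rfl, hA₂.reg 20 rfl, hA₁.reg 20 rfl, h20]
    have g23 : σ₄.reg 23 = lo := by rw [hA₄.reg 23 rfl, hA₃.reg 23 rfl]
    have g24 : σ₄.reg 24 = hi := by rw [hA₄.reg 24 rfl, hA₃.reg 24 rfl]
    have h22 : σ₄.reg 22 = (F ((lo + hi) / 2)).toNat := h₄
    have hpot : ∀ g', g' ≤ (hi - lo + 1) / 2 →
        n * 60 + 30 + 5 + 1 + Nat.clog 2 g' * (n * 60 + 40) ≤
          Nat.clog 2 (hi - lo) * (n * 60 + 40) ∧ 1 + Nat.clog 2 g' ≤ Nat.clog 2 (hi - lo) := by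
      intro g' hg'
      have h1 := clog_half (show 2 ≤ hi - lo by omega) hg'
      have h2 := Nat.mul_le_mul_right (n * 60 + 40) h1
      rw [add_mul] at h2
      omega
    refine Runs.block' ?_ rfl (by decide)
    simp only [Prog.wp, Expr.ok_sub, Expr.ok_reg, Expr.eval_sub, Expr.eval_reg, true_and,
      State.reg_setReg, Expr.ok_add, Expr.eval_add, g19, g20, h22, hcost]
    simp +decide only [if_true, if_false, g23, g24]
    refine ⟨toNat_diff_lt hS₄.large _ _, fun h => ⟨⟨by omega, by omega, hlo, fun h' => ?_⟩,
      hpot _ (by omega)⟩, fun h => ⟨⟨by omega, hle, ?_, hhi⟩, hpot _ (by omega)⟩⟩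
    · exact h ((toNat_diff _ _).2 h'.symm)
    · exact ((toNat_diff _ _).1 h).symm
  · rw [h₁.1, h₁.2, hcost, Nat.sub_zero]
  · rw [h₁.1, h₁.2, Nat.sub_zero]
  · rintro σ₂ ⟨⟨hlt, hle, hlo, hhi⟩, he⟩
    simp only [Expr.eval_sub, Expr.eval_num, Expr.eval_reg] at he
    refine ⟨by omega, fun h => hhi ?_⟩
    rw [← hlo, show σ₂.reg 24 = σ₂.reg 23 + 1 by omega]
    exact h.symm

/-- The set `R` of the relevant variables found so far is stored in register `12` and in the arrays
`6` and `7`. -/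
structure Found (f : (Fin n → Bool) → Bool) (R : Finset (Fin n)) (σ : State) : Prop where
  card : σ.reg 12 = R.card
  rel : ∀ i ∈ R, Relevant f i
  mark : ∀ i : Fin n, σ.arr 6 i = if i ∈ R then 1 else 0
  list : ∀ r < R.card, ∃ i ∈ R, σ.arr 7 r = (i : Fin n)
  mem : ∀ i ∈ R, ∃ r < R.card, σ.arr 7 r = (i : Fin n)

/-- The samples before `q` have been treated. -/
def Treated (f : (Fin n → Bool) → Bool) (cls : ℕ → ℕ → ℕ) (R : Finset (Fin n)) (q : ℕ)
    (σ : State) : Prop :=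
  ∀ q' < q, σ.arr 5 q' = (f (sample n cls q')).toNat ∧ ∃ ρ : ℕ → ℕ,
    (∀ i : Fin n, ρ i ≠ 0 → i ∈ R) ∧ f (hybrid n cls q' ρ 0) = f (hybrid n cls q' ρ n)

/-- The alternative stands outside `Runs` so that each outcome has its own price: two queries finish
a sample, or a binary search is paid for one new relevant variable and the sample is tried again. -/
theorem runs_treatSample (hp : Params n s dd k Q σ) (ht : Tables n k Q σ) (hQ : 0 < Q)
    {G : ℕ → ℕ} (hG : σ.arr 4 = G) (hGlt : ∀ r < rounds k Q, G r < Q ^ k)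
    (hw : Q * (n + Q ^ k) < w) (hw₂ : 2 * n < w) {D : ℕ}
    (hD : ∀ R : Finset (Fin n), (∀ i ∈ R, Relevant f i) → R.card ≤ D) (hDw : D < w)
    {q : ℕ} (hq : σ.reg 16 = q) (hqM : q < Q * rounds k Q) {R : Finset (Fin n)}
    (hF : Found f R σ) (hT : Treated f (scl k Q G) R q σ) :
    Runs w f treatSample σ (n * 120 + 70) 2 (fun σ' => σ'.reg 16 = q + 1 ∧ Found f R σ' ∧
        Treated f (scl k Q G) R (q + 1) σ') ∨
    Runs w f treatSample σ (n * 120 + 70 + Nat.clog 2 n * (n * 60 + 40)) (2 + Nat.clog 2 n)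
      (fun σ' => σ'.reg 16 = q ∧ ∃ R', R'.card = R.card + 1 ∧ Found f R' σ' ∧
        Treated f (scl k Q G) R' q σ') := by
  classical
  set F : ℕ → Bool := fun mid => f (hybrid n (scl k Q G) q (σ.arr 6) mid) with hFdef
  have hrn : 0 < rounds k Q := by
    rcases Nat.eq_zero_or_pos (rounds k Q) with h | h
    · rw [h] at hqM; omega
    · exact h
  have hx : q / rounds k Q < Q := Nat.div_lt_of_lt_mul (by rwa [mul_comm])
  have hω := hGlt _ (Nat.mod_lt q hrn)
  -- the common prefix: ask for both extreme hybrids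
  have pre : ∀ {T M : ℕ} {Post : State → Prop},
      (∀ σ', σ'.reg 20 = (F 0).toNat → σ'.reg 22 = (F n).toNat → Params n s dd k Q σ' →
        Tables n k Q σ' → σ'.reg 17 = q / rounds k Q → σ'.reg 18 = G (q % rounds k Q) →
        σ'.reg 16 = q → σ'.reg 12 = σ.reg 12 → σ'.arr 5 = σ.arr 5 → σ'.arr 6 = σ.arr 6 →
        σ'.arr 7 = σ.arr 7 → Small w σ' →
        Runs w f (.cond (rg 20 - rg 22 + (rg 22 - rg 20))
          (search ⨟ .store 6 (rg 23) 1 ⨟ .store 7 (rg 12) (rg 23) ⨟ 12 ⇐ rg 12 + 1)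
          (.store 5 (rg 16) (rg 20) ⨟ 16 ⇐ rg 16 + 1)) σ' (30 + T) M Post) →
      Runs w f treatSample σ (n * 120 + 70 + T) (2 + M) Post := by
    intro T M Post hpost
    refine Runs.seq_le (P := fun σ₁ => σ₁.reg 17 = q / rounds k Q ∧
        σ₁.reg 18 = G (q % rounds k Q) ∧ σ₁.reg 19 = 0) (T₁ := 12) (M₁ := 0)
      (T₂ := n * 120 + 58 + T) (M₂ := 2 + M)
      (Runs.block' (by simp [Prog.wp, hq, hp.r10, hG]) rfl (by decide)) (by omega) (by omega)
      fun σ₁ h₁ hA₁ hS₁ => ?_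
    have hp₁ := hp.agree hA₁ (by decide)
    have ht₁ := ht.agree hA₁ rfl rfl
    have hask := runs_ask (f := f) hp₁ ht₁ hQ h₁.1 h₁.2.1 h₁.2.2 hx hω hw
    rw [hA₁.arr 6 rfl] at hask
    refine Runs.seq_le hask (T₂ := n * 60 + 48 + T) (M₂ := 1 + M) (by omega) (by omega)
      fun σ₂ h₂ hA₂ hS₂ => ?_
    have hp₂ := hp₁.agree hA₂ (by decide)
    have ht₂ := ht₁.agree hA₂ rfl rfl
    refine Runs.seq_le (P := fun σ₃ => σ₃.reg 20 = (F 0).toNat ∧ σ₃.reg 19 = n) (T₁ := 4)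
      (M₁ := 0) (T₂ := n * 60 + 44 + T) (M₂ := 1 + M)
      (Runs.block' (by simp [Prog.wp, hp₂.r0, h₂, hFdef]) rfl (by decide)) (by omega) (by omega)
      fun σ₃ h₃ hA₃ hS₃ => ?_
    have hp₃ := hp₂.agree hA₃ (by decide)
    have ht₃ := ht₂.agree hA₃ rfl rfl
    have g17 : σ₃.reg 17 = q / rounds k Q := by rw [hA₃.reg 17 rfl, hA₂.reg 17 rfl, h₁.1]
    have g18 : σ₃.reg 18 = G (q % rounds k Q) := by rw [hA₃.reg 18 rfl, hA₂.reg 18 rfl, h₁.2.1]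
    have hask₃ := runs_ask (f := f) hp₃ ht₃ hQ g17 g18 h₃.2 hx hω hw
    rw [hA₃.arr 6 rfl, hA₂.arr 6 rfl, hA₁.arr 6 rfl] at hask₃
    refine Runs.seq_le hask₃ (T₂ := 30 + T) (M₂ := M) (by omega) (by omega)
      fun σ₄ h₄ hA₄ hS₄ => ?_
    exact hpost σ₄ ((hA₄.reg 20 rfl).trans h₃.1) h₄ (hp₃.agree hA₄ (by decide))
      (ht₃.agree hA₄ rfl rfl) ((hA₄.reg 17 rfl).trans g17) ((hA₄.reg 18 rfl).trans g18)
      (by rw [hA₄.reg 16 rfl, hA₃.reg 16 rfl, hA₂.reg 16 rfl, hA₁.reg 16 rfl, hq])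
      (by rw [hA₄.reg 12 rfl, hA₃.reg 12 rfl, hA₂.reg 12 rfl, hA₁.reg 12 rfl])
      (by rw [hA₄.arr 5 rfl, hA₃.arr 5 rfl, hA₂.arr 5 rfl, hA₁.arr 5 rfl])
      (by rw [hA₄.arr 6 rfl, hA₃.arr 6 rfl, hA₂.arr 6 rfl, hA₁.arr 6 rfl])
      (by rw [hA₄.arr 7 rfl, hA₃.arr 7 rfl, hA₂.arr 7 rfl, hA₁.arr 7 rfl]) hS₄
  have hcost : (rg 20 - rg 22 + (rg 22 - rg 20)).cost = 7 := rfl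
  by_cases heq : F 0 = F n
  · left
    refine (pre (T := 0) (M := 0) ?_).mono le_rfl le_rfl fun _ h => h
    intro σ' h20 h22 hp' ht' h17 h18 h16 h12 h5 h6 h7 hS
    refine (Runs.cond (T := 20) (by simp [h20, h22, toNat_diff_lt hS.large])
      (fun he => ?_) fun he => ?_).mono (by omega) le_rfl fun _ h => h
    · simp only [Expr.eval_add, Expr.eval_sub, Expr.eval_reg, h20, h22] at he
      exact (he ((toNat_diff _ _).2 heq)).elim
    have hqw : q + 1 < w := by
      have := hS.reg 11; rw [hp'.r11] at this; omega
    refine Runs.block' ?_ rfl (by decide)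
    simp only [Prog.wp, Expr.ok_reg, Expr.eval_reg, Expr.ok_add, Expr.eval_add, Expr.ok_num,
      Expr.eval_num, h16, h20, State.reg_setArr, State.reg_setReg, true_and, if_true]
    refine ⟨⟨by norm_num, hqw⟩, ⟨by simp [h12, hF.card], hF.rel, ?_, ?_, ?_⟩, ?_⟩
    · intro i; simpa [h6] using hF.mark i
    · intro r hr; simpa [h7] using hF.list r hr
    · intro i hi; simpa [h7] using hF.mem i hi
    · intro q' hq'
      simp only [State.arr_setReg, State.arr_setArr, true_and, h5]
      rcases Nat.lt_succ_iff_lt_or_eq.1 hq' with h | rfl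
      · rw [if_neg (by omega)]; exact hT q' h
      · rw [if_pos rfl]
        -- The marks at this moment are recorded as `ρ`. Marks added later do no harm, since `ρ`
        -- only has to be supported in the final set.
        refine ⟨by rw [hFdef]; simp only [hybrid_zero], σ.arr 6, fun i hi => ?_, heq⟩
        rw [hF.mark i] at hi
        by_contra hR
        simp [hR] at hi
  · right
    refine (pre (T := Nat.clog 2 n * (n * 60 + 40)) (M := Nat.clog 2 n) ?_)
    intro σ' h20 h22 hp' ht' h17 h18 h16 h12 h5 h6 h7 hS
    refine (Runs.cond (T := 22 + Nat.clog 2 n * (n * 60 + 40))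
      (by simp [h20, h22, toNat_diff_lt hS.large])
      (fun he => ?_) fun he => ?_).mono (by omega) le_rfl fun _ h => h
    · have hsearch := runs_search (f := f) hp' ht' hQ h17 h18 hx hω hw hw₂
        (by rw [h20, h6]) (by rw [h6]; exact heq)
      rw [h6] at hsearch
      refine Runs.seq_le hsearch (T₂ := 12) (M₂ := 0) (by omega) le_rfl
        fun σ₁ h₁ hA₁ hS₁ => ?_
      obtain ⟨hl, hne⟩ := h₁
      set l := σ₁.reg 23 with hldef
      obtain ⟨hrel, hρ⟩ := relevant_of_hybrid_ne hl hne
      have hnot : (⟨l, hl⟩ : Fin n) ∉ R := by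
        intro h
        have := hF.mark ⟨l, hl⟩
        rw [if_pos h] at this
        simp only at this
        omega
      have hcard : (insert ⟨l, hl⟩ R).card = R.card + 1 := Finset.card_insert_of_notMem hnot
      have hrel' : ∀ i ∈ insert ⟨l, hl⟩ R, Relevant f i := by
        intro i hi
        rcases Finset.mem_insert.1 hi with rfl | hi
        · exact hrel
        · exact hF.rel i hi
      have hle := hD _ hrel'
      have g12 : σ₁.reg 12 = R.card := by rw [hA₁.reg 12 rfl, h12, hF.card]
      have g16 : σ₁.reg 16 = q := by rw [hA₁.reg 16 rfl, h16]
      have g5 : σ₁.arr 5 = σ.arr 5 := by rw [hA₁.arr 5 rfl, h5]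
      have g6 : σ₁.arr 6 = σ.arr 6 := by rw [hA₁.arr 6 rfl, h6]
      have g7 : σ₁.arr 7 = σ.arr 7 := by rw [hA₁.arr 7 rfl, h7]
      refine Runs.block' ?_ rfl (by decide)
      simp only [Prog.wp, Expr.ok_reg, Expr.eval_reg, Expr.ok_add, Expr.eval_add, Expr.ok_num,
        Expr.eval_num, g12, State.reg_setArr, State.reg_setReg, true_and, ← hldef]
      refine ⟨by norm_num, ⟨by norm_num, by omega⟩, by simp [g16],
        insert ⟨l, hl⟩ R, hcard, ⟨by simp [hcard], hrel', ?_, ?_, ?_⟩, ?_⟩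
      · intro i
        by_cases hi : i = ⟨l, hl⟩
        · subst hi; simp
        · have : (i : ℕ) ≠ l := fun h => hi (Fin.ext h)
          simpa [this, hi, g6] using hF.mark i
      · intro r hr
        by_cases hrr : r = R.card
        · exact ⟨⟨l, hl⟩, by simp, by simp [hrr]⟩
        · obtain ⟨i, hi, hi'⟩ := hF.list r (by omega)
          exact ⟨i, by simp [hi], by simp [hrr, g7, hi']⟩
      · intro i hi
        rcases Finset.mem_insert.1 hi with rfl | hi
        · exact ⟨R.card, by omega, by simp⟩
        · obtain ⟨r, hr, hi'⟩ := hF.mem i hi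
          exact ⟨r, by omega, by simp [hr.ne, g7, hi']⟩
      · intro q' hq'
        obtain ⟨h1, ρ, h2, h3⟩ := hT q' hq'
        exact ⟨by simp [g5, h1], ρ, fun i hi => by simp [h2 i hi], h3⟩
    · simp only [Expr.eval_add, Expr.eval_sub, Expr.eval_reg, h20, h22] at he
      exact (heq ((toNat_diff _ _).1 he)).elim

/-- Amortization: the potentials hold a fixed price for each untreated sample and the price of a
binary search for each of the at most `D` variables not yet found. -/
theorem runs_queryPhase (hp : Params n s dd k Q σ) (ht : Tables n k Q σ) (hQ : 0 < Q)
    {G : ℕ → ℕ} (hG : σ.arr 4 = G) (hGlt : ∀ r < rounds k Q, G r < Q ^ k)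
    (hw : Q * (n + Q ^ k) < w) (hw₂ : 2 * n < w) {D : ℕ}
    (hD : ∀ R : Finset (Fin n), (∀ i ∈ R, Relevant f i) → R.card ≤ D) (hDw : D < w)
    (hz : ∀ i, σ.arr 6 i = 0) :
    Runs w f queryPhase σ (Q * rounds k Q * (n * 120 + 80) +
        D * (n * 120 + 80 + Nat.clog 2 n * (n * 60 + 40)) + 10)
      (Q * rounds k Q * 2 + D * (2 + Nat.clog 2 n)) fun σ' =>
      ∃ R, Found f R σ' ∧ Treated f (scl k Q G) R (Q * rounds k Q) σ' := by
  set M := Q * rounds k Q with hM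
  refine Runs.seq_le (P := fun σ₁ => σ₁.reg 16 = 0 ∧ σ₁.reg 12 = 0) (T₁ := 4) (M₁ := 0)
    (T₂ := M * (n * 120 + 80) + D * (n * 120 + 80 + Nat.clog 2 n * (n * 60 + 40)) + 4)
    (M₂ := M * 2 + D * (2 + Nat.clog 2 n))
    (Runs.block' (by simp [Prog.wp]) rfl (by decide)) (by omega) (by omega)
    fun σ₁ h₁ hA₁ hS₁ => ?_
  have hp₁ := hp.agree hA₁ (by decide)
  have ht₁ := ht.agree hA₁ rfl rfl
  have hcost : (rg 11 - rg 16).cost = 3 := rfl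
  refine ((Runs.loop (fun σ₂ => σ₂.reg 16 ≤ M ∧ ∃ R, Found f R σ₂ ∧
      Treated f (scl k Q G) R (σ₂.reg 16) σ₂)
      (fun σ₂ => (M - σ₂.reg 16) * (n * 120 + 80) +
        (D - σ₂.reg 12) * (n * 120 + 80 + Nat.clog 2 n * (n * 60 + 40)))
      (fun σ₂ => (M - σ₂.reg 16) * 2 + (D - σ₂.reg 12) * (2 + Nat.clog 2 n)) ?_ ?_ ?_).post
      (Q' := fun σ' => ∃ R, Found f R σ' ∧ Treated f (scl k Q G) R M σ') ?_).mono
      ?_ ?_ fun _ h => h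
  · refine ⟨by omega, ∅, ⟨by simp [h₁.2], by simp, fun i => ?_, by simp, by simp⟩, ?_⟩
    · simp [hA₁.arr 6 rfl, hz]
    · rw [h₁.1]; intro q' hq'; omega
  · intros; simp
  · rintro σ₂ ⟨hle, R, hF, hT⟩ hA₂ hS₂ he
    have hp₂ := hp₁.agree hA₂ (by decide)
    have ht₂ := ht₁.agree hA₂ rfl rfl
    simp only [Expr.eval_sub, Expr.eval_reg, hp₂.r11, ← hM] at he
    have hRD := hD R hF.rel
    rcases runs_treatSample hp₂ ht₂ hQ (by rw [hA₂.arr 4 rfl, hA₁.arr 4 rfl, hG]) hGlt hw hw₂ hD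
      hDw rfl (show σ₂.reg 16 < Q * rounds k Q by omega) hF hT with h | h
    · refine ⟨_, _, h.mono le_rfl le_rfl ?_⟩
      rintro σ₃ ⟨h16, hF', hT'⟩
      refine ⟨⟨by omega, R, hF', h16 ▸ hT'⟩, ?_, ?_⟩
      · rw [h16, hF.card, hF'.card, hcost]
        obtain ⟨l, hl⟩ : ∃ l, M = σ₂.reg 16 + 1 + l := ⟨M - (σ₂.reg 16 + 1), by omega⟩
        rw [show M - σ₂.reg 16 = l + 1 by omega, show M - (σ₂.reg 16 + 1) = l by omega, add_mul]
        omega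
      · rw [h16, hF.card, hF'.card]
        omega
    · refine ⟨_, _, h.mono le_rfl le_rfl ?_⟩
      rintro σ₃ ⟨h16, R', hcard, hF', hT'⟩
      have hRD' := hD R' hF'.rel
      refine ⟨⟨by omega, R', hF', h16 ▸ hT'⟩, ?_, ?_⟩
      · rw [h16, hF.card, hF'.card, hcost, hcard]
        obtain ⟨l, hl⟩ : ∃ l, D = R.card + 1 + l := ⟨D - (R.card + 1), by omega⟩
        rw [show D - R.card = l + 1 by omega, show D - (R.card + 1) = l by omega, add_mul]
        omega
      · rw [h16, hF.card, hF'.card, hcard]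
        obtain ⟨l, hl⟩ : ∃ l, D = R.card + 1 + l := ⟨D - (R.card + 1), by omega⟩
        rw [show D - R.card = l + 1 by omega, show D - (R.card + 1) = l by omega, add_mul]
        omega
  · rintro σ₂ ⟨⟨hle, R, hF, hT⟩, he⟩ hA₂ -
    have hp₂ := hp₁.agree hA₂ (by decide)
    simp only [Expr.eval_sub, Expr.eval_reg, hp₂.r11, ← hM] at he
    rw [show σ₂.reg 16 = M by omega] at hT
    exact ⟨R, hF, hT⟩
  · rw [h₁.1, h₁.2, hcost]; simp
  · rw [h₁.1, h₁.2]; simp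

end

end DTLearn

namespace DTLearn

variable {n w : ℕ} {f : (Fin n → Bool) → Bool}

/-! ### The dynamic program -/

/-- Number of literals and number of nodes of the heap. -/
def setHeap : Prog :=
  (13 ⇐ 2 * rg 12 ⨟ 14 ⇐ 0 ⨟ 22 ⇐ rg 3 + 1) ⨟ .forLt 16 22 (14 ⇐ rg 13 * rg 14 + 1)

/-- Register `20` becomes nonzero if sample `19` satisfies all literals of node `16`. -/
def testNode : Prog :=
  (20 ⇐ 1 ⨟ 21 ⇐ rg 16) ⨟ .loop (rg 21) (
    22 ⇐ (rg 21 - 1) % rg 13 ⨟ 21 ⇐ (rg 21 - 1) / rg 13 ⨟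
    23 ⇐ ld 2 (ld 1 (ld 1 (rg 19 / rg 10 * rg 7 + ld 7 (rg 22 / 2)) * rg 7 +
      ld 4 (rg 19 % rg 10))) % 2 ⨟
    .cond (rg 23 - rg 22 % 2 + (rg 22 % 2 - rg 23)) (20 ⇐ 0) .skip)

/-- Registers `17` and `18` become nonzero if the answer `0` and the answer `1`, respectively,
occurs at node `16`. -/
def scanNode : Prog :=
  (17 ⇐ 0 ⨟ 18 ⇐ 0) ⨟ .forLt 19 11 (testNode ⨟
    .cond (rg 20) (.cond (ld 5 (rg 19)) (18 ⇐ 1) (17 ⇐ 1)) .skip)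

/-- The best variable at node `16`. -/
def bestVar : Prog :=
  .forLt 25 12 (
    26 ⇐ ld 9 (rg 13 * rg 16 + 1 + 2 * rg 25) + ld 9 (rg 13 * rg 16 + 1 + (2 * rg 25 + 1)) ⨟
    .cond (rg 23 - rg 26) (23 ⇐ rg 26 ⨟ 24 ⇐ rg 25 + 2) .skip)

/-- Compute the entries of the dynamic program at node `16`. -/
def solveNode : Prog :=
  scanNode ⨟ .cond (rg 17 * rg 18)
    ((23 ⇐ rg 2 + 1 ⨟ 24 ⇐ 0) ⨟
      .cond (rg 14 - (rg 13 * rg 16 + rg 13)) bestVar .skip ⨟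
      .store 9 (rg 16) (rg 23) ⨟ .store 10 (rg 16) (rg 24))
    (.store 9 (rg 16) 1 ⨟ .store 10 (rg 16) (rg 18))

/-- The dynamic program, from the last node to the root. -/
def solveAll : Prog :=
  .forLt 15 14 (16 ⇐ rg 14 - 1 - rg 15 ⨟ solveNode)

/-- The memory contents on which the dynamic program works. -/
structure DPCtx (n s dd k Q N : ℕ) (G ans RL : ℕ → ℕ) (σ : State) : Prop where
  params : Params n s dd k Q σ
  tables : Tables n k Q σ
  a4 : σ.arr 4 = G
  a5 : σ.arr 5 = ans
  a7 : σ.arr 7 = RL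
  r12 : σ.reg 12 = N
  r13 : σ.reg 13 = 2 * N
  r14 : σ.reg 14 = heapOff (2 * N) (dd + 1)

section

variable {σ : State} {s dd k Q N : ℕ} {G ans RL : ℕ → ℕ}

theorem DPCtx.agree {p : Prog} {σ' : State} (h : DPCtx n s dd k Q N G ans RL σ)
    (hA : Agree p σ σ') (hp : ∀ x < 15, p.wrReg x = false) (ha : ∀ x < 8, p.wrArr x = false) :
    DPCtx n s dd k Q N G ans RL σ' where
  params := h.params.agree hA fun x hx => hp x (by omega)
  tables := h.tables.agree hA (ha _ (by norm_num)) (ha _ (by norm_num))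
  a4 := by rw [hA.arr _ (ha _ (by norm_num)), h.a4]
  a5 := by rw [hA.arr _ (ha _ (by norm_num)), h.a5]
  a7 := by rw [hA.arr _ (ha _ (by norm_num)), h.a7]
  r12 := by rw [hA.reg _ (hp _ (by norm_num)), h.r12]
  r13 := by rw [hA.reg _ (hp _ (by norm_num)), h.r13]
  r14 := by rw [hA.reg _ (hp _ (by norm_num)), h.r14]

theorem runs_setHeap (hp : Params n s dd k Q σ) (ht : Tables n k Q σ) (h4 : σ.arr 4 = G)
    (h5 : σ.arr 5 = ans) (h7 : σ.arr 7 = RL) (h12 : σ.reg 12 = N) (hNw : 2 * N < w)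
    (hw : heapOff (2 * N) (dd + 1) < w) (hdw : dd + 1 < w) :
    Runs w f setHeap σ (dd * 20 + 50) 0 fun σ' => DPCtx n s dd k Q N G ans RL σ' := by
  refine Runs.seq_le (P := fun σ₁ => σ₁.reg 13 = 2 * N ∧ σ₁.reg 14 = 0 ∧ σ₁.reg 22 = dd + 1)
    (T₁ := 12) (M₁ := 0) (T₂ := dd * 20 + 38) (M₂ := 0) (Runs.block' ?_ rfl (by decide)) (by omega)
    le_rfl fun σ₁ h₁ hA₁ hS₁ => ?_
  · simp [Prog.wp, h12, hp.r3, hNw, hdw]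
  refine ((Runs.forLt (T := 6) (M := 0) (fun j σ₂ => σ₂.reg 14 = heapOff (2 * N) j) (dd + 1)
    rfl rfl h₁.2.2 (by simp [h₁, heapOff]) ?_).post
    (Q' := fun σ' => DPCtx n s dd k Q N G ans RL σ') ?_).mono (by omega) (by simp) fun _ h => h
  · intro j σ₂ hj hI hj' hA₂ hS₂
    have h13 : σ₂.reg 13 = 2 * N := by rw [hA₂.reg 13 rfl, h₁.1]
    have := heapOff_mono (2 * N) hj
    simp only [heapOff] at this
    refine Runs.block' ?_ rfl (by decide)
    simp [Prog.wp, h13, hI, heapOff]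
    simp only [heapOff] at hw
    omega
  · rintro σ₂ ⟨hI, -⟩ hA₂ -
    refine ⟨(hp.agree hA₁ (by decide)).agree hA₂ (by decide),
      (ht.agree hA₁ rfl rfl).agree hA₂ rfl rfl, ?_, ?_, ?_, ?_, ?_, hI⟩
    · rw [hA₂.arr 4 rfl, hA₁.arr 4 rfl, h4]
    · rw [hA₂.arr 5 rfl, hA₁.arr 5 rfl, h5]
    · rw [hA₂.arr 7 rfl, hA₁.arr 7 rfl, h7]
    · rw [hA₂.reg 12 rfl, hA₁.reg 12 rfl, h12]
    · rw [hA₂.reg 13 rfl, h₁.1]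

/-- The loop climbs from the node to the root and checks one literal per edge, with the node index
as potential. `t = 0 ∨ 0 < N` rules out division by 0 on the way. -/
theorem runs_testNode (hc : DPCtx n s dd k Q N G ans RL σ) (hQ : 0 < Q)
    (hGlt : ∀ r < rounds k Q, G r < Q ^ k) (hRL : ∀ r < N, RL r < n)
    (hw : Q * (n + Q ^ k) < w) {q t : ℕ} (hq : σ.reg 19 = q) (hqM : q < Q * rounds k Q)
    (ht : σ.reg 16 = t) (htN : t = 0 ∨ 0 < N) :
    Runs w f testNode σ (t * 60 + 10) 0 fun σ' =>
      (σ'.reg 20 ≠ 0 ↔ HeapAll (SatLit (scl k Q G) RL q) (2 * N) t) := by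
  set p := SatLit (scl k Q G) RL q with hpdef
  have hrn : 0 < rounds k Q := by
    rcases Nat.eq_zero_or_pos (rounds k Q) with h | h
    · rw [h] at hqM; omega
    · exact h
  have hx : q / rounds k Q < Q := Nat.div_lt_of_lt_mul (by rwa [mul_comm])
  have hω := hGlt _ (Nat.mod_lt q hrn)
  refine Runs.seq_le (P := fun σ₁ => σ₁.reg 20 = 1 ∧ σ₁.reg 21 = t)
    (T₁ := 4) (M₁ := 0) (T₂ := t * 60 + 2) (M₂ := 0)
    (Runs.block' (by simp [Prog.wp, ht]) rfl (by decide)) (by omega)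
    le_rfl fun σ₁ h₁ hA₁ hS₁ => ?_
  have hc₁ := hc.agree hA₁ (by decide) (by decide)
  have hcost : (rg 21).cost = 1 := rfl
  refine (Runs.loop (fun σ₂ => ((σ₂.reg 20 ≠ 0 ∧ HeapAll p (2 * N) (σ₂.reg 21)) ↔
      HeapAll p (2 * N) t) ∧ (σ₂.reg 21 = 0 ∨ 0 < N)) (fun σ₂ => σ₂.reg 21 * 60)
      (fun _ => 0) ?_ ?_ ?_).mono ?_ le_rfl ?_
  · simp [h₁, htN]
  · intros; simp
  · rintro σ₂ ⟨hI, hN⟩ hA₂ hS₂ he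
    have hc₂ := hc₁.agree hA₂ (by decide) (by decide)
    have hq₂ : σ₂.reg 19 = q := by rw [hA₂.reg 19 rfl, hA₁.reg 19 rfl, hq]
    simp only [Expr.eval_reg] at he
    obtain ⟨u, hu⟩ : ∃ u, σ₂.reg 21 = u + 1 := ⟨σ₂.reg 21 - 1, by omega⟩
    have hN0 : 0 < N := by omega
    have hlit : u % (2 * N) < 2 * N := Nat.mod_lt _ (by omega)
    have hdiv : u / (2 * N) ≤ u := Nat.div_le_self _ _
    obtain ⟨v₁, v₂, v₃⟩ := hc₂.tables.vcl hQ hx hω (hRL (u % (2 * N) / 2) (by omega))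
    rw [hu, heapAll_succ] at hI
    have hpl : p (u % (2 * N)) ↔ vcl k Q (q / rounds k Q) (G (q % rounds k Q))
      (RL (u % (2 * N) / 2)) % 2 = u % (2 * N) % 2 := Iff.rfl
    set c := vcl k Q (q / rounds k Q) (G (q % rounds k Q)) (RL (u % (2 * N) / 2)) with hcdef
    have hlarge := hS₂.large
    refine ⟨57, 0, Runs.block' ?_ rfl (by decide)⟩
    simp only [Prog.wp, Expr.ok_mul, Expr.ok_reg, Expr.eval_mul, Expr.eval_reg, Expr.ok_load,
        Expr.eval_load, Expr.ok_mod, Expr.eval_mod, Expr.ok_add, Expr.eval_add, Expr.ok_sub,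
        Expr.eval_sub, Expr.ok_num, Expr.eval_num, Expr.ok_div, Expr.eval_div, State.reg_setReg,
        State.arr_setReg, true_and, and_true, hcost]
    simp +decide only [if_true, if_false, hc₂.r13, hc₂.params.r7, hc₂.params.r10, hc₂.a4, hc₂.a7,
      hu, Nat.add_sub_cancel, hq₂, v₃, true_and, and_true, ne_eq]
    refine ⟨⟨by omega, by omega⟩, by omega, fun h => ⟨⟨?_, Or.inr hN0⟩, by omega⟩,
      fun h => ⟨⟨?_, Or.inr hN0⟩, by omega⟩⟩
    · rw [← hI, hpl]
      constructor
      · rintro ⟨h', -⟩; exact h'.elim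
      · rintro ⟨-, h', -⟩; omega
    · rw [← hI, hpl]
      constructor
      · rintro ⟨h₁, h₂⟩; exact ⟨h₁, by omega, h₂⟩
      · rintro ⟨h₁, -, h₂⟩; exact ⟨h₁, h₂⟩
  · rw [h₁.2, hcost]
  · rintro σ₂ ⟨⟨hI, -⟩, he⟩
    simp only [Expr.eval_reg] at he
    rw [← hI, he]
    simp [heapAll_zero]

/-- Both flags are set exactly if no constant fits the samples at the node. -/
theorem runs_scanNode (hc : DPCtx n s dd k Q N G ans RL σ) (hQ : 0 < Q)
    (hGlt : ∀ r < rounds k Q, G r < Q ^ k) (hRL : ∀ r < N, RL r < n)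
    (hw : Q * (n + Q ^ k) < w) {t : ℕ} (ht : σ.reg 16 = t) (htN : t = 0 ∨ 0 < N) :
    Runs w f scanNode σ (Q * rounds k Q * (t * 60 + 30) + 10) 0 fun σ' =>
      σ'.reg 17 ≤ 1 ∧ σ'.reg 18 ≤ 1 ∧
      (σ'.reg 17 ≠ 0 ↔ ∃ q < Q * rounds k Q,
        HeapAll (SatLit (scl k Q G) RL q) (2 * N) t ∧ ans q = 0) ∧
      (σ'.reg 18 ≠ 0 ↔ ∃ q < Q * rounds k Q,
        HeapAll (SatLit (scl k Q G) RL q) (2 * N) t ∧ ans q ≠ 0) := by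
  set M := Q * rounds k Q with hM
  refine Runs.seq_le (P := fun σ₁ => σ₁.reg 17 = 0 ∧ σ₁.reg 18 = 0)
    (T₁ := 4) (M₁ := 0) (T₂ := M * (t * 60 + 30) + 6) (M₂ := 0)
    (Runs.block' (by simp [Prog.wp]) rfl (by decide)) (by omega)
    le_rfl fun σ₁ h₁ hA₁ hS₁ => ?_
  have hc₁ := hc.agree hA₁ (by decide) (by decide)
  refine (Runs.forLt (T := t * 60 + 22) (M := 0) (fun j σ₂ => σ₂.reg 17 ≤ 1 ∧ σ₂.reg 18 ≤ 1 ∧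
      (σ₂.reg 17 ≠ 0 ↔ ∃ q < j,
        HeapAll (SatLit (scl k Q G) RL q) (2 * N) t ∧ ans q = 0) ∧
      (σ₂.reg 18 ≠ 0 ↔ ∃ q < j,
        HeapAll (SatLit (scl k Q G) RL q) (2 * N) t ∧ ans q ≠ 0)) M rfl rfl hc₁.params.r11
      (by simp [h₁]) ?_).mono (by simp [add_assoc]) (by simp) fun _ h => h.1
  rintro q σ₂ hq ⟨hI₁, hI₂, hI₃, hI₄⟩ hq' hA₂ hS₂
  have hc₂ := hc₁.agree hA₂ (by decide) (by decide)
  have ht₂ : σ₂.reg 16 = t := by rw [hA₂.reg 16 rfl, hA₁.reg 16 rfl, ht]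
  refine Runs.seq_le (runs_testNode hc₂ hQ hGlt hRL hw hq' hq ht₂ htN) (T₂ := 12) (M₂ := 0)
    (by omega) le_rfl fun σ₃ h₃ hA₃ hS₃ => ?_
  have hc₃ := hc₂.agree hA₃ (by decide) (by decide)
  have g17 : σ₃.reg 17 = σ₂.reg 17 := hA₃.reg 17 rfl
  have g18 : σ₃.reg 18 = σ₂.reg 18 := hA₃.reg 18 rfl
  have g19 : σ₃.reg 19 = q := (hA₃.reg 19 rfl).trans hq'
  have hex : ∀ A : ℕ → Prop, (∃ q' < q + 1, A q') ↔ (∃ q' < q, A q') ∨ A q := by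
    intro A
    constructor
    · rintro ⟨q', h, hA⟩
      rcases Nat.lt_succ_iff_lt_or_eq.1 h with h | rfl
      · exact Or.inl ⟨q', h, hA⟩
      · exact Or.inr hA
    · rintro (⟨q', h, hA⟩ | hA)
      · exact ⟨q', by omega, hA⟩
      · exact ⟨q, by omega, hA⟩
  refine Runs.block' ?_ rfl (by decide)
  simp only [Prog.wp, Expr.ok_reg, Expr.eval_reg, Expr.ok_load, Expr.eval_load, Expr.ok_num,
    Expr.eval_num, State.reg_setReg, true_and, h₃, g19, hc₃.a5, hex]
  simp +decide only [if_true, if_false, g17, g18, ← hI₃, ← hI₄, true_and, le_refl, hI₁, hI₂]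
  refine ⟨fun h => ⟨fun h' => ⟨?_, ?_⟩, fun h' => ⟨?_, ?_⟩⟩, fun h => ?_⟩
  · simp [h']
  · simp [h, h']
  · simp [h, h']
  · simp [h']
  · have : ¬ HeapAll (SatLit (scl k Q G) RL q) (2 * N) t := fun h' => (h₃.2 h') h
    simp [this]

/-- The minimum starts at the cap `s + 1`, so a variable is chosen only if it gives size at most
`s`. Entries are capped too, hence sums stay within `2 * s + 2`. -/
theorem runs_bestVar (hc : DPCtx n s dd k Q N G ans RL σ) {t : ℕ} (ht : σ.reg 16 = t)
    (hin : 2 * N * t + 2 * N < heapOff (2 * N) (dd + 1)) (hsw : 2 * s + 2 < w)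
    (hb : ∀ u > t, u < heapOff (2 * N) (dd + 1) → σ.arr 9 u ≤ s + 1) (h23 : σ.reg 23 = s + 1) :
    Runs w f bestVar σ (N * 60 + 6) 0 fun σ' =>
      (σ'.reg 23 = s + 1 ∨ ∃ r < N, σ'.reg 24 = r + 2 ∧ σ'.reg 23 ≤ s ∧
        σ'.reg 23 = σ.arr 9 (2 * N * t + 1 + 2 * r) + σ.arr 9 (2 * N * t + 1 + (2 * r + 1))) ∧
      ∀ r < N, σ'.reg 23 ≤
        σ.arr 9 (2 * N * t + 1 + 2 * r) + σ.arr 9 (2 * N * t + 1 + (2 * r + 1)) := by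
  refine (Runs.forLt (T := 52) (M := 0) (fun j σ₁ =>
      (σ₁.reg 23 = s + 1 ∨ ∃ r < N, σ₁.reg 24 = r + 2 ∧ σ₁.reg 23 ≤ s ∧
        σ₁.reg 23 = σ.arr 9 (2 * N * t + 1 + 2 * r) + σ.arr 9 (2 * N * t + 1 + (2 * r + 1))) ∧
      ∀ r < j, σ₁.reg 23 ≤
        σ.arr 9 (2 * N * t + 1 + 2 * r) + σ.arr 9 (2 * N * t + 1 + (2 * r + 1))) N rfl rfl hc.r12
      ⟨Or.inl (by simp [h23]), fun r hr => by omega⟩ ?_).mono le_rfl (by simp) fun _ h => h.1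
  rintro r σ₁ hr ⟨hI₁, hI₂⟩ hr' hA₁ hS₁
  have hc₁ := hc.agree hA₁ (by decide) (by decide)
  have ht₁ : σ₁.reg 16 = t := by rw [hA₁.reg 16 rfl, ht]
  have htot : heapOff (2 * N) (dd + 1) < w := by rw [← hc₁.r14]; exact hS₁.reg 14
  have hmul : t ≤ 2 * N * t := Nat.le_mul_of_pos_left _ (by omega)
  have hb₀ := hb (2 * N * t + 1 + 2 * r) (by omega) (by omega)
  have hb₁ := hb (2 * N * t + 1 + (2 * r + 1)) (by omega) (by omega)
  have g9 : σ₁.arr 9 = σ.arr 9 := hA₁.arr 9 rfl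
  set V := σ.arr 9 (2 * N * t + 1 + 2 * r) + σ.arr 9 (2 * N * t + 1 + (2 * r + 1)) with hV
  have h23 : σ₁.reg 23 ≤ s + 1 := by
    rcases hI₁ with h | ⟨r, _, _, h, _⟩ <;> omega
  refine Runs.block' ?_ rfl (by decide)
  simp only [Prog.wp, Expr.ok_mul, Expr.ok_reg, Expr.eval_mul, Expr.eval_reg, Expr.ok_load,
        Expr.eval_load, Expr.ok_add, Expr.eval_add, Expr.ok_sub,
        Expr.eval_sub, Expr.ok_num, Expr.eval_num, State.reg_setReg, true_and, and_true]
  simp +decide only [if_true, if_false, hc₁.r13, ht₁, hr', g9, ← hV, true_and]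
  refine ⟨⟨⟨⟨by omega, by omega⟩, by omega, by omega⟩,
    ⟨⟨by omega, by omega⟩, ⟨by omega, by omega⟩, by omega⟩, by omega⟩,
    fun h => ⟨by omega, ⟨Or.inr ⟨r, hr, rfl, by omega, rfl⟩, fun r' hr'' => ?_⟩⟩,
    fun h => ⟨hI₁, fun r' hr'' => ?_⟩⟩
  · rcases Nat.lt_succ_iff_lt_or_eq.1 hr'' with h' | rfl
    · have := hI₂ r' h'; omega
    · exact le_rfl
  · rcases Nat.lt_succ_iff_lt_or_eq.1 hr'' with h' | rfl
    · exact hI₂ r' h'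
    · omega

/-- The equation at `t` reads only `t` and its children, which have larger indices, so entries
written later at smaller indices do not disturb it. -/
theorem DPEq.congr {cls : ℕ → ℕ → ℕ} {best choice best' choice' : ℕ → ℕ} {M tot t : ℕ}
    (h : DPEq cls RL ans best choice M N s tot t) (hb : ∀ u, t ≤ u → best' u = best u)
    (hch : choice' t = choice t) : DPEq cls RL ans best' choice' M N s tot t := by
  have hch' : ∀ r < N, ∀ l, best' (2 * N * t + 1 + l) = best (2 * N * t + 1 + l) := by
    intro r hr l
    have hmul : t ≤ 2 * N * t := Nat.le_mul_of_pos_left _ (by omega)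
    exact hb _ (by omega)
  rcases h with ⟨b, h₁, h₂, h₃⟩ | ⟨h₁, h₂, h₃⟩
  · exact Or.inl ⟨b, by rw [hch, h₁], by rw [hb t le_rfl, h₂], h₃⟩
  · refine Or.inr ⟨h₁, ?_, fun hin r hr => ?_⟩
    · rcases h₂ with h₂ | ⟨r, hr, h₄, h₅, h₆, h₇⟩
      · exact Or.inl (by rw [hb t le_rfl, h₂])
      · exact Or.inr ⟨r, hr, h₄, by rw [hch, h₅], by rw [hb t le_rfl]; exact h₆,
          by rw [hb t le_rfl, hch' r hr, hch' r hr, h₇]⟩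
    · rw [hb t le_rfl, hch' r hr, hch' r hr]; exact h₃ hin r hr

theorem runs_solveNode (hc : DPCtx n s dd k Q N G ans RL σ) (hQ : 0 < Q)
    (hGlt : ∀ r < rounds k Q, G r < Q ^ k) (hRL : ∀ r < N, RL r < n)
    (hans : ∀ q < Q * rounds k Q, ans q ≤ 1)
    (hw : Q * (n + Q ^ k) < w) (hsw : 2 * s + 2 < w)
    (hwt : 2 * N * heapOff (2 * N) (dd + 1) + 2 * N < w) {t : ℕ} (ht : σ.reg 16 = t)
    (htot : t < heapOff (2 * N) (dd + 1))
    (hb : ∀ u > t, u < heapOff (2 * N) (dd + 1) → σ.arr 9 u ≤ s + 1) :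
    Runs w f solveNode σ (Q * rounds k Q * (t * 60 + 30) + N * 60 + 60) 0 fun σ' =>
      σ'.arr 9 t ≤ s + 1 ∧ (∀ u ≠ t, σ'.arr 9 u = σ.arr 9 u ∧ σ'.arr 10 u = σ.arr 10 u) ∧
      DPEq (scl k Q G) RL ans (σ'.arr 9) (σ'.arr 10) (Q * rounds k Q) N s
        (heapOff (2 * N) (dd + 1)) t := by
  set M := Q * rounds k Q with hM
  set tot := heapOff (2 * N) (dd + 1) with htotdef
  -- Without variables the heap consists of the root only.
  have htN : t = 0 ∨ 0 < N := by
    rcases Nat.eq_zero_or_pos N with rfl | h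
    · left
      simp [htotdef, heapOff] at htot
      exact htot
    · exact Or.inr h
  refine Runs.seq_le (runs_scanNode hc hQ hGlt hRL hw ht htN) (T₂ := N * 60 + 50) (M₂ := 0)
    (by rw [← hM]; omega) le_rfl fun σ₁ h₁ hA₁ hS₁ => ?_
  obtain ⟨b17, b18, e17, e18⟩ := h₁
  have hc₁ := hc.agree hA₁ (by decide) (by decide)
  have ht₁ : σ₁.reg 16 = t := by rw [hA₁.reg 16 rfl, ht]
  have g9 : σ₁.arr 9 = σ.arr 9 := hA₁.arr 9 rfl
  have g10 : σ₁.arr 10 = σ.arr 10 := hA₁.arr 10 rfl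
  have hlarge := hS₁.large
  have hprod : σ₁.reg 17 * σ₁.reg 18 ≤ 1 := Nat.mul_le_mul b17 b18
  have hcost : (rg 17 * rg 18).cost = 3 := rfl
  refine (Runs.cond (T := N * 60 + 44) (by simp; omega) (fun he => ?_) fun he => ?_).mono (by omega)
    le_rfl fun _ h => h
  · simp only [Expr.eval_mul, Expr.eval_reg, ne_eq, mul_eq_zero, not_or] at he
    obtain ⟨q₀, hq₀, hm₀, ha₀⟩ := e17.1 he.1
    obtain ⟨q₁, hq₁, hm₁, ha₁⟩ := e18.1 he.2
    have hno : ¬ ∃ b : Bool, ∀ q < M, HeapAll (SatLit (scl k Q G) RL q) (2 * N) t →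
        ans q = b.toNat := by
      rintro ⟨b, hb⟩
      rw [hb q₀ hq₀ hm₀] at ha₀
      rw [hb q₁ hq₁ hm₁] at ha₁
      exact ha₁ ha₀
    refine Runs.seq_le (P := fun σ₂ => σ₂.reg 23 = s + 1 ∧ σ₂.reg 24 = 0) (T₁ := 6) (M₁ := 0)
      (T₂ := N * 60 + 36) (M₂ := 0) (Runs.block' ?_ rfl (by decide)) (by omega)
      le_rfl fun σ₂ h₂ hA₂ hS₂ => ?_
    · simp [Prog.wp, hc₁.params.r2]; omega
    have hc₂ := hc₁.agree hA₂ (by decide) (by decide)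
    have ht₂ : σ₂.reg 16 = t := by rw [hA₂.reg 16 rfl, ht₁]
    have k9 : σ₂.arr 9 = σ.arr 9 := by rw [hA₂.arr 9 rfl, g9]
    have k10 : σ₂.arr 10 = σ.arr 10 := by rw [hA₂.arr 10 rfl, g10]
    have hmul : 2 * N * t ≤ 2 * N * tot := Nat.mul_le_mul_left _ htot.le
    refine Runs.seq_le (P := fun σ₃ =>
        (σ₃.reg 23 = s + 1 ∨ ∃ r < N, 2 * N * t + 2 * N < tot ∧ σ₃.reg 24 = r + 2 ∧
          σ₃.reg 23 ≤ s ∧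
          σ₃.reg 23 = σ.arr 9 (2 * N * t + 1 + 2 * r) + σ.arr 9 (2 * N * t + 1 + (2 * r + 1))) ∧
        (2 * N * t + 2 * N < tot → ∀ r < N, σ₃.reg 23 ≤
          σ.arr 9 (2 * N * t + 1 + 2 * r) + σ.arr 9 (2 * N * t + 1 + (2 * r + 1))))
      (T₁ := N * 60 + 20) (M₁ := 0) (T₂ := 8) (M₂ := 0) ?_ (by omega) le_rfl
      fun σ₃ h₃ hA₃ hS₃ => ?_
    · have hcost₂ : (rg 14 - (rg 13 * rg 16 + rg 13)).cost = 7 := rfl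
      refine (Runs.cond (T := N * 60 + 6) ?_ (fun he => ?_) fun he => ?_).mono (by omega)
        le_rfl fun _ h => h
      · simp [hc₂.r13, ht₂]; omega
      · simp only [Expr.eval_sub, Expr.eval_reg, Expr.eval_add, Expr.eval_mul, hc₂.r13, hc₂.r14,
          ht₂, ← htotdef] at he
        have hin : 2 * N * t + 2 * N < tot := by omega
        have := runs_bestVar (f := f) hc₂ ht₂ hin hsw (by rw [k9]; exact hb) h₂.1
        rw [k9] at this
        refine this.mono le_rfl le_rfl ?_
        rintro σ₃ ⟨h | ⟨r, hr, ha, hb, hc⟩, h'⟩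
        · exact ⟨Or.inl h, fun _ => h'⟩
        · exact ⟨Or.inr ⟨r, hr, hin, ha, hb, hc⟩, fun _ => h'⟩
      · simp only [Expr.eval_sub, Expr.eval_reg, Expr.eval_add, Expr.eval_mul, hc₂.r13, hc₂.r14,
          ht₂, ← htotdef] at he
        exact Runs.block' (by
          simp only [Prog.wp]
          exact ⟨Or.inl h₂.1, fun h => by omega⟩) rfl (by simp [Prog.time])
    · obtain ⟨h₃, h₃'⟩ := h₃
      have ht₃ : σ₃.reg 16 = t := by
        rw [hA₃.reg 16 rfl, ht₂]
      have m9 : σ₃.arr 9 = σ.arr 9 := by rw [hA₃.arr 9 rfl, k9]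
      have m10 : σ₃.arr 10 = σ.arr 10 := by rw [hA₃.arr 10 rfl, k10]
      have hne : ∀ r < N, ∀ l, 2 * N * t + 1 + l ≠ t := by
        intro r hr l
        have hmul : t ≤ 2 * N * t := Nat.le_mul_of_pos_left _ (by omega)
        omega
      have a9 : ∀ v u : ℕ, ((σ₃.setArr 9 t v).setArr 10 t (σ₃.reg 24)).arr 9 u =
          if u = t then v else σ.arr 9 u := by intro v u; simp [m9]
      have a10 : ∀ v u : ℕ, ((σ₃.setArr 9 t v).setArr 10 t (σ₃.reg 24)).arr 10 u =
          if u = t then σ₃.reg 24 else σ.arr 10 u := by intro v u; simp [m10]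
      refine Runs.block' ?_ rfl (by decide)
      simp only [Prog.wp, Expr.ok_reg, Expr.eval_reg, true_and, State.reg_setArr, ht₃]
      refine ⟨?_, fun u hu => ⟨?_, ?_⟩, Or.inr ⟨hno, ?_, fun hin r hr => ?_⟩⟩
      · rw [a9, if_pos rfl]
        rcases h₃ with h | ⟨r, _, _, _, h, _⟩ <;> omega
      · rw [a9, if_neg hu]
      · rw [a10, if_neg hu]
      · simp only [a9, a10, if_true]
        rcases h₃ with h | ⟨r, hr, h₄, h₅, h₆, h₇⟩
        · exact Or.inl h
        · refine Or.inr ⟨r, hr, h₄, h₅, h₆, ?_⟩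
          rw [if_neg (hne r hr _), if_neg (hne r hr _)]; exact h₇
      · rw [a9, a9, a9, if_pos rfl, if_neg (hne r hr _), if_neg (hne r hr _)]
        exact h₃' hin r hr
  · simp only [Expr.eval_mul, Expr.eval_reg, mul_eq_zero] at he
    refine Runs.block' ?_ rfl (by have : 0 ≤ N := by omega
                                  simp only [Prog.time, Expr.cost]
                                  exact le_trans (by decide) (Nat.le_add_left 44 _))
    simp only [Prog.wp, Expr.ok_reg, Expr.eval_reg, Expr.ok_num, Expr.eval_num, true_and,
      State.reg_setArr, ht₁]
    -- Flag `18` is itself a valid label: it is set exactly if the answer 1 occurs, and 0 also fits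
    -- a node without samples.
    refine ⟨by norm_num, ?_, fun u hu => ⟨?_, ?_⟩, Or.inl ⟨decide (σ₁.reg 18 ≠ 0), ?_, ?_, ?_⟩⟩
    · simp
    · simp [hu, g9]
    · simp [hu, g10]
    · rcases Nat.eq_zero_or_pos (σ₁.reg 18) with h | h
      · simp [h]
      · have : σ₁.reg 18 = 1 := by omega
        simp [this]
    · simp
    · intro q hq hm
      have hq1 := hans q hq
      by_cases h18 : σ₁.reg 18 = 0
      · simp only [h18, ne_eq, not_true_eq_false, decide_false, Bool.toNat_false]
        by_contra hne
        exact (e18.2 ⟨q, hq, hm, hne⟩) h18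
      · simp only [h18, ne_eq, not_false_eq_true, decide_true, Bool.toNat_true]
        by_contra hne
        rcases he with h | h
        · exact (e17.2 ⟨q, hq, hm, by omega⟩) h
        · exact h18 h

/-- Children have larger indices than their parent, so the decreasing order finds them solved. -/
theorem runs_solveAll (hc : DPCtx n s dd k Q N G ans RL σ) (hQ : 0 < Q)
    (hGlt : ∀ r < rounds k Q, G r < Q ^ k) (hRL : ∀ r < N, RL r < n)
    (hans : ∀ q < Q * rounds k Q, ans q ≤ 1)
    (hw : Q * (n + Q ^ k) < w) (hsw : 2 * s + 2 < w)
    (hwt : 2 * N * heapOff (2 * N) (dd + 1) + 2 * N < w) :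
    Runs w f solveAll σ (heapOff (2 * N) (dd + 1) *
        (Q * rounds k Q * (heapOff (2 * N) (dd + 1) * 60 + 30) + N * 60 + 80) + 6) 0 fun σ' =>
      ∀ t < heapOff (2 * N) (dd + 1), DPEq (scl k Q G) RL ans (σ'.arr 9) (σ'.arr 10)
        (Q * rounds k Q) N s (heapOff (2 * N) (dd + 1)) t := by
  set M := Q * rounds k Q with hM
  set tot := heapOff (2 * N) (dd + 1) with htot
  refine (Runs.forLt (T := M * (tot * 60 + 30) + N * 60 + 72) (M := 0) (fun j σ₁ =>
    ∀ t, tot - j ≤ t → t < tot → σ₁.arr 9 t ≤ s + 1 ∧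
      DPEq (scl k Q G) RL ans (σ₁.arr 9) (σ₁.arr 10) M N s tot t) tot rfl rfl hc.r14
    (fun t h₁ h₂ => by omega) ?_).mono (by simp [add_assoc]) (by simp)
    fun σ' h t ht => (h.1 t (by omega) ht).2
  intro j σ₁ hj hI hj' hA₁ hS₁
  have hc₁ := hc.agree hA₁ (by decide) (by decide)
  refine Runs.seq_le (P := fun σ₂ => σ₂.reg 16 = tot - 1 - j) (T₁ := 6) (M₁ := 0)
      (T₂ := M * (tot * 60 + 30) + N * 60 + 66) (M₂ := 0)
      (Runs.block' (by simp [Prog.wp, hc₁.r14, hj', ← htot]) rfl (by decide)) (by omega)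
      le_rfl fun σ₂ h₂ hA₂ hS₂ => ?_
  have hc₂ := hc₁.agree hA₂ (by decide) (by decide)
  have g9 : σ₂.arr 9 = σ₁.arr 9 := hA₂.arr 9 rfl
  have g10 : σ₂.arr 10 = σ₁.arr 10 := hA₂.arr 10 rfl
  refine (runs_solveNode hc₂ hQ hGlt hRL hans hw hsw hwt h₂ (by omega)
    (by rw [g9]; exact fun u hu hu' => (hI u (by omega) hu').1)).mono ?_ le_rfl ?_
  · have : M * ((tot - 1 - j) * 60 + 30) ≤ M * (tot * 60 + 30) :=
      Nat.mul_le_mul_left _ (by omega)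
    rw [← hM]
    omega
  · rintro σ₃ ⟨h₃, h₄, h₅⟩ t ht ht'
    simp only [State.arr_setReg]
    by_cases hte : t = tot - 1 - j
    · subst hte; exact ⟨h₃, h₅⟩
    · obtain ⟨i₁, i₂⟩ := hI t (by omega) ht'
      refine ⟨by rw [(h₄ t hte).1, g9]; exact i₁, i₂.congr (fun u hu => ?_) ?_⟩
      · rw [(h₄ u (by omega)).1, g9]
      · rw [(h₄ t hte).2, g10]

end

end DTLearn

namespace DTLearn

variable {n w : ℕ} {f : (Fin n → Bool) → Bool}

/-! ### Writing the output -/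

/-- Write the preorder code of the tree stored in the dynamic program. -/
def writeTree : Prog :=
  (16 ⇐ 1 ⨟ 17 ⇐ 0) ⨟ .loop (rg 16) (
    16 ⇐ rg 16 - 1 ⨟ 18 ⇐ ld 11 (rg 16) ⨟ 19 ⇐ ld 10 (rg 18) ⨟
    .cond (rg 19 - 1)
      (.store 0 (rg 17) (ld 7 (rg 19 - 2) + 2) ⨟
        .store 11 (rg 16) (rg 13 * rg 18 + 1 + (2 * (rg 19 - 2) + 1)) ⨟
        .store 11 (rg 16 + 1) (rg 13 * rg 18 + 1 + 2 * (rg 19 - 2)) ⨟ 16 ⇐ rg 16 + 2)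
      (.store 0 (rg 17) (rg 19)) ⨟
    17 ⇐ rg 17 + 1)

theorem DTree.size_pos (T : DTree n) : 0 < T.size :=
  (Nat.zero_le _).trans_lt T.depth_lt_size

theorem DTree.length_code : ∀ T : DTree n, T.code.length + 1 = 2 * T.size
  | .leaf _ => rfl
  | .node i l r => by
    have := l.length_code
    have := r.length_code
    simp only [code, size, List.length_cons, List.length_append]
    omega

/-- Array `a` holds a stack of heap indices at which the given trees can be read. -/
def StackOf (RL choice : ℕ → ℕ) (N tot : ℕ) (a : ℕ → ℕ) : List (DTree n) → Prop
  | [] => True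
  | T :: L => Reads RL choice N tot (a L.length) T ∧ StackOf RL choice N tot a L

theorem StackOf.congr {RL choice a a' : ℕ → ℕ} {N tot : ℕ} :
    ∀ {L : List (DTree n)}, StackOf RL choice N tot a L → (∀ j < L.length, a' j = a j) →
      StackOf RL choice N tot a' L
  | [], _, _ => trivial
  | T :: L, h, ha => by
    refine ⟨?_, h.2.congr fun j hj => ha j (by simp; omega)⟩
    rw [ha _ (by simp)]
    exact h.1

theorem length_le_length_flatMap_code (L : List (DTree n)) :
    L.length ≤ (L.flatMap DTree.code).length := by
  induction L with
  | nil => simp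
  | cons T L ih =>
    have := T.length_code
    have : 0 < T.size := T.size_pos
    simp only [List.flatMap_cons, List.length_cons, List.length_append]
    omega

/-- Depth-first traversal with an explicit stack: the words written, followed by the codes of the
stacked trees, always form the code of `T`. The right child is pushed below the left one. Each round
writes one word, so the number of missing words is the potential. -/
theorem runs_writeTree {σ : State} {s dd k Q N : ℕ} {G ans RL : ℕ → ℕ}
    (hc : DPCtx n s dd k Q N G ans RL σ) (hsw : 2 * s + 2 < w) (hnw : n + 2 < w)
    (hz : ∀ i, σ.arr 11 i = 0) {T : DTree n} (hT : T.size ≤ s)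
    (hR : Reads RL (σ.arr 10) N (heapOff (2 * N) (dd + 1)) 0 T) :
    Runs w f writeTree σ (T.size * 160) 0 fun σ' => Outputs σ' T := by
  set tot := heapOff (2 * N) (dd + 1) with htot
  have hlen := T.length_code
  have hpos := T.size_pos
  refine Runs.seq_le (P := fun σ₁ => σ₁.reg 16 = 1 ∧ σ₁.reg 17 = 0)
    (T₁ := 4) (M₁ := 0) (T₂ := T.size * 160 - 4) (M₂ := 0)
    (Runs.block' (by simp [Prog.wp]) rfl (by decide)) (by omega)
    le_rfl fun σ₁ h₁ hA₁ hS₁ => ?_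
  have hc₁ := hc.agree hA₁ (by decide) (by decide)
  have c10 : σ₁.arr 10 = σ.arr 10 := hA₁.arr 10 rfl
  have hcost : (rg 16).cost = 1 := rfl
  refine (Runs.loop (fun σ₂ => ∃ (L : List (DTree n)) (pre : List ℕ),
      StackOf RL (σ.arr 10) N tot (σ₂.arr 11) L ∧ σ₂.reg 16 = L.length ∧
      σ₂.reg 17 = pre.length ∧ (∀ j (hj : j < pre.length), σ₂.arr 0 j = pre[j]) ∧
      pre ++ L.flatMap DTree.code = T.code) (fun σ₂ => (T.code.length - σ₂.reg 17) * 70)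
      (fun _ => 0) ?_ ?_ ?_).mono ?_ le_rfl ?_
  · refine ⟨[T], [], ⟨?_, trivial⟩, by simp [h₁], by simp [h₁], by simp, by simp⟩
    rw [hA₁.arr 11 rfl, hz]
    exact hR
  · intros; simp
  · rintro σ₂ ⟨L, pre, hL, h16, h17, hpre, hcode⟩ hA₂ hS₂ he
    simp only [Expr.eval_reg, h16] at he
    obtain _ | ⟨U, L⟩ := L
    · simp at he
    have r13 : σ₂.reg 13 = 2 * N := by rw [hA₂.reg 13 rfl, hc₁.r13]
    have a7 : σ₂.arr 7 = RL := by rw [hA₂.arr 7 rfl, hc₁.a7]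
    have a10 : σ₂.arr 10 = σ.arr 10 := by rw [hA₂.arr 10 rfl, c10]
    have r14 : σ₂.reg 14 = tot := by rw [hA₂.reg 14 rfl, hc₁.r14]
    have htw : tot < w := by rw [← r14]; exact hS₂.reg 14
    have hlL := length_le_length_flatMap_code L
    have hcl := congrArg List.length hcode
    simp only [List.flatMap_cons, List.length_append] at hcl
    have hU := U.length_code
    have hUpos := U.size_pos
    simp only [List.length_cons] at h16
    obtain ⟨hU', hL⟩ := hL
    refine ⟨66, 0, Runs.block' ?_ rfl (by decide)⟩
    simp only [Prog.wp, Expr.ok_mul, Expr.ok_reg, Expr.eval_mul, Expr.eval_reg, Expr.ok_load,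
        Expr.eval_load, Expr.ok_add, Expr.eval_add, Expr.ok_sub,
        Expr.eval_sub, Expr.ok_num, Expr.eval_num, State.reg_setReg, State.arr_setReg,
        State.reg_setArr, true_and, hcost]
    simp +decide only [if_true, if_false, r13, a7, a10, h16, h17, Nat.add_sub_cancel, true_and,
      and_true]
    set t := σ₂.arr 11 L.length with ht
    cases U with
    | leaf b =>
      have hb : σ.arr 10 t = b.toNat := hU'
      have hb' := Bool.toNat_le b
      simp only [DTree.code, List.length_singleton] at hcl
      refine ⟨fun h => by omega, fun _ => ⟨by omega, ?_, by omega⟩⟩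
      refine ⟨L, pre ++ [b.toNat], hL.congr fun j hj => by simp, by simp, by simp, ?_, ?_⟩
      · intro j hj
        simp only [List.length_append, List.length_singleton] at hj
        rcases Nat.lt_succ_iff_lt_or_eq.1 hj with h | rfl
        · rw [List.getElem_append_left h]
          simp only [State.arr_setReg, State.arr_setArr, true_and]
          rw [if_neg (by omega)]
          exact hpre j h
        · simp [hb]
      · rw [← hcode]; simp [DTree.code]
    | node i l r =>
      obtain ⟨ρ, hρ, hin, hch, hRL, hl, hr⟩ := hU'
      have hRL' : RL ρ < n := by rw [hRL]; exact i.2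
      have hl1 := l.length_code
      have hr1 := r.length_code
      have hlp := l.size_pos
      have hrp := r.size_pos
      simp only [DTree.code, List.length_cons, List.length_append] at hcl
      rw [hch]
      simp only [Nat.add_sub_cancel]
      refine ⟨fun _ => ?_, fun h => by omega⟩
      refine ⟨by omega, by omega, by omega, by omega, by omega, by omega, ?_, by omega⟩
      refine ⟨l :: r :: L, pre ++ [(i : ℕ) + 2], ⟨?_, ?_, hL.congr fun j hj => ?_⟩, by simp,
        by simp, ?_, ?_⟩
      · simpa using hl
      · simpa using hr
      · simp only [State.arr_setReg, State.arr_setArr, true_and]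
        rw [if_neg (by omega), if_neg (by omega), if_neg (by omega)]
      · intro j hj
        simp only [List.length_append, List.length_singleton] at hj
        rcases Nat.lt_succ_iff_lt_or_eq.1 hj with h | rfl
        · rw [List.getElem_append_left h]
          simp only [State.arr_setReg, State.arr_setArr, true_and]
          rw [if_neg (by omega), if_neg (by omega), if_neg (by omega)]
          exact hpre j h
        · simp [hRL]
      · rw [← hcode]; simp [DTree.code]
  · rw [h₁.2, hcost]; omega
  · rintro σ₂ ⟨⟨L, pre, hL, h16, h17, hpre, hcode⟩, he⟩
    simp only [Expr.eval_reg, h16, List.length_eq_zero_iff] at he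
    subst he
    simp only [List.flatMap_nil, List.append_nil] at hcode
    subst hcode
    exact hpre

end DTLearn

namespace DTLearn

variable {n w : ℕ}

/-! ### The learning algorithm -/

/-- Compute a tree from the answers to the queries. -/
def solve : Prog := setHeap ⨟ solveAll ⨟ writeTree

/-- The learning algorithm, once the prime has been found. -/
def learnPrime : Prog := setParams ⨟ buildTables ⨟ greedy ⨟ queryPhase ⨟ solve

/-- The learning algorithm. -/
def learn : Prog := setDepth ⨟ findPrime ⨟ learnPrime

/-- Nodes of depth at most `l` are words over `B` letters, padded to length `l` by one extra letter.
-/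
theorem heapOff_succ_le (B l : ℕ) : heapOff B (l + 1) ≤ (B + 1) ^ l := by
  induction l with
  | zero => simp [heapOff]
  | succ l ih =>
    rw [heapOff, pow_succ]
    have := Nat.mul_le_mul_left B ih
    have := Nat.one_le_pow l (B + 1) (by omega)
    nlinarith

theorem rounds_mono {k Q P : ℕ} (h : Q ≤ P) : rounds k Q ≤ rounds k P := by
  unfold rounds
  have := Nat.le_length_digits_le 2 (2 * Q) (2 * P) (by omega)
  gcongr

theorem runs_solve {T₀ : DTree n} {σ : State} {s dd k Q N : ℕ} {G : ℕ → ℕ} {R : Finset (Fin n)}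
    (hk : k = 2 * dd + 1) (hp : Params n s dd k Q σ) (ht : Tables n k Q σ) (h4 : σ.arr 4 = G)
    (hF : Found T₀.eval R σ)
    (hT : Treated T₀.eval (scl k Q G) R (Q * rounds k Q) σ)
    (hG : Greedy k Q (rounds k Q) G) (hQ : GoodPrime n k Q)
    (hdepth : T₀.depth ≤ dd) (hsize : T₀.size ≤ s) (hN : R.card ≤ N)
    (hw : Q * (n + Q ^ k) < w) (hnw : n + 2 < w) (hsw : 2 * s + 2 < w)
    (hdw : dd + 1 < w) (hwt : 2 * N * (2 * N + 1) ^ dd + 2 * N < w) (hz : ∀ i, σ.arr 11 i = 0) :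
    Runs w T₀.eval solve σ (dd * 20 + 60 + (2 * N + 1) ^ dd *
        (Q * rounds k Q * ((2 * N + 1) ^ dd * 60 + 30) + N * 60 + 80) + 2 ^ dd * 160) 0
      fun σ' => ∃ T : DTree n, Outputs σ' T ∧ T.depth ≤ dd ∧ T.size ≤ s ∧ T.eval = T₀.eval := by
  set H := (2 * N + 1) ^ dd with hH
  have hH0 : heapOff (2 * R.card) (dd + 1) ≤ H :=
    (heapOff_succ_le _ _).trans (Nat.pow_le_pow_left (by omega) _)
  have hHN : 2 * R.card * heapOff (2 * R.card) (dd + 1) ≤ 2 * N * H :=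
    Nat.mul_le_mul (by omega) hH0
  have hH1 : 0 < H := by positivity
  have hHw : heapOff (2 * R.card) (dd + 1) < w := by
    rcases Nat.eq_zero_or_pos R.card with h | h
    · simp only [h, mul_zero, heapOff, zero_mul]; omega
    · have : heapOff (2 * R.card) (dd + 1) ≤ 2 * R.card * heapOff (2 * R.card) (dd + 1) :=
        Nat.le_mul_of_pos_left _ (by omega)
      omega
  have hRL : ∀ r < R.card, σ.arr 7 r < n := fun r hr => by
    obtain ⟨i, -, h⟩ := hF.list r hr
    rw [h]; exact i.2
  have hans : ∀ q < Q * rounds k Q, σ.arr 5 q ≤ 1 := fun q hq => by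
    rw [(hT q hq).1]; exact Bool.toNat_le _
  have hS : Sampling n (2 * dd + 1) (Q * rounds k Q) (scl k Q G) := hk ▸ hG.sampling hQ (by omega)
  clear_value H
  -- For an unmarked relevant variable some sample would separate its extreme hybrids under every
  -- marking that leaves the variable free, contrary to the equality recorded when that sample was
  -- treated.
  have hrel : ∀ i, Relevant T₀.eval i → ∃ r < R.card, σ.arr 7 r = i := by
    intro i hi
    apply hF.mem
    by_contra hiR
    obtain ⟨q, hq, h⟩ := hS.marked hdepth hi
    obtain ⟨ρ, h₁, h₂⟩ := (hT q hq).2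
    exact h ρ (by_contra fun h' => hiR (h₁ i h')) h₂
  refine Runs.seq_le (runs_setHeap hp ht h4 rfl rfl hF.card (by omega) hHw hdw)
    (T₂ := 10 + H * (Q * rounds k Q * (H * 60 + 30) + N * 60 + 80) + 2 ^ dd * 160) (M₂ := 0) (by omega) le_rfl
    fun σ₁ hc₁ hA₁ hS₁ => ?_
  have hsolve : heapOff (2 * R.card) (dd + 1) *
      (Q * rounds k Q * (heapOff (2 * R.card) (dd + 1) * 60 + 30) + R.card * 60 + 80) ≤
      H * (Q * rounds k Q * (H * 60 + 30) + N * 60 + 80) := by gcongr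
  refine Runs.seq_le (runs_solveAll hc₁ hQ.prime.pos (fun r hr => (hG r hr).1) hRL hans hw hsw
    (by omega)) (T₂ := 2 ^ dd * 160) (M₂ := 0) (by linarith) le_rfl
    fun σ₂ h₂ hA₂ hS₂ => ?_
  have hc₂ := hc₁.agree hA₂ (by decide) (by decide)
  obtain ⟨T, hTd, hTs, hTe, hTr⟩ := DPEq.exists_reads hS hdepth hsize hRL hrel
    (fun q hq => (hT q hq).1) h₂
  have h2 : T.size ≤ 2 ^ dd := T.size_le_two_pow.trans (Nat.pow_le_pow_right (by omega) hTd)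
  refine (runs_writeTree hc₂ hsw hnw (fun i => ?_) hTs hTr).mono (by omega) le_rfl
    fun σ' h => ⟨T, h, hTd, hTs, hTe⟩
  rw [hA₂.arr 11 rfl, hA₁.arr 11 rfl, hz]

/-- Bound for the running time of `learnPrime` and `findPrime`. -/
def learnTime (n k dd P N : ℕ) : ℕ :=
  P * (P * 20 + n * 10 + 60) + 40 + (36 * k + 20 * P + 80) +
  (P * ((n + P ^ k) * 30 + 14) + P * 30 + 12) +
  (rounds k P * (P ^ k * ((2 * P) ^ k * (k * 60 + 40) + 40) + (2 * P) ^ k * (k * 60 + 40) + 40) +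
    6) +
  (P * rounds k P * (n * 120 + 80) + N * (n * 120 + 80 + Nat.clog 2 n * (n * 60 + 40)) + 10) +
  (dd * 20 + 60 + (2 * N + 1) ^ dd *
    (P * rounds k P * ((2 * N + 1) ^ dd * 60 + 30) + N * 60 + 80) + 2 ^ dd * 160)

/-- The program works with the prime `Q` it has found; costs and word bounds are monotone and
therefore stated for the upper bound `P`, as they are for `N` instead of the number of variables
found. -/
theorem runs_learnPrime {T₀ : DTree n} {σ : State} {s dd k Q P N : ℕ} (hk : k = 2 * dd + 1)
    (h0 : σ.reg 0 = n) (h2 : σ.reg 2 = s) (h3 : σ.reg 3 = dd) (h4 : σ.reg 4 = k)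
    (h5 : σ.reg 5 = Q) (hQ : GoodPrime n k Q) (hQP : Q ≤ P)
    (hdepth : T₀.depth ≤ dd) (hsize : T₀.size ≤ s) (hN : T₀.vars.card ≤ N)
    (hw₁ : (2 * P) ^ k < w) (hw₂ : P * rounds k P < w) (hw₃ : P * (n + P ^ k) < w)
    (hw₄ : P * P + P < w) (hw₅ : P * (4 * k) < w) (hw₆ : 2 * n < w) (hnw : n + 2 < w)
    (hsw : 2 * s + 2 < w) (hdw : dd + 1 < w) (hwt : 2 * N * (2 * N + 1) ^ dd + 2 * N < w)
    (hz : ∀ a i, σ.arr a i = 0) :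
    Runs w T₀.eval learnPrime σ
      ((36 * k + 20 * P + 80) + ((P * ((n + P ^ k) * 30 + 14) + P * 30 + 12) +
      ((rounds k P * (P ^ k * ((2 * P) ^ k * (k * 60 + 40) + 40) + (2 * P) ^ k * (k * 60 + 40) +
        40) + 6) +
      ((P * rounds k P * (n * 120 + 80) +
        N * (n * 120 + 80 + Nat.clog 2 n * (n * 60 + 40)) + 10) +
      (dd * 20 + 60 + (2 * N + 1) ^ dd *
        (P * rounds k P * ((2 * N + 1) ^ dd * 60 + 30) + N * 60 + 80) + 2 ^ dd * 160)))))
      (P * rounds k P * 2 + N * (2 + Nat.clog 2 n))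
      fun σ' => ∃ T : DTree n, Outputs σ' T ∧ T.depth ≤ dd ∧ T.size ≤ s ∧ T.eval = T₀.eval := by
  have hr := rounds_mono (k := k) hQP
  have hk0 : 0 < k := by omega
  have hQ0 := hQ.prime.pos
  have hQw : Q * (n + Q ^ k) < w := lt_of_le_of_lt (by gcongr) hw₃
  have hD : ∀ R : Finset (Fin n), (∀ i ∈ R, Relevant T₀.eval i) → R.card ≤ N := fun R hR =>
    (Finset.card_le_card fun i hi => (hR i hi).mem_vars).trans hN
  have hNw : N < w := by omega
  refine Runs.seq_le ((runs_setParams h0 h2 h3 h4 h5 hQ0 hk0 (lt_of_le_of_lt (by gcongr) hw₁)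
    (lt_of_le_of_lt (by gcongr) hw₂) (lt_of_le_of_lt (Nat.le_mul_of_pos_left _ hQ0) hQw)).mono
    (T' := 36 * k + 20 * P + 80) (by gcongr) le_rfl fun _ h => h) le_rfl (zero_add _).le
    fun σ₁ hp₁ hA₁ hS₁ => ?_
  refine Runs.seq_le ((runs_buildTables hp₁ hQ.prime.one_lt (fun i => by rw [hA₁.arr 1 rfl, hz]) hQw
    (lt_of_le_of_lt (by gcongr) hw₄) (lt_of_le_of_lt (by gcongr) hw₅)).mono
    (T' := P * ((n + P ^ k) * 30 + 14) + P * 30 + 12) (by gcongr) le_rfl fun _ h => h) le_rfl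
    (zero_add _).le fun σ₂ ht₂ hA₂ hS₂ => ?_
  have hp₂ := hp₁.agree hA₂ (by decide)
  refine Runs.seq_le ((runs_greedy hp₂ ht₂ hQ0 (fun i => by rw [hA₂.arr 3 rfl, hA₁.arr 3 rfl, hz])
    hQw).mono (T' := rounds k P * (P ^ k * ((2 * P) ^ k * (k * 60 + 40) + 40) +
    (2 * P) ^ k * (k * 60 + 40) + 40) + 6) (by gcongr) le_rfl fun _ h => h) le_rfl
    (zero_add _).le fun σ₃ hG hA₃ hS₃ => ?_
  have hp₃ := hp₂.agree hA₃ (by decide)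
  have ht₃ := ht₂.agree hA₃ rfl rfl
  refine Runs.seq_le ((runs_queryPhase hp₃ ht₃ hQ0 rfl (fun r hr => (hG r hr).1) hQw hw₆ hD hNw
    (fun i => by rw [hA₃.arr 6 rfl, hA₂.arr 6 rfl, hA₁.arr 6 rfl, hz])).mono
    (T' := P * rounds k P * (n * 120 + 80) +
      N * (n * 120 + 80 + Nat.clog 2 n * (n * 60 + 40)) + 10)
    (M' := P * rounds k P * 2 + N * (2 + Nat.clog 2 n)) (by gcongr) (by gcongr) fun _ h => h) le_rfl
    (add_zero _).le fun σ₄ h₄ hA₄ hS₄ => ?_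
  obtain ⟨R, hF, hT⟩ := h₄
  refine (runs_solve hk (hp₃.agree hA₄ (by decide)) (ht₃.agree hA₄ rfl rfl) (hA₄.arr 4 rfl) hF hT hG hQ
    hdepth hsize (hD R hF.rel) hQw hnw hsw hdw hwt fun i => ?_).mono (by gcongr) le_rfl fun _ h => h
  rw [hA₄.arr 11 rfl, hA₃.arr 11 rfl, hA₂.arr 11 rfl, hA₁.arr 11 rfl, hz]

theorem runs_learn {T₀ : DTree n} {d s dd k P N : ℕ} (hdd : dd = min d (s - 1))
    (hk : k = 2 * dd + 1) (hP : GoodPrime n k P) (hdepth : T₀.depth ≤ d) (hsize : T₀.size ≤ s)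
    (hN : T₀.vars.card ≤ N)
    (hw₁ : (2 * P) ^ k < w) (hw₂ : P * rounds k P < w) (hw₃ : P * (n + P ^ k) < w)
    (hw₄ : P * P + P < w) (hw₅ : P * (4 * k) < w) (hw₆ : 2 * n < w) (hnw : n + 2 < w)
    (hsw : 2 * s + 2 < w) (hdw : 2 * d + 1 < w) (hwt : 2 * N * (2 * N + 1) ^ dd + 2 * N < w)
    (hkw : k * k * n < w) :
    Runs w T₀.eval learn (init n d s) (learnTime n k dd P N)
      (P * rounds k P * 2 + N * (2 + Nat.clog 2 n))
      fun σ' => ∃ T : DTree n, Outputs σ' T ∧ T.depth ≤ dd ∧ T.size ≤ s ∧ T.eval = T₀.eval := by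
  have hd' : T₀.depth ≤ dd := by have := T₀.depth_lt_size; omega
  have hk0 : 0 < k := by omega
  have hPP := hP.prime.pos
  have hle : P ≤ P * P := Nat.le_mul_of_pos_left _ hPP
  refine Runs.seq_le (runs_setDepth (d := d) (s := s) rfl rfl hdw)
    (T₂ := learnTime n k dd P N - 20) (M₂ := P * rounds k P * 2 + N * (2 + Nat.clog 2 n))
    (by unfold learnTime; omega) (by omega) fun σ₁ h₁ hA₁ hS₁ => ?_
  rw [← hdd, ← hk] at h₁
  refine Runs.seq_le (runs_findPrime (hA₁.reg 0 rfl) h₁.2 hk0 hP (by omega) hkw)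
    ?_ (zero_add _).le fun σ₂ h₂ hA₂ hS₂ => runs_learnPrime hk ?_ ?_ ?_ ?_ rfl h₂.1 h₂.2 hd' hsize
      hN hw₁ hw₂ hw₃ hw₄ hw₅ hw₆ hnw hsw ?_ hwt ?_
  · unfold learnTime; omega
  · rw [hA₂.reg 0 rfl, hA₁.reg 0 rfl]; rfl
  · rw [hA₂.reg 2 rfl, hA₁.reg 2 rfl]; rfl
  · rw [hA₂.reg 3 rfl, h₁.1]
  · rw [hA₂.reg 4 rfl, h₁.2]
  · rcases Nat.eq_zero_or_pos d with h | h
    · have := hS₁.large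
      omega
    · omega
  · intro a i
    rw [hA₂.arr a rfl, hA₁.arr a rfl]; rfl

end DTLearn

namespace DTLearn

/-! ### Bounds -/

theorem length_digits_anti_left {b c m : ℕ} (hb : 1 < b) (hbc : b ≤ c) (hm : m ≠ 0) :
    (Nat.digits c m).length ≤ (Nat.digits b m).length := by
  rw [Nat.length_digits _ _ (by omega) hm, Nat.length_digits _ _ hb hm]
  have := Nat.log_anti_left (n := m) hb hbc
  omega

/-- There is a good prime of size `O (k ^ 3 * log n)`, with the binary length of the prime
included. -/
theorem exists_goodPrime {n k : ℕ} (hn : n ≠ 0) (hk : 0 < k) :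
    ∃ P, GoodPrime n k P ∧
      P * (Nat.digits 2 (2 * P)).length ≤ 128 * k ^ 3 * (Nat.log 2 n + 1) := by
  classical
  have hk1 : 1 ≤ k * k := Nat.mul_pos hk hk
  have hex : ∃ p, 8 * k * k ≤ p ∧ k * k * (Nat.digits p n).length < p := by
    refine ⟨8 * k * k * (Nat.log 2 n + 1), Nat.le_mul_of_pos_right _ (by omega), ?_⟩
    have h8 : 2 ≤ 8 * k * k * (Nat.log 2 n + 1) := by
      have : 8 * (k * k) * 1 ≤ 8 * (k * k) * (Nat.log 2 n + 1) := Nat.mul_le_mul_left _ (by omega)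
      rw [← mul_assoc] at this
      nlinarith
    have := length_digits_anti_left one_lt_two h8 hn
    rw [Nat.length_digits _ _ one_lt_two hn] at this
    calc _ ≤ k * k * (Nat.log 2 n + 1) := Nat.mul_le_mul_left _ this
      _ < 8 * k * k * (Nat.log 2 n + 1) := by
        rw [mul_assoc 8, mul_assoc 8]
        have : 0 < k * k * (Nat.log 2 n + 1) := by positivity
        omega
  -- The least admissible `q` is followed by a prime up to `2 * q` (Bertrand), which stays
  -- admissible because a larger base does not lengthen the expansion of `n`.
  obtain ⟨q, ⟨hq₁, hq₂⟩, hmin⟩ : ∃ q, (8 * k * k ≤ q ∧ k * k * (Nat.digits q n).length < q) ∧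
      ∀ p < q, ¬ (8 * k * k ≤ p ∧ k * k * (Nat.digits p n).length < p) :=
    ⟨Nat.find hex, Nat.find_spec hex, fun p hp => Nat.find_min hex hp⟩
  rw [mul_assoc] at hq₁
  obtain ⟨P, hP, hqP, hPq⟩ := Nat.exists_prime_lt_and_le_two_mul q (by omega)
  refine ⟨P, ⟨hP, by rw [mul_assoc]; omega, ?_⟩, ?_⟩
  · have := Nat.mul_le_mul_left (k * k) (length_digits_anti_left (by omega) hqP.le hn)
    omega
  have hL : 1 ≤ Nat.log 2 n + 1 := by omega
  have hk3 : k * k * k = k ^ 3 := by ring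
  -- At the lower limit the prime is of order `k ^ 2` and its binary length of order `k`.
  by_cases hq : q ≤ 8 * (k * k)
  · have hkk : k * k * 4 ≤ 2 ^ (2 * k) := by
      have : k + 1 ≤ 2 ^ k := Nat.lt_two_pow_self
      obtain ⟨j, rfl⟩ : ∃ j, k = j + 1 := ⟨k - 1, by omega⟩
      have hj : j + 1 ≤ 2 ^ j := Nat.lt_two_pow_self
      calc (j + 1) * (j + 1) * 4 ≤ 2 ^ j * 2 ^ j * 4 := by gcongr
        _ = 2 ^ (2 * (j + 1)) := by ring
    have hlen : (Nat.digits 2 (2 * P)).length ≤ 2 * k + 4 := by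
      rw [Nat.digits_length_le_iff one_lt_two]
      have : 2 ^ (2 * k + 4) = 16 * 2 ^ (2 * k) := by ring
      omega
    calc P * (Nat.digits 2 (2 * P)).length ≤ (16 * (k * k)) * (8 * k) :=
          Nat.mul_le_mul (by omega) (by omega)
      _ = 128 * k ^ 3 * 1 := by ring
      _ ≤ _ := Nat.mul_le_mul_left _ hL
  -- Here `q - 1` violates the digit condition, so `p` is at most of order `k ^ 2 * log n / log p`.
  -- The denominator cancels the binary length of the prime, and the product is linear in `log n`.
  · obtain ⟨p, rfl⟩ : ∃ p, q = p + 1 := ⟨q - 1, by omega⟩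
    have hp := hmin p (by omega)
    rw [mul_assoc] at hp
    have hp8 : 8 * (k * k) ≤ p := by omega
    have hpk : p ≤ k * k * (Nat.digits p n).length := by
      by_contra h; exact hp ⟨hp8, by omega⟩
    rw [Nat.length_digits _ _ (by omega) hn] at hpk
    set e := Nat.log p n with he
    have he1 : 1 ≤ e := by
      by_contra h
      have : e = 0 := by omega
      rw [this] at hpk
      omega
    set l := Nat.log 2 p with hl
    have hl3 : 3 ≤ l := Nat.le_log_of_pow_le one_lt_two (by omega)
    have hle : l * e ≤ Nat.log 2 n := by
      apply Nat.le_log_of_pow_le one_lt_two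
      rw [pow_mul]
      exact (Nat.pow_le_pow_left (Nat.pow_log_le_self 2 (by omega)) e).trans
        (Nat.pow_log_le_self p hn)
    have hlen : (Nat.digits 2 (2 * P)).length ≤ 5 * l := by
      refine le_trans ((Nat.digits_length_le_iff one_lt_two (2 * P)).2 (?_ : _ < 2 ^ (l + 4)))
        (by omega)
      have h1 : p < 2 ^ (l + 1) := Nat.lt_pow_succ_log_self one_lt_two p
      have : 2 ^ (l + 4) = 8 * 2 ^ (l + 1) := by ring
      omega
    calc P * (Nat.digits 2 (2 * P)).length ≤ (4 * p) * (5 * l) :=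
          Nat.mul_le_mul (by omega) hlen
      _ ≤ (4 * (k * k * (e + e))) * (5 * l) := by gcongr; exact hpk.trans (by gcongr)
      _ = 40 * (k * k) * (l * e) := by ring
      _ ≤ 128 * (k * k * k) * (Nat.log 2 n + 1) := by
        gcongr
        · norm_num
        · exact Nat.le_mul_of_pos_right _ hk
        · omega
      _ = _ := by rw [hk3]

/-- Powers of logarithms are small. -/
theorem log_pow_mul_le {n : ℕ} (hn : n ≠ 0) {j : ℕ} (hj : 0 < j) (B : ℕ) :
    (Nat.log 2 n + 1) ^ j * B ≤ (2 * j) ^ (2 * j) * B ^ 2 + 2 * n := by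
  set L := Nat.log 2 n + 1 with hL
  have h2 : 2 ^ L ≤ 2 * n := by
    rw [hL, pow_succ, mul_comm]
    exact Nat.mul_le_mul_left _ (Nat.pow_log_le_self 2 hn)
  have hdiv : L ≤ 2 * j * 2 ^ (L / (2 * j)) := by
    have h1 : L / (2 * j) + 1 ≤ 2 ^ (L / (2 * j)) := Nat.lt_two_pow_self
    have h3 : L < 2 * j * (L / (2 * j) + 1) := Nat.lt_mul_div_succ L (by omega)
    exact h3.le.trans (Nat.mul_le_mul_left _ h1)
  have hpow : L ^ (2 * j) ≤ (2 * j) ^ (2 * j) * (2 * n) := by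
    calc L ^ (2 * j) ≤ (2 * j * 2 ^ (L / (2 * j))) ^ (2 * j) := Nat.pow_le_pow_left hdiv _
      _ = (2 * j) ^ (2 * j) * 2 ^ (L / (2 * j) * (2 * j)) := by rw [mul_pow, ← pow_mul]
      _ ≤ (2 * j) ^ (2 * j) * 2 ^ L := by
        gcongr
        · norm_num
        · exact Nat.div_mul_le_self _ _
      _ ≤ _ := by gcongr
  -- From `x ^ 2 ≤ a * b` follows `x ≤ a + b`; this trades the power of the logarithm for a term
  -- linear in `n`.
  have hsq : (L ^ j * B) ^ 2 ≤ ((2 * j) ^ (2 * j) * B ^ 2) * (2 * n) := by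
    calc (L ^ j * B) ^ 2 = L ^ (2 * j) * B ^ 2 := by rw [mul_pow, ← pow_mul, mul_comm j 2]
      _ ≤ ((2 * j) ^ (2 * j) * (2 * n)) * B ^ 2 := by gcongr
      _ = _ := by ring
  generalize (2 * j) ^ (2 * j) * B ^ 2 = a at *
  generalize L ^ j * B = x at *
  by_contra h
  push Not at h
  nlinarith

/-- Bound for all costs that do not depend on `n` directly. -/
theorem prime_pow_mul_le {n k P H : ℕ} (hn : n ≠ 0) (hk : 0 < k)
    (hP : P ≤ 128 * k ^ 3 * (Nat.log 2 n + 1)) :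
    ((2 * P) ^ k) ^ 6 * H ^ 2 ≤ (3072 * k ^ 4) ^ (12 * k) * H ^ 4 + 2 * n := by
  calc ((2 * P) ^ k) ^ 6 * H ^ 2 = (2 * P) ^ (6 * k) * H ^ 2 := by rw [← pow_mul, mul_comm k 6]
    _ ≤ (256 * k ^ 3 * (Nat.log 2 n + 1)) ^ (6 * k) * H ^ 2 := by
      refine Nat.mul_le_mul_right _ (Nat.pow_le_pow_left ?_ _)
      linarith
    _ = (Nat.log 2 n + 1) ^ (6 * k) * ((256 * k ^ 3) ^ (6 * k) * H ^ 2) := by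
      rw [mul_pow (256 * k ^ 3)]; ring
    _ ≤ (2 * (6 * k)) ^ (2 * (6 * k)) * ((256 * k ^ 3) ^ (6 * k) * H ^ 2) ^ 2 + 2 * n :=
      log_pow_mul_le hn (by omega) _
    _ = (12 * k) ^ (12 * k) * (256 * k ^ 3) ^ (12 * k) * H ^ 4 + 2 * n := by
      rw [mul_pow ((256 * k ^ 3) ^ (6 * k)), ← pow_mul (256 * k ^ 3), ← pow_mul H, ← mul_assoc,
        ← mul_assoc 2 6 k, mul_comm (6 * k) 2, ← mul_assoc 2 6 k]
      norm_num
    _ = (3072 * k ^ 4) ^ (12 * k) * H ^ 4 + 2 * n := by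
      rw [← mul_pow]; congr 3; ring

/-- The cap at `s - 1` enters here: for `dd > 0` both `dd` and the constants are bounded by powers
of `s`, with exponent `728 = 20 * 36 + 8`. For `dd = 0` no power of `s` is available, and `3072 ^ 12
≤ 2 ^ 144` is used. -/
theorem depth_pow_le {d s dd N : ℕ} (hs : 0 < s) (hdd : dd = min d (s - 1)) (hN : N < s) :
    (3072 * (2 * dd + 1) ^ 4) ^ (12 * (2 * dd + 1)) * ((2 * N + 1) ^ dd) ^ 4 ≤
      2 ^ 144 * s ^ (728 * dd) := by
  rcases Nat.eq_zero_or_pos dd with rfl | h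
  · norm_num
  have hs2 : 2 ≤ s := by omega
  have h1 : 3072 * (2 * dd + 1) ^ 4 ≤ s ^ 20 := by
    calc 3072 * (2 * dd + 1) ^ 4 ≤ 4096 * (2 * s) ^ 4 := by gcongr <;> omega
      _ = 2 ^ 16 * s ^ 4 := by ring
      _ ≤ s ^ 16 * s ^ 4 := by gcongr
      _ = s ^ 20 := by ring
  have h2 : 2 * N + 1 ≤ s ^ 2 := by nlinarith
  calc _ ≤ (s ^ 20) ^ (12 * (3 * dd)) * ((s ^ 2) ^ dd) ^ 4 := by
        gcongr ?_ * ?_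
        · exact (Nat.pow_le_pow_left h1 _).trans
            (Nat.pow_le_pow_right (by positivity) (by omega))
        · gcongr
    _ = s ^ (728 * dd) := by
      rw [← pow_mul, ← pow_mul, ← pow_mul, ← pow_add]; congr 1; ring
    _ ≤ _ := Nat.le_mul_of_pos_left _ (by positivity)

end DTLearn

/-! ### Total time and total number of queries -/

namespace DTLearn

variable {n : ℕ}

theorem rounds_le_pow {k P : ℕ} (hk : 0 < k) (hP : 8 * k * k ≤ P) :
    rounds k P ≤ ((2 * P) ^ k) ^ 3 := by
  have hP1 : 1 ≤ P := by nlinarith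
  have hlen := length_digits_le one_lt_two (2 * P)
  have hX : 2 * P ≤ (2 * P) ^ k := Nat.le_self_pow hk.ne' _
  have h2 : 2 ^ k ≤ (2 * P) ^ k := Nat.pow_le_pow_left (by omega) k
  calc rounds k P = 4 * (k * k) * 2 ^ k * (Nat.digits 2 (2 * P)).length := by unfold rounds; ring
    _ ≤ (2 * P) * (2 * P) ^ k * (2 * P) :=
      Nat.mul_le_mul (Nat.mul_le_mul (by nlinarith) h2) hlen
    _ ≤ (2 * P) ^ k * (2 * P) ^ k * (2 * P) ^ k := by gcongr
    _ = _ := by ring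

/-- The terms containing `n` are charged to the query bound times `n`. Table construction, greedy
phase and dynamic program contribute at most a constant times `X ^ 6 * H ^ 2` with `X = (2 * P) ^ k`
and `H = (2 * N + 1) ^ dd`. -/
theorem learnTime_le {k dd P N : ℕ} (hn : 0 < n) (hk : k = 2 * dd + 1) (hP : 8 * k * k ≤ P)
    (hN : N ≤ (2 * N + 1) ^ dd) :
    learnTime n k dd P N ≤ 120 * (P * rounds k P * 2 + N * (2 + Nat.clog 2 n)) * n +
      2000 * (((2 * P) ^ k) ^ 6 * ((2 * N + 1) ^ dd) ^ 2) := by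
  have hk0 : 0 < k := by omega
  have hkP : k ≤ P := by nlinarith
  have hP1 : 1 ≤ P := by omega
  have hR := rounds_le_pow hk0 hP
  have hR1 : 1 ≤ rounds k P := by
    have : 0 < (Nat.digits 2 (2 * P)).length := by
      rw [Nat.length_digits _ _ one_lt_two (by omega)]; omega
    unfold rounds; exact Nat.one_le_iff_ne_zero.2 (by positivity)
  have hPX : P ≤ (2 * P) ^ k := (by omega : P ≤ 2 * P).trans (Nat.le_self_pow hk0.ne' _)
  have hPk : P ^ k ≤ (2 * P) ^ k := Nat.pow_le_pow_left (by omega) k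
  have h2 : 2 ^ dd ≤ (2 * P) ^ k :=
    (Nat.pow_le_pow_right (by omega) (by omega)).trans
      (Nat.pow_le_pow_left (by omega : 2 ≤ 2 * P) k)
  have hH1 : 1 ≤ (2 * N + 1) ^ dd := Nat.one_le_pow _ _ (by omega)
  have hPR : P ≤ P * rounds k P := Nat.le_mul_of_pos_right _ hR1
  unfold learnTime
  generalize (2 * P) ^ k = X at *
  generalize (2 * N + 1) ^ dd = H at *
  generalize rounds k P = R at *
  generalize P ^ k = Y at *
  generalize 2 ^ dd = D at *
  generalize Nat.clog 2 n = cl at *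
  have hX1 : 1 ≤ X := by omega
  have hH2 : 1 ≤ H ^ 2 := Nat.one_le_pow _ _ hH1
  have hE : ∀ j ≤ 6, X ^ j ≤ X ^ 6 * H ^ 2 := fun j hj =>
    (Nat.pow_le_pow_right hX1 hj).trans (Nat.le_mul_of_pos_right _ hH2)
  have e0 := hE 0 (by omega)
  have e1 := hE 1 (by omega)
  have e2 := hE 2 (by omega)
  have e6 := hE 6 (by omega)
  rw [pow_zero] at e0
  rw [pow_one] at e1
  have hdd : dd ≤ X := by omega
  have hkX : k ≤ X := by omega
  have b1 : P * P ≤ X ^ 2 := by rw [sq]; gcongr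
  have b2 : P * Y ≤ X ^ 2 := by rw [sq]; gcongr
  have b3 : R * (Y * (X * (k * 60 + 40) + 40) + X * (k * 60 + 40) + 40) ≤ 280 * X ^ 6 := by
    have c1 : k * 60 + 40 ≤ 100 * X := by omega
    have c2 : 40 ≤ 40 * X ^ 2 := Nat.le_mul_of_pos_right _ (Nat.one_le_pow _ _ hX1)
    have c3 : X * (k * 60 + 40) ≤ X * (100 * X) * X :=
      (Nat.mul_le_mul_left _ c1).trans (Nat.le_mul_of_pos_right _ hX1)
    have c4 : 40 ≤ 40 * X ^ 3 := Nat.le_mul_of_pos_right _ (Nat.one_le_pow _ _ hX1)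
    calc _ ≤ X ^ 3 * (X * (X * (100 * X) + 40 * X ^ 2) + X * (100 * X) * X + 40 * X ^ 3) :=
          Nat.mul_le_mul hR (add_le_add (add_le_add (Nat.mul_le_mul hPk
            (add_le_add (Nat.mul_le_mul_left _ c1) c2)) c3) c4)
      _ = 280 * X ^ 6 := by ring
  have b4 : H * (P * R * (H * 60 + 30) + N * 60 + 80) ≤ 230 * (X ^ 6 * H ^ 2) := by
    calc _ ≤ H * (X * X ^ 3 * (H * 60 + 30 * H) + H * 60 + 80 * H) := by
          gcongr
          · exact Nat.le_mul_of_pos_right _ hH1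
          · exact Nat.le_mul_of_pos_right _ hH1
      _ = 90 * (X ^ 4 * H ^ 2) + 140 * (1 * H ^ 2) := by ring
      _ ≤ 90 * (X ^ 6 * H ^ 2) + 140 * (X ^ 6 * H ^ 2) := by
        have := Nat.pow_le_pow_right hX1 (by norm_num : 4 ≤ 6)
        have := Nat.one_le_pow 6 X hX1
        gcongr
      _ = _ := by ring
  have b5 : N * (n * 120 + 80 + cl * (n * 60 + 40)) ≤ N * (2 + cl) * n * 100 := by
    calc _ ≤ N * (n * 120 + 80 * n + cl * (n * 60 + 40 * n)) := by
          gcongr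
          · exact Nat.le_mul_of_pos_right _ hn
          · exact Nat.le_mul_of_pos_right _ hn
      _ = _ := by ring
  have b6 : P * n ≤ P * R * n := Nat.mul_le_mul_right _ hPR
  have b7 : P * R ≤ P * R * n := Nat.le_mul_of_pos_right _ hn
  generalize X ^ 6 * H ^ 2 = E at *
  have b8 : 0 ≤ N * (2 + cl) * n := by positivity
  nlinarith

/-- The factor `2 ^ k = 2 * 4 ^ dd` of the rounds gives `2 ^ (2 * d)`; the prime times its length
gives `k ^ 3 * log n`. The samples account for the constant 2048 and the binary searches for 3. -/
theorem queries_le {k dd d P N : ℕ} (hk : k = 2 * dd + 1) (hd : dd ≤ d) (hN : N ≤ 2 ^ dd)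
    (hP : P * (Nat.digits 2 (2 * P)).length ≤ 128 * k ^ 3 * (Nat.log 2 n + 1)) :
    P * rounds k P * 2 + N * (2 + Nat.clog 2 n) ≤
      2051 * (2 * d + 1) ^ 5 * 2 ^ (2 * d) * (Nat.log 2 n + 1) := by
  have hcl : Nat.clog 2 n ≤ Nat.log 2 n + 1 :=
    Nat.clog_le_of_le_pow (Nat.lt_pow_succ_log_self one_lt_two n).le
  have hkd : k ≤ 2 * d + 1 := by omega
  have h1 : 1 ≤ (2 * d + 1) ^ 5 := Nat.one_le_pow _ _ (by omega)
  have hN' : N ≤ 2 ^ (2 * d) := hN.trans (Nat.pow_le_pow_right (by omega) (by omega))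
  calc P * rounds k P * 2 + N * (2 + Nat.clog 2 n)
      = 16 * k ^ 2 * 2 ^ (2 * dd) * (P * (Nat.digits 2 (2 * P)).length) +
          N * (2 + Nat.clog 2 n) := by
        unfold rounds
        rw [hk, pow_succ 2 (2 * dd)]; ring
    _ ≤ 16 * (2 * d + 1) ^ 2 * 2 ^ (2 * d) * (128 * (2 * d + 1) ^ 3 * (Nat.log 2 n + 1)) +
          2 ^ (2 * d) * (3 * (Nat.log 2 n + 1)) := by
        refine add_le_add (Nat.mul_le_mul ?_ (hP.trans ?_)) (Nat.mul_le_mul hN' (by omega))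
        · gcongr; norm_num
        · gcongr
    _ = 2048 * (2 * d + 1) ^ 5 * 2 ^ (2 * d) * (Nat.log 2 n + 1) +
          3 * 1 * 2 ^ (2 * d) * (Nat.log 2 n + 1) := by ring
    _ ≤ 2048 * (2 * d + 1) ^ 5 * 2 ^ (2 * d) * (Nat.log 2 n + 1) +
          3 * (2 * d + 1) ^ 5 * 2 ^ (2 * d) * (Nat.log 2 n + 1) := by gcongr
    _ = _ := by ring

/-- The exponent of the query bound besides `2 * d`. -/
noncomputable def slack (d : ℕ) : ℝ := Real.logb 2 (4102 * (2 * d + 1) ^ 5)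

/-- The slack is even logarithmic, at most `23 + 5 * log d`; from `d = 2` on the logarithm is at
least 1 and squaring it only helps. -/
theorem slack_isBigO :
    Asymptotics.IsBigO Filter.atTop slack (fun d : ℕ => (Real.logb 2 (d : ℝ)) ^ 2) := by
  refine Asymptotics.IsBigO.of_bound 28 ?_
  filter_upwards [Filter.eventually_ge_atTop 2] with d hd
  have hd' : (2 : ℝ) ≤ d := by exact_mod_cast hd
  have h1 : 1 ≤ Real.logb 2 d := by
    rw [Real.le_logb_iff_rpow_le one_lt_two (by linarith)]; simpa using hd'
  have h0 : (1 : ℝ) ≤ 4102 * (2 * d + 1) ^ 5 := by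
    have : (1 : ℝ) ≤ (2 * d + 1) ^ 5 := one_le_pow₀ (by linarith)
    linarith
  have h2 : slack d ≤ 23 + 5 * Real.logb 2 d := by
    have : (4102 : ℝ) * (2 * d + 1) ^ 5 ≤ 2 ^ 13 * (2 ^ 2 * d) ^ 5 := by
      gcongr
      · norm_num
      · linarith
    refine (Real.logb_le_logb_of_le one_lt_two (by linarith) this).trans_eq ?_
    have e : ((2 : ℝ) ^ 13 * (2 ^ 2 * d) ^ 5) = 2 ^ 23 * (d : ℝ) ^ 5 := by ring
    rw [e, Real.logb_mul (by positivity) (by positivity), Real.logb_pow, Real.logb_pow,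
      Real.logb_self_eq_one one_lt_two]
    norm_num
  have h3 : 0 ≤ slack d := Real.logb_nonneg one_lt_two h0
  rw [Real.norm_of_nonneg h3, Real.norm_of_nonneg (by positivity)]
  nlinarith

theorem two_rpow_slack (d : ℕ) :
    (2 : ℝ) ^ (2 * (d : ℝ) + slack d) = 4102 * (2 * d + 1) ^ 5 * 2 ^ (2 * d) := by
  rw [Real.rpow_add two_pos, slack, Real.rpow_logb two_pos (by norm_num) (by positivity),
    mul_comm]
  congr 1
  exact_mod_cast Real.rpow_natCast 2 (2 * d)

theorem log_add_one_le_logb (hn : 2 ≤ n) : ((Nat.log 2 n + 1 : ℕ) : ℝ) ≤ 2 * Real.logb 2 n := by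
  have h1 : (1 : ℕ) ≤ Nat.log 2 n := Nat.le_log_of_pow_le one_lt_two (by simpa using hn)
  have h2 : ((Nat.log 2 n : ℕ) : ℝ) ≤ Real.logb 2 n := by
    exact_mod_cast Real.natLog_le_logb n 2
  have h1' : (1 : ℝ) ≤ (Nat.log 2 n : ℕ) := by exact_mod_cast h1
  push_cast
  linarith

end DTLearn

/-! ### Word size and the final estimate -/

namespace DTLearn

variable {n : ℕ}

theorem small_init {w d s : ℕ} (h : 64 ≤ w) (hn : n < w) (hd : d < w) (hs : s < w) :
    Small w (init n d s) where
  large := h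
  reg x := by
    simp only [init]
    split_ifs <;> omega
  arr a i := by
    change 0 < w
    omega

/-- The costs that do not depend on `n` directly fit into a word. -/
theorem lt_word {n d s dd c E W : ℕ} (hn : 2 ≤ n) (hs : 0 < s) (hdd : dd ≤ d) (hc : 2 ^ 200 ≤ c)
    (hE : E ≤ 2 ^ 144 * s ^ (728 * dd) + 2 * n) (hW : W = n * (s + 2) ^ (d + 1)) :
    10 * E * n < W ^ c ∧ 16 * W < W ^ c := by
  have h1 : 1 ≤ (s + 2) ^ d := Nat.one_le_pow _ _ (by omega)
  have hW' : W = n * ((s + 2) ^ d * (s + 2)) := by rw [hW, pow_succ]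
  have hnW : 3 * n ≤ W := by
    rw [hW']
    have : 1 * 3 ≤ (s + 2) ^ d * (s + 2) := Nat.mul_le_mul h1 (by omega)
    nlinarith
  have hsW : s ^ dd ≤ W := by
    calc s ^ dd ≤ (s + 2) ^ dd := Nat.pow_le_pow_left (by omega) _
      _ ≤ (s + 2) ^ (d + 1) := Nat.pow_le_pow_right (by omega) (by omega)
      _ ≤ W := by rw [hW]; exact Nat.le_mul_of_pos_left _ (by omega)
  have hW6 : 6 ≤ W := by omega
  have hc' : 900 ≤ c := le_trans (by norm_num) hc
  -- `872 = 144 + 728`: the base 2 is replaced by `W`, and `s ^ dd ≤ W`.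
  have hE' : E ≤ 2 * W ^ 872 := by
    calc E ≤ 2 ^ 144 * s ^ (728 * dd) + 2 * n := hE
      _ ≤ W ^ 144 * W ^ 728 + W ^ 1 := by
        refine add_le_add (Nat.mul_le_mul (Nat.pow_le_pow_left (by omega) _) ?_) ?_
        · exact (pow_mul' s 728 dd).le.trans (Nat.pow_le_pow_left hsW _)
        · rw [pow_one]; omega
      _ ≤ W ^ 872 + W ^ 872 := by
        rw [← pow_add]
        gcongr
        · omega
        · norm_num
      _ = _ := by ring
  have hlt : W ^ 875 < W ^ c := Nat.pow_lt_pow_right (by omega) (by omega)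
  constructor
  · refine lt_of_le_of_lt ?_ hlt
    calc 10 * E * n ≤ 10 * (2 * W ^ 872) * W := by gcongr; omega
      _ = 20 * W ^ 873 := by ring
      _ ≤ W ^ 2 * W ^ 873 := by gcongr; nlinarith
      _ = W ^ 875 := by rw [← pow_add]
  · refine lt_of_le_of_lt ?_ hlt
    calc 16 * W ≤ W * W * W := by gcongr; nlinarith
      _ = W ^ 3 := by ring
      _ ≤ W ^ 875 := Nat.pow_le_pow_right (by omega) (by norm_num)

/-- The query bound `M` is exposed with `0 < M` so that terms linear in `n` can be charged to `M *
n`, and `dd` because `dd = 0` needs a separate estimate. -/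
theorem learn_spec {d s c : ℕ} (hn : 2 ≤ n) (hc : 2 ^ 200 ≤ c) {T₀ : DTree n}
    (hT₀ : T₀ ∈ DT n d s) :
    ∃ (σ : State) (t m M dd : ℕ) (T : DTree n),
      Exec ((n * (s + 2) ^ (d + 1)) ^ c) T₀.eval learn (init n d s) σ t m ∧ Outputs σ T ∧
      T ∈ DT n d s ∧ T.eval = T₀.eval ∧ dd = min d (s - 1) ∧ m ≤ M ∧ 0 < M ∧
      M ≤ 2051 * (2 * d + 1) ^ 5 * 2 ^ (2 * d) * (Nat.log 2 n + 1) ∧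
      t ≤ 120 * M * n + 2000 * (2 ^ 144 * s ^ (728 * dd) + 2 * n) := by
  obtain ⟨hd, hs⟩ := hT₀
  have hs0 : 0 < s := T₀.size_pos.trans_le hs
  obtain ⟨dd, hdd⟩ : ∃ dd, dd = min d (s - 1) := ⟨_, rfl⟩
  obtain ⟨k, hk⟩ : ∃ k, k = 2 * dd + 1 := ⟨_, rfl⟩
  obtain ⟨P, hP, hPlen⟩ := exists_goodPrime (n := n) (k := k) (by omega) (by omega)
  obtain ⟨N, hN⟩ : ∃ N, N = T₀.vars.card := ⟨_, rfl⟩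
  have hd' : T₀.depth ≤ dd := by have := T₀.depth_lt_size; omega
  have hNsize : N < T₀.size := hN ▸ T₀.card_vars_lt_size
  have h2dd : T₀.size ≤ 2 ^ dd :=
    T₀.size_le_two_pow.trans (Nat.pow_le_pow_right (by omega) hd')
  have hNs : N < s := by omega
  have hNH : N ≤ (2 * N + 1) ^ dd := by
    rcases Nat.eq_zero_or_pos dd with h | h
    · rw [h] at h2dd; rw [h]; omega
    · exact (by omega : N ≤ 2 * N + 1).trans (Nat.le_self_pow h.ne' _)
  have hPpos := hP.prime.pos
  have hlen : 0 < (Nat.digits 2 (2 * P)).length := by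
    rw [Nat.length_digits _ _ one_lt_two (by omega)]; omega
  have hPle : P ≤ 128 * k ^ 3 * (Nat.log 2 n + 1) :=
    (Nat.le_mul_of_pos_right _ hlen).trans hPlen
  have hE := (prime_pow_mul_le (H := (2 * N + 1) ^ dd) (by omega) (by omega) hPle).trans
    (Nat.add_le_add_right (hk ▸ depth_pow_le hs0 hdd hNs) _)
  obtain ⟨hw, hw'⟩ := lt_word hn hs0 (by omega : dd ≤ d) hc hE rfl
  have hR := rounds_le_pow (by omega) hP.large
  have hkP : k * k * 8 ≤ P := by have := hP.large; linarith
  have hPX : 2 * P ≤ (2 * P) ^ k := Nat.le_self_pow (by omega) _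
  have hPk : P ^ k ≤ (2 * P) ^ k := Nat.pow_le_pow_left (by omega) k
  have hH1 : 1 ≤ (2 * N + 1) ^ dd := Nat.one_le_pow _ _ (by omega)
  have hW₁ : 2 ^ (d + 1) * n ≤ n * (s + 2) ^ (d + 1) := by
    rw [mul_comm]; gcongr; omega
  have hW₂ : (s + 2) * n ≤ n * (s + 2) ^ (d + 1) := by
    rw [mul_comm]; gcongr; exact Nat.le_self_pow (by omega) _
  have hd2 : d + 1 < 2 ^ (d + 1) := Nat.lt_two_pow_self
  have hdn : (d + 2) * 2 ≤ 2 ^ (d + 1) * n := Nat.mul_le_mul (by omega) hn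
  have hsn : (s + 2) * 2 ≤ (s + 2) * n := Nat.mul_le_mul_left _ hn
  have hsn' : 3 * n ≤ (s + 2) * n := Nat.mul_le_mul_right _ (by omega)
  have hk1 : 1 ≤ k * k := Nat.mul_pos (by omega) (by omega)
  have hkk : k ≤ k * k := Nat.le_mul_of_pos_left _ (by omega)
  have hlearn : Runs ((n * (s + 2) ^ (d + 1)) ^ c) T₀.eval learn (init n d s)
      (learnTime n k dd P N) (P * rounds k P * 2 + N * (2 + Nat.clog 2 n))
      fun σ' => ∃ T : DTree n, Outputs σ' T ∧ T.depth ≤ dd ∧ T.size ≤ s ∧ T.eval = T₀.eval := by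
    -- With the powers opaque, the word bounds become linear inequalities, mostly between monomials
    -- dominated by `E`.
    generalize (n * (s + 2) ^ (d + 1)) ^ c = w at *
    generalize n * (s + 2) ^ (d + 1) = W at *
    clear hE
    have hX1 : 1 ≤ (2 * P) ^ k := by omega
    have hXE : ∀ j ≤ 6, ((2 * P) ^ k) ^ j * n ≤
        ((2 * P) ^ k) ^ 6 * ((2 * N + 1) ^ dd) ^ 2 * n := fun j hj =>
      Nat.mul_le_mul_right _ ((Nat.pow_le_pow_right hX1 hj).trans
        (Nat.le_mul_of_pos_right _ (Nat.one_le_pow _ _ hH1)))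
    have hHE : ((2 * N + 1) ^ dd) ^ 2 * 1 ≤
        ((2 * P) ^ k) ^ 6 * ((2 * N + 1) ^ dd) ^ 2 * n :=
      Nat.mul_le_mul (Nat.le_mul_of_pos_left _ (Nat.one_le_pow _ _ hX1)) (by omega)
    have x1 := hXE 1 (by omega)
    have x2 := hXE 2 (by omega)
    have x4 := hXE 4 (by omega)
    rw [pow_one] at x1
    rw [mul_assoc] at hw
    generalize ((2 * P) ^ k) ^ 6 * ((2 * N + 1) ^ dd) ^ 2 * n = E at *
    have y1 : (2 * P) ^ k ≤ (2 * P) ^ k * n := Nat.le_mul_of_pos_right _ (by omega)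
    have y2 : ((2 * P) ^ k) ^ 2 ≤ ((2 * P) ^ k) ^ 2 * n := Nat.le_mul_of_pos_right _ (by omega)
    have y4 : ((2 * P) ^ k) ^ 4 ≤ ((2 * P) ^ k) ^ 4 * n := Nat.le_mul_of_pos_right _ (by omega)
    have z1 : P * rounds k P ≤ ((2 * P) ^ k) ^ 4 := by
      calc _ ≤ (2 * P) ^ k * ((2 * P) ^ k) ^ 3 := Nat.mul_le_mul (by omega) hR
        _ = _ := by ring
    have z2 : P * n ≤ (2 * P) ^ k * n := Nat.mul_le_mul_right _ (by omega)
    have z3 : P * P ^ k ≤ ((2 * P) ^ k) ^ 2 := by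
      rw [sq]; exact Nat.mul_le_mul (by omega) hPk
    have z4 : P * P ≤ ((2 * P) ^ k) ^ 2 := by
      rw [sq]; exact Nat.mul_le_mul (by omega) (by omega)
    have z5 : P * k ≤ ((2 * P) ^ k) ^ 2 := by
      rw [sq]; exact Nat.mul_le_mul (by omega) (by omega)
    have z6 : k * k * n ≤ (2 * P) ^ k * n := Nat.mul_le_mul_right _ (by omega)
    have z7 : N * (2 * N + 1) ^ dd ≤ ((2 * N + 1) ^ dd) ^ 2 := by
      rw [sq]; exact Nat.mul_le_mul_right _ hNH
    have z8 : N ≤ N * (2 * N + 1) ^ dd := Nat.le_mul_of_pos_right _ hH1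
    refine runs_learn hdd hk hP hd hs hN.ge (by omega) (by omega) ?_ (by omega) ?_ (by omega)
      (by omega) (by omega) (by omega) ?_ (by omega)
    · rw [mul_add]; omega
    · rw [mul_left_comm]; omega
    · rw [mul_assoc]; omega
  obtain ⟨σ, t, m, hexec, ht, hm, T, hout, hTd, hTs, hTe⟩ := hlearn
    (small_init (by omega) (by omega) (by omega) (by omega))
  refine ⟨σ, t, m, _, dd, T, hexec, hout, ⟨by omega, hTs⟩, hTe, hdd, hm, ?_,
    queries_le hk (by omega) (by omega) hPlen, ht.trans ((learnTime_le (by omega) hk hP.large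
      hNH).trans (Nat.add_le_add_left (Nat.mul_le_mul_left _ hE) _))⟩
  have : 0 < rounds k P := by unfold rounds; rw [hk]; positivity
  positivity

end DTLearn

theorem mainTheorem5 :
    ∃ (P : DTLearn.Prog) (c : ℕ) (g : ℕ → ℝ) (m : ℕ → ℕ → ℝ),
      Asymptotics.IsBigO Filter.atTop g (fun d : ℕ => (Real.logb 2 (d : ℝ)) ^ 2) ∧
      (∀ n d : ℕ, m n d = (2 : ℝ) ^ (2 * (d : ℝ) + g d) * Real.logb 2 (n : ℝ)) ∧
      ∀ n d s : ℕ, 2 ≤ n → ∀ T₀ ∈ DTLearn.DT n d s,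
        DTLearn.LearnsExactlyProperly P ((n * (s + 2) ^ (d + 1)) ^ c) n d s T₀.eval
          (m n d) ((s : ℝ) ^ (c * d) + c * (m n d * n)) := by
  -- Any large constant works: it has to exceed `2000 * 2 ^ 144` with some room, and 1000 as an
  -- exponent. Its value is hidden to prevent evaluation of the powers.
  obtain ⟨c, hc⟩ : ∃ c : ℕ, 2 ^ 200 ≤ c := ⟨_, le_rfl⟩
  refine ⟨DTLearn.learn, c, DTLearn.slack, _, DTLearn.slack_isBigO, fun n d => rfl, ?_⟩
  intro n d s hn T₀ hT₀
  obtain ⟨σ, t, m, M, dd, T, hexec, hout, hT, hTe, hdd, hm, hM0, hM, ht⟩ :=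
    DTLearn.learn_spec hn hc hT₀
  have hs0 : 0 < s := T₀.size_pos.trans_le hT₀.2
  set μ : ℝ := (2 : ℝ) ^ (2 * (d : ℝ) + DTLearn.slack d) * Real.logb 2 (n : ℝ) with hμ
  have hMμ : (M : ℝ) ≤ μ := by
    rw [hμ, DTLearn.two_rpow_slack]
    calc (M : ℝ) ≤ ((2051 * (2 * d + 1) ^ 5 * 2 ^ (2 * d) * (Nat.log 2 n + 1) : ℕ) : ℝ) := by
          exact_mod_cast hM
      _ = 2051 * (2 * d + 1) ^ 5 * 2 ^ (2 * d) * ((Nat.log 2 n + 1 : ℕ) : ℝ) := by push_cast; ring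
      _ ≤ 2051 * (2 * d + 1) ^ 5 * 2 ^ (2 * d) * (2 * Real.logb 2 n) := by
          gcongr; exact DTLearn.log_add_one_le_logb hn
      _ = _ := by ring
  refine ⟨σ, t, m, T, hexec, hout, hT, hTe, le_trans (by exact_mod_cast hm) hMμ, ?_⟩
  have hnat : t ≤ s ^ (c * d) + c * (M * n) := by
    have hMn : n ≤ M * n := Nat.le_mul_of_pos_left _ hM0
    have hcM : 2 ^ 200 * (M * n) ≤ c * (M * n) := Nat.mul_le_mul_right _ hc
    have hMn' : 120 * M * n = 120 * (M * n) := mul_assoc _ _ _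
    -- For `dd = 0` the power of `s` may be as small as 1, so the constants are charged to `c * (M *
    -- n)`; otherwise `s ≥ 2` and they are absorbed into `s ^ (c * d)`.
    rcases Nat.eq_zero_or_pos dd with h | h
    · rw [h, mul_zero, pow_zero] at ht
      omega
    · have hs2 : 2 ≤ s := by omega
      have hpow : 2000 * (2 ^ 144 * s ^ (728 * dd)) ≤ s ^ (c * d) := by
        calc 2000 * (2 ^ 144 * s ^ (728 * dd)) ≤ 2 ^ 155 * s ^ (728 * dd) := by
              rw [← mul_assoc]; gcongr; norm_num
          _ ≤ s ^ 155 * s ^ (728 * dd) := by gcongr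
          _ = s ^ (155 + 728 * dd) := by rw [← pow_add]
          _ ≤ s ^ (c * d) := by
            apply Nat.pow_le_pow_right (by omega)
            have : 1000 * d ≤ c * d := Nat.mul_le_mul_right _ (le_trans (by norm_num) hc)
            omega
      generalize s ^ (c * d) = A at *
      omega
  calc (t : ℝ) ≤ ((s ^ (c * d) + c * (M * n) : ℕ) : ℝ) := by exact_mod_cast hnat
    _ = (s : ℝ) ^ (c * d) + c * (M * n) := by push_cast; ring
    _ ≤ _ := by gcongr
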